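/- Let $\tau=\frac{1+\sqrt5}{2}$. The fundamental tetrahedra $t_1,\dots,t_6$ are the tetrahedra with vertices $a,b,c,d$ and edge lengths $(ab,ac,bc,ad,bd,cd)$ equal to $t_1:(1,1,1,1,1,\tau)$, $t_2:(1,1,1,\tau,\tau,1)$, $t_3:(\tau,\tau,\tau,1,1,1)$, $t_4:(1,1,1,\tau,\tau,\tau)$, $t_5:(\tau,\tau,\tau,\tau,1,1)$, $t_6:(1,\tau,\tau,\tau,\tau,\tau)$. Glueing fundamental tetrahedra along whole equilateral faces one obtains four composite tiles: $T_1=E+C$, where $E=t_4+t_1+t_4$, $C=t_3+t_6+t_3$, and the two $(1,\tau,\tau)$ faces of the $t_6$ in $C$ are matched with faces of the two $t_4$ in $E$; $T_2=t_2+t_4$; $T_3=t_5+t_6+t_5$ (the version with a pentagonal face of edge length $1$); and $T_4=t_3+t_6+t_5$, obtained from $T_3$ by replacing one $t_5$ by $t_3$. Their boundaries are made of Robinson triangles with edge lengths $(1,1,\tau)$ and $(1,\tau,\tau)$. A copy of a tile is an image under an isometry of $\mathbb{R}^3$ (mirror images allowed). A family of copies is called face-to-face if any two fundamental tetrahedra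 in it intersect exactly in the convex hull of their common vertices; in particular tiles are matched along whole Robinson triangles, edges and vertices. Such tiles exist in $\mathbb{R}^3$, and there is an inflation rule, i.e. a choice for each $i$ of a finite set $D_i$ of copies of $T_1,\dots,T_4$, with the following properties. (1) For each $i$, the tiles of $D_i$ have pairwise disjoint interiors, are face-to-face, and have union $\tau T_i$. The numbers of tiles of each type are given by $$\tau T_1=T_1+2T_2+2T_3+2T_4,\quad \tau T_2=2T_2+T_3,\quad \tau T_3=T_1+2T_2+T_3+T_4,\quad \tau T_4=T_1+T_2+T_3+T_4,$$ that is $\tau T_i=\sum_j M_{ij}T_j$ with $$M=\begin{pmatrix}1&2&2&2\\0&2&1&0\\1&2&1&1\\1&1&1&1\end{pmatrix}.$$ (2) Iterating the rule (scale everything by $\tau$ and replace every scaled tile by the corresponding copy of its dissection) $n$ times, starting from $T_i$, gives for all $n\ge 0$ and all $i$ a dissection of $\tau^nT_i$ into copies of the composite tiles with pairwise disjoint interiors, face-to-face, with exactly $(M^n)_{ij}$ tiles of type $T_j$. (3) Iterating the rule tiles all of $\mathbb{R}^3$: there is a face-to-face tiling of $\mathbb{R}^3$ by copies of $T_1,\dots,T_4$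 that is generated by the rule (each of its finite parts occurs, up to an isometry, in some $n$-fold inflated tile as in (2)) and is mapped to itself by some positive power of the inflation. (4) Every family of copies that is generated by the rule and covers $\mathbb{R}^3$ is a face-to-face tiling, and it is aperiodic: no nonzero translation maps the family of its tiles onto itself. -/

import Mathlib

open scoped Pointwise

namespace IcosahedralTiling

noncomputable section

/-- Euclidean 3-space. -/
abbrev E3 : Type := EuclideanSpace ℝ (Fin 3)

/-- The golden ratio, which is also the inflation factor. -/
abbrev tau : ℝ := Real.goldenRatio

/-! ### Fundamental tetrahedra -/

/-- Edge lengths of the fundamental tetrahedra `t₁, …, t₆` (row `i` is `t_{i+1}`) with vertices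
`a, b, c, d`, in the order `ab, ac, bc, ad, bd, cd`. -/
def fundamentalEdges : Fin 6 → Fin 6 → ℝ :=
  ![![1, 1, 1, 1, 1, tau],
    ![1, 1, 1, tau, tau, 1],
    ![tau, tau, tau, 1, 1, 1],
    ![1, 1, 1, tau, tau, tau],
    ![tau, tau, tau, tau, 1, 1],
    ![1, tau, tau, tau, tau, tau]]

/-- The points `a, b, c, d` are the vertices of a copy of the fundamental tetrahedron `t_{i+1}`. -/
def IsFundamental (i : Fin 6) (a b c d : E3) : Prop :=
  dist a b = fundamentalEdges i 0 ∧ dist a c = fundamentalEdges i 1 ∧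
  dist b c = fundamentalEdges i 2 ∧ dist a d = fundamentalEdges i 3 ∧
  dist b d = fundamentalEdges i 4 ∧ dist c d = fundamentalEdges i 5

/-- The tetrahedra `abcx` and `abcy` lie on strictly opposite sides of their common face `abc`. -/
def GluedAlong (a b c x y : E3) : Prop :=
  (affineSpan ℝ {a, b, c}).SOppSide x y

/-- A cluster of tetrahedra, each given by its vertex set, is a copy of the composite tile
`T_{i+1}`:
* `T₁ = E + C` with `E = t₄ + t₁ + t₄`, `C = t₃ + t₆ + t₃`, where the two `(1, τ, τ)` faces of the
  `t₆` of `C` are matched with faces of the two `t₄` of `E`;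
* `T₂ = t₂ + t₄`;
* `T₃ = t₅ + t₆ + t₅`, the version with a pentagonal face (the long edges `pr`, `ps` of the two
  `t₅` meet in one vertex `p`);
* `T₄ = t₃ + t₆ + t₅`, obtained from `T₃` by replacing one `t₅` by `t₃`.
All gluings inside `E`, `C`, `T₂`, `T₃`, `T₄` are along equilateral faces. -/
def IsComposite : Fin 4 → Set (Set E3) → Prop :=
  ![fun K => ∃ a b c d p q r s : E3,
      IsFundamental 0 a b c d ∧ IsFundamental 3 a b c p ∧ IsFundamental 3 a b d q ∧
      IsFundamental 5 a b p q ∧ IsFundamental 2 p q a r ∧ IsFundamental 2 p q b s ∧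
      GluedAlong a b c d p ∧ GluedAlong a b d c q ∧
      GluedAlong p q a b r ∧ GluedAlong p q b a s ∧
      GluedAlong a b p c q ∧ GluedAlong a b q d p ∧
      K = {{a, b, c, d}, {a, b, c, p}, {a, b, d, q}, {a, b, p, q}, {p, q, a, r}, {p, q, b, s}},
    fun K => ∃ a b c d p : E3,
      IsFundamental 1 a b c d ∧ IsFundamental 3 a b c p ∧
      GluedAlong a b c d p ∧
      K = {{a, b, c, d}, {a, b, c, p}},
    fun K => ∃ a b p q r s : E3,
      IsFundamental 5 a b p q ∧ IsFundamental 4 p q a r ∧ IsFundamental 4 p q b s ∧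
      GluedAlong p q a b r ∧ GluedAlong p q b a s ∧
      K = {{a, b, p, q}, {p, q, a, r}, {p, q, b, s}},
    fun K => ∃ a b p q r s : E3,
      IsFundamental 5 a b p q ∧ IsFundamental 4 p q a r ∧ IsFundamental 2 p q b s ∧
      GluedAlong p q a b r ∧ GluedAlong p q b a s ∧
      K = {{a, b, p, q}, {p, q, a, r}, {p, q, b, s}}]

/-! ### The four composite prototiles in coordinates -/

/-- The point `(x, y, z) / 2`. -/
def pt (x y z : ℝ) : E3 := !₂[x / 2, y / 2, z / 2]

def ptA : E3 := pt 0 (-1) 0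
def ptB : E3 := pt 0 1 0
def ptC : E3 := pt (1 - tau) 0 (-tau)
def ptD : E3 := pt (1 - tau) 0 tau
def ptP : E3 := pt (1 + tau) 0 (-tau)
def ptQ : E3 := pt (1 + tau) 0 tau
def ptR : E3 := pt 2 (-1) 0
def ptS : E3 := pt 2 1 0
def ptU : E3 := pt (-1 - tau) 0 (-tau)
def ptV : E3 := pt tau (-tau) 1
def ptW : E3 := pt tau tau 1

/-- The prototiles `T₁, …, T₄` (index `i` is `T_{i+1}`), each as the set of the vertex sets of its
fundamental tetrahedra. -/
def protoCells : Fin 4 → Set (Set E3) :=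
  ![{{ptA, ptB, ptC, ptD}, {ptA, ptB, ptC, ptP}, {ptA, ptB, ptD, ptQ},
      {ptA, ptB, ptP, ptQ}, {ptP, ptQ, ptA, ptR}, {ptP, ptQ, ptB, ptS}},
    {{ptA, ptB, ptC, ptU}, {ptA, ptB, ptC, ptP}},
    {{ptA, ptB, ptP, ptQ}, {ptP, ptQ, ptA, ptV}, {ptP, ptQ, ptB, ptW}},
    {{ptA, ptB, ptP, ptQ}, {ptP, ptQ, ptA, ptV}, {ptP, ptQ, ptB, ptS}}]

/-! ### Copies of tiles, dissections and tilings -/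

/-- A copy of a composite prototile in space: the image of `T_{kind+1}` under the isometry
`x ↦ rot x + trans` (mirror images are allowed). -/
structure PlacedTile where
  kind : Fin 4
  rot : E3 ≃ₗᵢ[ℝ] E3
  trans : E3

namespace PlacedTile

/-- The isometry that carries the prototile to its copy. -/
def map (p : PlacedTile) (x : E3) : E3 := p.rot x + p.trans

/-- The vertex sets of the fundamental tetrahedra of the copy. -/
def cells (p : PlacedTile) : Set (Set E3) := (fun S => p.map '' S) '' protoCells p.kind

/-- The solid body of the copy. -/
def support (p : PlacedTile) : Set E3 := ⋃ S ∈ p.cells, convexHull ℝ S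

/-- The image of a copy under the isometry `x ↦ A x + b`. -/
def move (A : E3 ≃ₗᵢ[ℝ] E3) (b : E3) (p : PlacedTile) : PlacedTile :=
  ⟨p.kind, p.rot.trans A, A p.trans + b⟩

end PlacedTile

/-- The prototile `T_{i+1}` itself. -/
def proto (i : Fin 4) : PlacedTile := ⟨i, LinearIsometryEquiv.refl ℝ E3, 0⟩

/-- The fundamental tetrahedra of all tiles of `P` fit together face-to-face: any two of them meet
exactly in the common (possibly empty) face spanned by their common vertices. As the boundary of a
composite tile is made of Robinson triangles, tiles are thus matched along whole Robinson
triangles, edges and vertices of these. -/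
def FaceToFace (P : Set PlacedTile) : Prop :=
  ∀ p ∈ P, ∀ q ∈ P, ∀ S ∈ p.cells, ∀ T ∈ q.cells,
    convexHull ℝ S ∩ convexHull ℝ T = convexHull ℝ (S ∩ T)

/-- The tiles of `P` fill the region `X`, do not overlap, and are face-to-face. -/
def Tiles (P : Set PlacedTile) (X : Set E3) : Prop :=
  (⋃ p ∈ P, p.support) = X ∧
  (P.Pairwise fun p q => Disjoint (interior p.support) (interior q.support)) ∧
  FaceToFace P

/-- The number of tiles of type `T_{j+1}` in `P`. -/
def count (P : Set PlacedTile) (j : Fin 4) : ℕ := {p ∈ P | p.kind = j}.ncard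

/-- The inflation matrix: `τ T_i = ∑ j, M i j • T_j`. -/
def inflationMatrix : Matrix (Fin 4) (Fin 4) ℕ :=
  !![1, 2, 2, 2;
     0, 2, 1, 0;
     1, 2, 1, 1;
     1, 1, 1, 1]

/-- Inflation of a set of tiles by the rule `D`: everything is scaled by `τ`, and each scaled tile,
which is a copy of some `τ T_{i+1}` under the isometry `x ↦ rot x + τ trans`, is replaced by the
tiles of the corresponding copy of `D i`. -/
def inflate (D : Fin 4 → Finset PlacedTile) (P : Set PlacedTile) : Set PlacedTile :=
  ⋃ p ∈ P, PlacedTile.move p.rot (tau • p.trans) '' (D p.kind : Set PlacedTile)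

/-- The patch obtained from the single tile `T_{i+1}` by `n` inflations. -/
def patch (D : Fin 4 → Finset PlacedTile) (n : ℕ) (i : Fin 4) : Set PlacedTile :=
  (inflate D)^[n] {proto i}

/-- A set of tiles is generated by iterating the rule `D`: each finite part of it occurs, up to an
isometry, inside some patch `patch D n i`. -/
def GeneratedBy (D : Fin 4 → Finset PlacedTile) (P : Set PlacedTile) : Prop :=
  ∀ F ⊆ P, F.Finite → ∃ (n : ℕ) (i : Fin 4) (A : E3 ≃ₗᵢ[ℝ] E3) (b : E3),
    F ⊆ PlacedTile.move A b '' patch D n i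

/-- No nonzero translation carries the family of (the bodies of) the tiles of `P` to itself. -/
def Aperiodic (P : Set PlacedTile) : Prop :=
  ∀ t : E3, (fun X : Set E3 => t +ᵥ X) '' (PlacedTile.support '' P) = PlacedTile.support '' P →
    t = 0

end

end IcosahedralTiling

open IcosahedralTiling

/-! All vertices lie in a lattice of rank three over `ℤ[τ]`, so the four dissections are finite
tables whose properties are exact computations in `ℤ[τ]`. A tetrahedron is shown to be covered by
others through repeated bisection of edges until each piece lies in a single tetrahedron. Two
tetrahedra are shown to meet in a prescribed face through a plane that weakly separates them.

Iteration is controlled by decorations. Every edge of the boundary of a tile carries a direction,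
which determines where its inflation is split, and hence how each Robinson triangle is subdivided.
Two tiles are `Matched` if common points of their tetrahedra always lie in a common facet with equal
decoration. The finite checks say that distinct tiles of one dissection are matched, and that the
tiles of a dissection meet an inflated boundary facet only in pieces of the subdivision dictated by
its decoration. Two matched tiles therefore induce the same subdivision on a shared facet, and their
children are matched again (`Matched.child`). By induction all patches are pairwise matched. This
gives face-to-face, it gives disjoint interiors because facets are null sets, and it gives the
powers of the matrix because no tile is matched with itself. A generated family inherits the
property, as any two of its tiles lie in a moved patch.

For the tiling of space, one `T₁` in the dissection of `τ T₁` is rotated by an element of order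
three about an interior point of `T₁`. With this point at the origin, the third power of the
inflation reproduces the tile, and its iterates form an increasing sequence that exhausts space.

Aperiodicity is a Galois argument. Under `τ ↦ 1 - τ` the inflation becomes a contraction, so the
conjugates of all vertices in all patches are uniformly bounded (`exists_integral`,
`exists_max_bound`). If `t` is a period, then so is `N t` for every `N`, and the conjugates of its
coordinates stay bounded. The conjugates of the coordinates of `t` are thus `O(1/N)`, their integral
norms are less than 1 for large `N`, and `t = 0` (`eq_zero_of_val`). -/

open scoped Pointwise

namespace IcosahedralTiling

/-! ### The ring of golden integers and the lattice of vertices -/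

/-- The number `a + b θ`, where `θ` is a root of `θ² = θ + 1`. -/
structure GoldenInt where
  a : ℤ
  b : ℤ
deriving DecidableEq

namespace GoldenInt

instance : Zero GoldenInt := ⟨⟨0, 0⟩⟩
instance : Add GoldenInt := ⟨fun x y => ⟨x.a + y.a, x.b + y.b⟩⟩
instance : Sub GoldenInt := ⟨fun x y => ⟨x.a - y.a, x.b - y.b⟩⟩
instance : Mul GoldenInt := ⟨fun x y => ⟨x.a * y.a + x.b * y.b, x.a * y.b + x.b * y.a + x.b * y.b⟩⟩

/-- The norm of `a + b θ`. -/
def norm (x : GoldenInt) : ℤ := x.a * x.a + x.a * x.b - x.b * x.b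

/-- Decides whether `a + b τ` is nonnegative. -/
def nonneg (x : GoldenInt) : Bool :=
  if 0 ≤ x.a then (if 0 ≤ x.b then true else decide (0 ≤ x.norm))
  else (if 0 ≤ x.b then decide (x.norm ≤ 0) else false)

/-- Decides whether `a + b τ` is positive. -/
def pos (x : GoldenInt) : Bool := x.nonneg && !(decide (x.a = 0) && decide (x.b = 0))

/-- The real number `a + b θ`. -/
def val (θ : ℝ) (x : GoldenInt) : ℝ := x.a + x.b * θ

@[simp] theorem val_zero (θ : ℝ) : val θ 0 = 0 := by
  change ((0 : ℤ) : ℝ) + ((0 : ℤ) : ℝ) * θ = 0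
  simp

@[simp] theorem val_add (θ : ℝ) (x y : GoldenInt) : val θ (x + y) = val θ x + val θ y := by
  change ((x.a + y.a : ℤ) : ℝ) + ((x.b + y.b : ℤ) : ℝ) * θ = _
  simp only [val]; push_cast; ring

@[simp] theorem val_sub (θ : ℝ) (x y : GoldenInt) : val θ (x - y) = val θ x - val θ y := by
  change ((x.a - y.a : ℤ) : ℝ) + ((x.b - y.b : ℤ) : ℝ) * θ = _
  simp only [val]; push_cast; ring

/-- Only the equation of `θ` enters, so the evaluation is multiplicative at `τ` and at its conjugate
`1 - τ` alike. The second case is what aperiodicity rests on. -/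
theorem val_mul {θ : ℝ} (hθ : θ ^ 2 = θ + 1) (x y : GoldenInt) :
    val θ (x * y) = val θ x * val θ y := by
  change ((x.a * y.a + x.b * y.b : ℤ) : ℝ) +
    ((x.a * y.b + x.b * y.a + x.b * y.b : ℤ) : ℝ) * θ = _
  simp only [val]; push_cast
  linear_combination (-(x.b : ℝ) * y.b) * hθ

theorem tau_sq : tau ^ 2 = tau + 1 := Real.goldenRatio_sq

theorem conj_sq : (1 - tau) ^ 2 = (1 - tau) + 1 := by
  linear_combination tau_sq

theorem val_mul_conj (x : GoldenInt) : val tau x * val (1 - tau) x = x.norm := by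
  simp only [val, norm]; push_cast
  linear_combination (-(x.b : ℝ) * x.b) * tau_sq

theorem one_lt_tau : 1 < tau := Real.one_lt_goldenRatio

/-- For coefficients of opposite sign, the conjugate `a + b (1 - τ)` has the sign of `a`, because `1
- τ < 0`. The sign of the value can then be read off from the norm, which is the product of the
value and its conjugate. -/
theorem nonneg_val {x : GoldenInt} (h : x.nonneg = true) : 0 ≤ val tau x := by
  have ht := one_lt_tau
  have hn := val_mul_conj x
  unfold nonneg at h
  split_ifs at h with ha hb hb
  · have ha' : (0 : ℝ) ≤ x.a := by exact_mod_cast ha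
    have hb' : (0 : ℝ) ≤ x.b := by exact_mod_cast hb
    simp only [val]; positivity
  · have ha' : (0 : ℝ) ≤ x.a := by exact_mod_cast ha
    have hb' : (x.b : ℝ) < 0 := by exact_mod_cast not_le.mp hb
    have hN : (0 : ℝ) ≤ x.norm := by exact_mod_cast of_decide_eq_true h
    have : 0 < val (1 - tau) x := by simp only [val]; nlinarith
    by_contra hc
    nlinarith
  · have ha' : (x.a : ℝ) < 0 := by exact_mod_cast not_le.mp ha
    have hb' : (0 : ℝ) ≤ x.b := by exact_mod_cast hb
    have hN : (x.norm : ℝ) ≤ 0 := by exact_mod_cast of_decide_eq_true h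
    have : val (1 - tau) x < 0 := by simp only [val]; nlinarith
    by_contra hc
    nlinarith

theorem val_eq_zero {x : GoldenInt} (h : val tau x = 0) : x = 0 := by
  have hb : x.b = 0 := by
    by_contra hb
    have hb' : (x.b : ℝ) ≠ 0 := by exact_mod_cast hb
    apply Real.goldenRatio_irrational
    refine ⟨-(x.a : ℚ) / x.b, ?_⟩
    have : tau = -x.a / x.b := by
      rw [eq_div_iff hb']; simp only [val] at h; linarith
    push_cast
    exact this.symm
  have ha : x.a = 0 := by
    simp only [val, hb] at h
    simpa using h
  cases x; simp only at ha hb; subst ha; subst hb; rfl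

theorem val_injective : Function.Injective (val tau) := by
  intro x y h
  have := val_eq_zero (x := x - y) (by rw [val_sub, h, sub_self])
  have h1 : x.a - y.a = 0 := congrArg GoldenInt.a this
  have h2 : x.b - y.b = 0 := congrArg GoldenInt.b this
  cases x; cases y
  simp only [mk.injEq] at *
  omega

theorem pos_val {x : GoldenInt} (h : x.pos = true) : 0 < val tau x := by
  simp only [pos, Bool.and_eq_true, Bool.not_eq_true', Bool.and_eq_false_iff,
    decide_eq_false_iff_not] at h
  refine lt_of_le_of_ne (nonneg_val h.1) fun h0 => ?_
  have := val_eq_zero h0.symm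
  subst this
  rcases h.2 with h | h <;> exact h rfl

end GoldenInt

/-! ### The lattice of vertices over `ℤ[τ]` -/

open GoldenInt

/-- Coordinates of a point with respect to the basis `(θ, θ - 1, 1) / 4`, `(1/2, 0, 0)`,
`(0, 1/2, 0)`. -/
structure LVec where
  x : GoldenInt
  y : GoldenInt
  z : GoldenInt
deriving DecidableEq

namespace LVec

instance : Zero LVec := ⟨⟨0, 0, 0⟩⟩
instance : Add LVec := ⟨fun u v => ⟨u.x + v.x, u.y + v.y, u.z + v.z⟩⟩
instance : Sub LVec := ⟨fun u v => ⟨u.x - v.x, u.y - v.y, u.z - v.z⟩⟩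
instance : SMul GoldenInt LVec := ⟨fun c v => ⟨c * v.x, c * v.y, c * v.z⟩⟩

/-- The pairing of a linear form with a vector. -/
def dot (n v : LVec) : GoldenInt := n.x * v.x + n.y * v.y + n.z * v.z

/-- The point of space with given coordinates. -/
noncomputable def ev (θ : ℝ) (v : LVec) : E3 :=
  !₂[(θ * val θ v.x + 2 * val θ v.y) / 4, ((θ - 1) * val θ v.x + 2 * val θ v.z) / 4, val θ v.x / 4]

@[simp] theorem ev_zero (θ : ℝ) : ev θ 0 = 0 := by
  have h : ((0 : LVec).x = 0 ∧ (0 : LVec).y = 0) ∧ (0 : LVec).z = 0 := ⟨⟨rfl, rfl⟩, rfl⟩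
  ext i; fin_cases i <;> simp [ev, h]

theorem ev_add (θ : ℝ) (u v : LVec) : ev θ (u + v) = ev θ u + ev θ v := by
  have h : ((u + v).x = u.x + v.x ∧ (u + v).y = u.y + v.y) ∧ (u + v).z = u.z + v.z :=
    ⟨⟨rfl, rfl⟩, rfl⟩
  ext i; fin_cases i <;> simp [ev, h] <;> ring

theorem ev_sub (θ : ℝ) (u v : LVec) : ev θ (u - v) = ev θ u - ev θ v := by
  have h : ((u - v).x = u.x - v.x ∧ (u - v).y = u.y - v.y) ∧ (u - v).z = u.z - v.z :=
    ⟨⟨rfl, rfl⟩, rfl⟩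
  ext i; fin_cases i <;> simp [ev, h] <;> ring

theorem ev_smul {θ : ℝ} (hθ : θ ^ 2 = θ + 1) (c : GoldenInt) (v : LVec) :
    ev θ (c • v) = val θ c • ev θ v := by
  have h : ((c • v).x = c * v.x ∧ (c • v).y = c * v.y) ∧ (c • v).z = c * v.z :=
    ⟨⟨rfl, rfl⟩, rfl⟩
  ext i; fin_cases i <;> simp [ev, h, val_mul hθ] <;> ring

/-- Multiplication by `τ`. -/
def scale (v : LVec) : LVec := (⟨0, 1⟩ : GoldenInt) • v

theorem ev_scale {θ : ℝ} (hθ : θ ^ 2 = θ + 1) (v : LVec) : ev θ (scale v) = θ • ev θ v := by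
  rw [scale, ev_smul hθ]; simp [val]

end LVec

/-- The point that divides the inflated long edge from `τ a` to `τ b` into a long and a short edge. -/
noncomputable def splitPoint (a b : E3) : E3 := tau • a + (b - a)

/-- The lattice version of `splitPoint`. -/
def LVec.split (a b : LVec) : LVec := a.scale + (b - a)

theorem LVec.ev_split (a b : LVec) : (a.split b).ev tau = splitPoint (a.ev tau) (b.ev tau) := by
  rw [LVec.split, LVec.ev_add, LVec.ev_sub, LVec.ev_scale tau_sq, splitPoint]

/-- The first coordinate form dual to the basis of `LVec.ev`. -/
noncomputable def coordX : E3 →ₗ[ℝ] ℝ where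
  toFun p := 4 * p 2
  map_add' p q := by simp; ring
  map_smul' c p := by simp; ring

/-- The second coordinate form dual to the basis of `LVec.ev`. -/
noncomputable def coordY : E3 →ₗ[ℝ] ℝ where
  toFun p := 2 * p 0 - 2 * tau * p 2
  map_add' p q := by simp; ring
  map_smul' c p := by simp; ring

/-- The third coordinate form dual to the basis of `LVec.ev`. -/
noncomputable def coordZ : E3 →ₗ[ℝ] ℝ where
  toFun p := 2 * p 1 - 2 * (tau - 1) * p 2
  map_add' p q := by simp; ring
  map_smul' c p := by simp; ring

theorem coordX_ev (v : LVec) : coordX (v.ev tau) = val tau v.x := by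
  simp [coordX, LVec.ev]; ring

theorem coordY_ev (v : LVec) : coordY (v.ev tau) = val tau v.y := by
  simp [coordY, LVec.ev]; ring

theorem coordZ_ev (v : LVec) : coordZ (v.ev tau) = val tau v.z := by
  simp [coordZ, LVec.ev]; ring

namespace LVec

/-- The real linear form with given coefficients. -/
noncomputable def form (n : LVec) : E3 →ₗ[ℝ] ℝ :=
  val tau n.x • coordX + val tau n.y • coordY + val tau n.z • coordZ

theorem form_ev (n v : LVec) : n.form (v.ev tau) = val tau (dot n v) := by
  simp [form, dot, coordX_ev, coordY_ev, coordZ_ev, val_mul tau_sq]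

/-- Sixteen times the scalar product. -/
def bilin (u v : LVec) : GoldenInt :=
  (⟨4, 0⟩ : GoldenInt) * (u.x * v.x + u.y * v.y + u.z * v.z) +
  (⟨0, 2⟩ : GoldenInt) * (u.x * v.y + u.y * v.x) +
  (⟨-2, 2⟩ : GoldenInt) * (u.x * v.z + u.z * v.x)

/-- The Gram matrix of the basis has entries in `ℤ[θ]/16`, given by the same formula for both roots
`θ`. Equality of scalar products is thereby decidable, and it passes to the conjugate lattice. -/
theorem inner_ev {θ : ℝ} (hθ : θ ^ 2 = θ + 1) (u v : LVec) :
    inner ℝ (ev θ u) (ev θ v) = val θ (bilin u v) / 16 := by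
  have h4 : val θ ⟨4, 0⟩ = 4 := by simp [val]
  have h2 : val θ ⟨0, 2⟩ = 2 * θ := by simp [val]
  have h3 : val θ ⟨-2, 2⟩ = 2 * θ - 2 := by simp [val]; ring
  simp only [bilin, val_add, val_mul hθ, h4, h2, h3, PiLp.inner_apply, Fin.sum_univ_three]
  simp [ev]
  linear_combination (2 * val θ u.x * val θ v.x) / 16 * hθ

end LVec

open GoldenInt

/-! ### Decorated facets and their inflation -/

/-- A decorated vertex, edge or triangle of the boundary of a tile. The order of the vertices
records the orientation of the edges: `long a b` is an edge of length `τ` whose inflation is split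
into a long edge at `τ a` and a short edge at `τ b`; `obtuse a b c` is a triangle with long edge
`a b`; `acute a b c` is a triangle with apex `a`. -/
inductive Facet (α : Type*) where
  | vertex (a : α)
  | short (a b : α)
  | long (a b : α)
  | obtuse (a b c : α)
  | acute (a b c : α)
deriving DecidableEq

namespace Facet

variable {α β γ : Type*}

/-- The vertices of a facet. -/
def pts : Facet α → List α
  | vertex a => [a]
  | short a b => [a, b]
  | long a b => [a, b]
  | obtuse a b c => [a, b, c]
  | acute a b c => [a, b, c]

/-- The image of a facet. -/
def map (f : α → β) : Facet α → Facet β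
  | vertex a => vertex (f a)
  | short a b => short (f a) (f b)
  | long a b => long (f a) (f b)
  | obtuse a b c => obtuse (f a) (f b) (f c)
  | acute a b c => acute (f a) (f b) (f c)

/-- The faces of a facet, including itself. -/
def subs : Facet α → List (Facet α)
  | vertex a => [vertex a]
  | short a b => [short a b, vertex a, vertex b]
  | long a b => [long a b, vertex a, vertex b]
  | obtuse a b c =>
    [obtuse a b c, long a b, short a c, short b c, vertex a, vertex b, vertex c]
  -- Short edges need a direction as well, since they inflate to long ones.
  | acute a b c => [acute a b c, long a b, long a c, short c b, vertex a, vertex b, vertex c]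

/-- The pieces of the inflated facet, where `s` scales a vertex and `p` splits a long edge. -/
def pieces (s : α → β) (p : α → α → β) : Facet α → List (Facet β)
  | vertex a => [vertex (s a)]
  | short a b => [long (s a) (s b)]
  | long a b => [long (s a) (p a b), short (s b) (p a b)]
  -- The golden subdivisions of the Robinson triangles. For the acute triangle there is a choice of
  -- diagonal in the trapezoid below the apex; the order of the base vertices makes it start at `c`.
  | obtuse a b c => [acute (s a) (p a b) (s c), obtuse (s b) (s c) (p a b)]
  | acute a b c => [acute (s a) (p a c) (p a b), acute (s c) (p a b) (s b),
      obtuse (s c) (p a b) (p a c)]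

/-- All faces of the pieces of the inflated facet. -/
def refine (s : α → β) (p : α → α → β) (F : Facet α) : List (Facet β) :=
  (F.pieces s p).flatMap subs

theorem pts_map (f : α → β) (F : Facet α) : (F.map f).pts = F.pts.map f := by cases F <;> rfl

theorem subs_map (f : α → β) (F : Facet α) : (F.map f).subs = F.subs.map (map f) := by
  cases F <;> rfl

theorem map_map (g : β → γ) (f : α → β) (F : Facet α) : (F.map f).map g = F.map (g ∘ f) := by
  cases F <;> rfl

theorem subs_trans {F G H : Facet α} (hG : G ∈ F.subs) (hH : H ∈ G.subs) : H ∈ F.subs := by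
  cases F <;> simp only [subs, List.mem_cons, List.not_mem_nil, or_false] at hG <;>
    rcases hG with rfl | rfl | rfl | rfl | rfl | rfl | rfl <;>
    simp only [subs, List.mem_cons, List.not_mem_nil, or_false] at hH ⊢ <;> tauto

/-- Subdivision is natural in the vertices. Hence it can be computed on labels and transported to
lattice points and to space. -/
theorem pieces_map (f : β → γ) (s : α → β) (p : α → α → β) (F : Facet α) :
    (F.pieces s p).map (map f) = F.pieces (f ∘ s) (fun a b => f (p a b)) := by cases F <;> rfl

theorem pieces_comp (f : α → β) (s : β → γ) (p : β → β → γ) (F : Facet α) :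
    (F.map f).pieces s p = F.pieces (s ∘ f) (fun a b => p (f a) (f b)) := by cases F <;> rfl

theorem refine_map (f : β → γ) (s : α → β) (p : α → α → β) (F : Facet α) :
    (F.refine s p).map (map f) = F.refine (f ∘ s) (fun a b => f (p a b)) := by
  simp only [refine, List.map_flatMap, ← pieces_map, List.flatMap_map, subs_map]

theorem refine_comp (f : α → β) (s : β → γ) (p : β → β → γ) (F : Facet α) :
    (F.map f).refine s p = F.refine (s ∘ f) (fun a b => p (f a) (f b)) := by
  simp only [refine, pieces_comp]

end Facet

/-! ### Combinatorial data of the tiles and of their dissections -/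

/-- A subdivision of a simplex, given as a list of points, by successive bisection of edges; the
final pieces lie inside listed tetrahedra. -/
inductive Bisection where
  | inside (k : ℕ)
  | golden (k l : ℕ) (s t : Bisection)
  | half (k l : ℕ) (s t : Bisection)

/-- Vertices, tetrahedra and decorated boundary triangles of a tile. -/
structure Kind where
  verts : List LVec
  cells : List (List ℕ)
  triangles : List (Facet ℕ)

/-- A tile of a dissection: its type, the images of the basis vectors under its rotation, its
translation, and the positions of its vertices in the table of all vertices. -/
structure Code where
  kind : Fin 4
  c₁ : LVec
  c₂ : LVec
  c₃ : LVec
  t : LVec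
  labels : List ℕ

/-- The dissection of an inflated tile: the table of all vertices, which starts with the scaled
vertices of the tile and the points that split the long edges `splits`; the tiles; linear forms
with the ranks of their values at the vertices; the bisections which show that each tetrahedron of
the dissection is covered by the inflated tile and conversely. -/
structure Rule where
  table : List LVec
  splits : List (ℕ × ℕ)
  codes : List Code
  ranks : List (LVec × List ℕ)
  inner : List (List Bisection)
  outer : List Bisection

/-- The vector with given coefficients. -/
def v (a b c d e f : ℤ) : LVec := ⟨⟨a, b⟩, ⟨c, d⟩, ⟨e, f⟩⟩

/-- The vertices, cells and boundary triangles of `T_1`. -/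
def kind1 : Kind where
  verts :=
    [v 0 0 0 0 (-1) 0, v 0 0 0 0 1 0, v 0 (-2) 2 0 1 0, v 0 2 0 (-2) (-1) 0, v 0 (-2) 2 2 1 0,
     v 0 2 0 0 (-1) 0, v 0 0 2 0 (-1) 0, v 0 0 2 0 1 0]
  cells := [[0, 1, 2, 3], [0, 1, 2, 4], [0, 1, 3, 5], [0, 1, 4, 5], [4, 5, 0, 6], [4, 5, 1, 7]]
  triangles :=
    [.obtuse 2 3 0, .obtuse 2 3 1, .obtuse 4 0 6, .obtuse 4 1 7, .obtuse 4 5 6, .obtuse 4 5 7,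
     .obtuse 5 0 6, .obtuse 5 1 7, .acute 4 0 2, .acute 4 1 2, .acute 5 0 3, .acute 5 1 3]

/-- The vertices, cells and boundary triangles of `T_2`. -/
def kind2 : Kind where
  verts :=
    [v 0 0 0 0 (-1) 0, v 0 0 0 0 1 0, v 0 (-2) 2 0 1 0, v 0 (-2) 0 0 1 0, v 0 (-2) 2 2 1 0]
  cells := [[0, 1, 2, 3], [0, 1, 2, 4]]
  triangles :=
    [.obtuse 3 0 2, .obtuse 3 1 2, .acute 3 0 1, .acute 4 0 1, .acute 4 2 0, .acute 4 2 1]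

/-- The vertices, cells and boundary triangles of `T_3`. -/
def kind3 : Kind where
  verts :=
    [v 0 0 0 0 (-1) 0, v 0 0 0 0 1 0, v 0 (-2) 2 2 1 0, v 0 2 0 0 (-1) 0, v 2 0 0 0 1 (-2),
     v 2 0 0 0 1 0]
  cells := [[0, 1, 2, 3], [2, 3, 0, 4], [2, 3, 1, 5]]
  triangles :=
    [.obtuse 3 0 4, .obtuse 3 1 5, .acute 2 0 1, .acute 2 4 0, .acute 2 4 3, .acute 2 5 1,
     .acute 2 5 3, .acute 3 0 1]

/-- The vertices, cells and boundary triangles of `T_4`. -/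
def kind4 : Kind where
  verts :=
    [v 0 0 0 0 (-1) 0, v 0 0 0 0 1 0, v 0 (-2) 2 2 1 0, v 0 2 0 0 (-1) 0, v 2 0 0 0 1 (-2),
     v 0 0 2 0 1 0]
  cells := [[0, 1, 2, 3], [2, 3, 0, 4], [2, 3, 1, 5]]
  triangles :=
    [.obtuse 2 1 5, .obtuse 2 3 5, .obtuse 3 0 4, .obtuse 3 1 5, .acute 2 0 1, .acute 2 4 0,
     .acute 2 4 3, .acute 3 0 1]

/-- The dissection of `τ T_1`. -/
def rule1 : Rule where
  table :=
    [v 0 0 0 0 0 (-1), v 0 0 0 0 0 1, v (-2) (-2) 0 2 0 1, v 2 2 (-2) (-2) 0 (-1),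
     v (-2) (-2) 2 4 0 1, v 2 2 0 0 0 (-1), v 0 0 0 2 0 (-1), v 0 0 0 2 0 1,
     v (-2) 2 (-2) 0 (-2) 1, v (-2) 0 0 2 (-2) 1, v (-2) 0 0 2 0 1, v (-2) 2 0 2 (-2) 1,
     v 2 0 0 0 0 (-1), v 2 0 0 0 2 (-1), v (-2) (-2) 2 2 0 1, v 2 2 0 (-2) 0 (-1)]
  splits := [(2, 3), (4, 0), (4, 1), (4, 5), (5, 0), (5, 1), (4, 2), (5, 3)]
  codes := [
    ⟨1, v 1 0 0 0 0 0, v 0 0 1 0 0 0, v 0 0 0 0 1 0, v (-2) 0 0 2 (-1) 1,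
      [9, 10, 14, 2, 4]⟩,
    ⟨1, v (-1) 0 0 1 (-1) 1, v 0 0 1 0 0 0, v 0 0 0 0 1 0, v 2 0 0 0 1 (-1),
      [12, 13, 15, 3, 5]⟩,
    ⟨3, v 1 (-1) 0 0 1 (-1), v (-1) 1 (-1) 0 (-1) 0, v (-1) 0 0 0 (-1) 1, v 1 0 0 0 1 0,
      [13, 1, 3, 0, 12, 8]⟩,
    ⟨0, v 1 (-1) 1 0 1 (-1), v 0 0 0 0 (-1) 0, v (-2) 0 0 1 (-1) 1, v 0 0 0 1 1 0,
      [13, 10, 1, 7, 0, 6, 12, 9]⟩,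
    ⟨3, v 1 (-1) 1 0 1 (-1), v (-1) 1 0 0 (-1) 0, v (-1) 0 0 1 (-1) 1, v 1 0 0 1 1 0,
      [13, 7, 5, 6, 12, 11]⟩,
    ⟨2, v (-1) 1 (-1) 0 (-1) 0, v 1 (-1) 0 0 1 (-1), v 1 0 0 (-1) 0 0, v (-1) 0 0 1 0 1,
      [10, 1, 2, 0, 9, 8]⟩,
    ⟨2, v (-1) 1 0 0 (-1) 0, v 1 (-1) 1 0 1 (-1), v 1 0 0 0 0 0, v (-1) 0 0 2 0 1,
      [10, 7, 4, 6, 9, 11]⟩]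
  ranks :=
    [(v (-4) 0 0 (-4) 0 0, [5, 5, 5, 7, 0, 2, 2, 2, 6, 3, 3, 1, 4, 4, 3, 5]),
     (v 2 0 0 2 (-2) 2, [2, 3, 3, 0, 8, 6, 6, 7, 1, 5, 6, 7, 3, 4, 6, 2]),
     (v 0 4 4 0 0 0, [2, 2, 0, 3, 2, 5, 3, 3, 2, 2, 2, 4, 3, 3, 1, 4]),
     (v (-4) 0 0 0 0 (-4), [3, 0, 3, 0, 3, 0, 3, 0, 1, 3, 1, 1, 2, 0, 3, 0]),
     (v 0 0 4 (-4) 0 4, [1, 4, 3, 3, 1, 1, 0, 3, 3, 1, 3, 1, 1, 3, 2, 2]),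
     (v 0 0 0 0 0 (-4), [3, 0, 0, 3, 0, 3, 3, 0, 2, 2, 0, 2, 3, 1, 0, 3]),
     (v 0 0 (-2) 2 2 0, [2, 4, 5, 0, 7, 2, 3, 5, 2, 4, 5, 4, 2, 3, 6, 1]),
     (v (-4) 0 4 (-4) 0 (-4), [4, 1, 3, 3, 1, 1, 3, 0, 3, 3, 1, 1, 3, 1, 2, 2]),
     (v 4 0 0 0 (-4) 4, [2, 3, 0, 5, 0, 5, 2, 3, 3, 1, 2, 3, 3, 4, 0, 5]),
     (v 4 0 0 4 (-4) 0, [1, 0, 0, 0, 3, 3, 3, 2, 0, 2, 1, 3, 2, 1, 1, 1]),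
     (v 0 (-4) 0 (-4) (-4) 0, [3, 2, 3, 3, 0, 0, 1, 0, 3, 2, 1, 0, 2, 1, 2, 2]),
     (v 0 4 0 4 4 0, [0, 1, 0, 0, 3, 3, 2, 3, 0, 1, 2, 3, 1, 2, 1, 1]),
     (v 0 0 0 0 0 4, [0, 3, 3, 0, 3, 0, 0, 3, 1, 1, 3, 1, 0, 2, 3, 0]),
     (v 0 0 4 0 0 0, [3, 3, 4, 0, 6, 3, 4, 4, 2, 4, 4, 4, 3, 3, 5, 1]),
     (v (-4) 0 0 (-4) 4 0, [2, 3, 3, 3, 0, 0, 0, 1, 3, 1, 2, 0, 1, 2, 2, 2]),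
     (v 0 0 (-4) 0 0 0, [3, 3, 2, 6, 0, 3, 2, 2, 4, 2, 2, 2, 3, 3, 1, 5]),
     (v 0 (-4) (-4) 0 0 0, [3, 3, 5, 2, 3, 0, 2, 2, 3, 3, 3, 1, 2, 2, 4, 1]),
     (v 4 0 0 0 0 4, [0, 3, 0, 3, 0, 3, 0, 3, 2, 0, 2, 2, 1, 3, 0, 3]),
     (v (-4) 0 0 0 4 (-4), [3, 2, 5, 0, 5, 0, 3, 2, 2, 4, 3, 2, 2, 1, 5, 0]),
     (v 0 2 4 0 0 0, [1, 1, 0, 0, 5, 5, 4, 4, 0, 3, 3, 5, 3, 3, 2, 2]),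
     (v 0 2 (-2) 2 2 0, [2, 4, 0, 5, 2, 7, 3, 5, 3, 2, 3, 5, 4, 5, 1, 6]),
     (v (-4) 4 0 0 4 (-4), [3, 2, 0, 5, 0, 5, 3, 2, 3, 2, 1, 3, 4, 3, 0, 5]),
     (v 0 (-2) (-4) 0 0 0, [4, 4, 5, 5, 0, 0, 1, 1, 5, 2, 2, 0, 2, 2, 3, 3]),
     (v 2 (-2) 0 0 (-4) 0, [4, 0, 2, 2, 2, 2, 4, 0, 2, 3, 1, 2, 3, 1, 2, 2]),
     (v 0 0 4 0 (-4) 0, [3, 1, 3, 0, 6, 3, 5, 3, 1, 4, 3, 4, 3, 2, 4, 1]),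
     (v 0 (-4) 0 (-4) 0 0, [5, 5, 7, 5, 2, 0, 2, 2, 6, 4, 4, 1, 3, 3, 5, 3]),
     (v 4 0 4 0 (-4) 0, [3, 1, 0, 3, 3, 6, 5, 3, 2, 3, 2, 5, 4, 3, 1, 4]),
     (v 0 4 0 4 0 0, [2, 2, 0, 2, 5, 7, 5, 5, 1, 3, 3, 6, 4, 4, 2, 4]),
     (v 0 (-4) (-4) 0 (-4) 0, [5, 3, 6, 3, 3, 0, 3, 1, 4, 4, 3, 1, 3, 2, 5, 2]),
     (v 4 (-4) (-4) 0 (-4) 0, [5, 3, 3, 6, 0, 3, 3, 1, 5, 3, 2, 2, 4, 3, 2, 5]),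
     (v 4 0 0 4 0 0, [2, 2, 2, 0, 7, 5, 5, 5, 1, 4, 4, 6, 3, 3, 4, 2]),
     (v 0 0 (-4) 4 0 (-4), [3, 0, 1, 1, 3, 3, 4, 1, 1, 3, 1, 3, 3, 1, 2, 2]),
     (v 4 0 (-4) 4 0 4, [0, 3, 1, 1, 3, 3, 1, 4, 1, 1, 3, 3, 1, 3, 2, 2])]
  inner := [
    [.inside 1, .inside 1],
    [.inside 2, .inside 2],
    [.inside 2, .inside 2, .inside 0],
    [.inside 5, .inside 3, .golden 3 2 (.golden 2 0 (.inside 3) (.golden 3 1 (.inside 3) (.golden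
     1 3 (.inside 4) (.inside 3)))) (.inside 5), .golden 0 3 (.inside 3) (.golden 2 1 (.inside 3)
     (.inside 4)), .golden 2 1 (.inside 3) (.inside 4), .golden 2 1 (.inside 3) (.inside 4)],
    [.golden 3 1 (.golden 2 0 (.inside 3) (.golden 1 2 (.inside 4) (.inside 3))) (.inside 5),
     .golden 2 1 (.inside 3) (.inside 4), .golden 1 2 (.golden 0 1 (.inside 4) (.inside 3))
     (.inside 5)],
    [.inside 1, .inside 1, .inside 0],
    [.golden 3 1 (.golden 2 0 (.inside 3) (.golden 1 2 (.inside 4) (.inside 3))) (.inside 5),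
     .golden 2 1 (.inside 3) (.inside 4), .golden 1 2 (.golden 0 1 (.inside 4) (.inside 3))
     (.inside 5)]]
  outer := [
    .golden 2 3 (.inside 18) (.inside 6),
    .golden 3 1 (.golden 0 2 (.golden 0 3 (.inside 1) (.inside 0)) (.inside 17)) (.inside 16),
    .golden 3 1 (.golden 0 2 (.golden 0 3 (.inside 3) (.inside 2)) (.inside 5)) (.inside 4),
    .golden 2 0 (.golden 0 2 (.golden 0 3 (.golden 1 3 (.golden 0 1 (.golden 3 0 (.inside 19)
     (.inside 21)) (.inside 19)) (.inside 20)) (.golden 3 0 (.golden 2 0 (.golden 0 3 (.inside 13)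
     (.inside 9)) (.golden 1 2 (.half 0 2 (.inside 12) (.inside 10)) (.inside 9))) (.golden 3 1
     (.golden 3 0 (.inside 13) (.inside 9)) (.inside 15)))) (.golden 3 2 (.golden 0 3 (.golden 0 3
     (.inside 13) (.inside 9)) (.half 2 1 (.inside 10) (.inside 8))) (.golden 3 1 (.half 0 2
     (.inside 8) (.inside 10)) (.half 1 2 (.inside 12) (.inside 10))))) (.golden 3 0 (.golden 0 3
     (.golden 0 3 (.inside 14) (.inside 11)) (.half 1 2 (.inside 8) (.inside 10))) (.golden 3 1
     (.half 0 2 (.inside 8) (.inside 10)) (.half 1 2 (.inside 12) (.inside 10)))),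
    .golden 0 1 (.golden 0 2 (.golden 1 2 (.golden 0 1 (.inside 20) (.inside 19)) (.inside 21))
     (.golden 2 0 (.golden 2 0 (.inside 10) (.golden 1 2 (.half 0 2 (.inside 15) (.inside 13))
     (.inside 9))) (.inside 12))) (.golden 2 0 (.golden 2 0 (.inside 14) (.inside 11)) (.half 1 0
     (.inside 15) (.inside 13))),
    .golden 0 2 (.golden 0 2 (.golden 2 1 (.inside 19) (.inside 21)) (.golden 2 0 (.golden 2 0
     (.inside 13) (.inside 9)) (.inside 15))) (.golden 2 1 (.golden 0 2 (.inside 13) (.inside 9))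
     (.inside 7))]

/-- The dissection of `τ T_2`. -/
def rule2 : Rule where
  table :=
    [v 0 0 0 0 0 (-1), v 0 0 0 0 0 1, v (-2) (-2) 0 2 0 1, v (-2) (-2) 0 0 0 1,
     v (-2) (-2) 2 4 0 1, v (-2) 0 0 0 (-2) 1, v (-2) 0 0 0 0 1, v (-2) 0 0 2 (-2) 1,
     v (-2) 0 0 2 0 1, v (-2) (-2) 2 2 0 1]
  splits := [(3, 0), (3, 1), (4, 0), (4, 1), (4, 2)]
  codes := [
    ⟨1, v 0 (-1) 1 0 0 0, v (-1) 0 0 0 0 0, v 0 (-1) 0 1 1 0, v (-2) (-1) 0 1 (-1) 1,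
      [5, 2, 6, 1, 3]⟩,
    ⟨1, v 0 (-1) 0 1 0 0, v (-1) 0 0 1 0 0, v 0 (-1) 1 0 1 0, v (-2) (-1) 1 2 (-1) 1,
      [7, 9, 8, 1, 4]⟩,
    ⟨2, v 0 1 0 (-1) (-1) 0, v 2 0 0 (-1) 1 (-1), v 0 0 (-1) 0 0 0, v (-2) (-2) 1 2 0 1,
      [9, 2, 1, 0, 7, 5]⟩]
  ranks :=
    [(v 0 2 4 0 0 0, [3, 3, 2, 0, 6, 1, 1, 5, 5, 4]),
     (v 0 (-2) (-4) 0 0 0, [3, 3, 4, 6, 0, 5, 5, 1, 1, 2]),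
     (v 0 0 0 0 0 (-4), [2, 0, 0, 0, 0, 1, 0, 1, 0, 0]),
     (v 4 0 0 0 0 4, [0, 2, 0, 0, 0, 0, 1, 0, 1, 0]),
     (v 4 (-4) 0 0 (-4) 4, [0, 1, 3, 3, 3, 1, 2, 1, 2, 3]),
     (v (-4) 4 0 0 4 (-4), [3, 2, 0, 0, 0, 2, 1, 2, 1, 0]),
     (v 0 (-4) (-4) 0 0 0, [0, 0, 2, 3, 0, 1, 1, 0, 0, 1]),
     (v 0 0 4 0 (-4) 0, [2, 0, 2, 0, 4, 1, 0, 3, 2, 3]),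
     (v 0 4 0 4 4 0, [2, 3, 2, 0, 5, 1, 2, 3, 4, 3]),
     (v 0 0 4 0 0 0, [0, 0, 1, 0, 3, 0, 0, 1, 1, 2]),
     (v 4 0 0 4 (-4) 0, [3, 2, 2, 0, 5, 2, 1, 4, 3, 3]),
     (v 0 (-4) (-4) 0 (-4) 0, [2, 0, 3, 4, 0, 3, 2, 1, 0, 2]),
     (v (-4) 0 0 (-4) 0 0, [2, 2, 2, 4, 0, 3, 3, 1, 1, 1]),
     (v (-4) 0 (-4) 0 4 0, [0, 2, 3, 4, 0, 2, 3, 0, 1, 2]),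
     (v 4 0 (-4) 4 0 4, [0, 3, 1, 0, 3, 0, 2, 1, 3, 2]),
     (v 0 0 (-4) 0 4 0, [2, 4, 2, 4, 0, 3, 4, 1, 2, 1]),
     (v (-4) 0 0 (-4) 4 0, [2, 3, 3, 5, 0, 3, 4, 1, 2, 2]),
     (v 0 4 0 4 0 0, [2, 2, 1, 0, 4, 1, 1, 3, 3, 2]),
     (v 4 0 0 4 0 0, [2, 2, 2, 0, 4, 1, 1, 3, 3, 3])]
  inner := [
    [.inside 0, .inside 0],
    [.inside 1, .inside 1],
    [.inside 1, .inside 1, .inside 0]]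
  outer := [
    .golden 3 0 (.golden 0 2 (.inside 1) (.inside 0)) (.inside 6),
    .golden 3 2 (.golden 0 2 (.golden 0 3 (.inside 3) (.inside 2)) (.inside 5)) (.inside 4)]

/-- The dissection of `τ T_3`. -/
def rule3 : Rule where
  table :=
    [v 0 0 0 0 0 (-1), v 0 0 0 0 0 1, v (-2) (-2) 2 4 0 1, v 2 2 0 0 0 (-1), v 0 2 0 0 (-2) (-1),
     v 0 2 0 0 0 1, v 2 0 0 0 0 (-1), v 2 0 0 0 2 (-1), v (-2) 0 0 2 (-2) 1, v (-2) 0 0 2 0 1,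
     v 0 0 0 2 0 (-1), v (-2) 2 0 2 (-2) 1, v 0 0 0 2 0 1]
  splits := [(3, 0), (3, 1), (2, 0), (2, 1), (2, 4), (2, 3), (2, 5)]
  codes := [
    ⟨0, v 1 (-1) 1 0 1 0, v 0 0 0 0 1 0, v (-2) 0 0 1 (-1) 1, v 0 0 0 1 (-1) 0,
      [6, 8, 0, 10, 1, 12, 7, 9]⟩,
    ⟨1, v 1 0 0 0 1 (-1), v 1 0 0 0 0 0, v 0 1 0 (-1) (-1) 0, v 0 1 0 1 (-1) (-1),
      [10, 4, 6, 0, 3]⟩,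
    ⟨1, v 1 0 0 0 0 0, v 1 0 0 0 1 (-1), v 0 1 0 (-1) 0 0, v 0 1 0 1 0 1,
      [12, 5, 7, 1, 3]⟩,
    ⟨3, v 1 (-1) 1 0 1 0, v (-1) 1 0 0 (-1) 1, v (-1) 0 0 1 0 0, v 1 0 0 1 0 (-1),
      [6, 10, 3, 12, 7, 11]⟩,
    ⟨2, v (-1) 1 0 0 (-1) 1, v 1 (-1) 1 0 1 0, v 1 0 0 0 1 (-1), v (-1) 0 0 2 (-1) 0,
      [8, 10, 2, 12, 9, 11]⟩]
  ranks :=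
    [(v (-2) 0 0 0 0 0, [4, 4, 6, 0, 1, 1, 2, 2, 5, 5, 4, 3, 4]),
     (v 2 0 0 0 0 0, [2, 2, 0, 6, 5, 5, 4, 4, 1, 1, 2, 3, 2]),
     (v (-2) 0 (-2) 0 0 (-2), [5, 2, 0, 2, 5, 0, 4, 2, 3, 1, 3, 1, 0]),
     (v 4 0 (-4) 4 0 4, [0, 2, 2, 2, 0, 4, 1, 2, 1, 2, 1, 2, 3]),
     (v 0 0 4 0 0 0, [0, 0, 2, 0, 0, 0, 0, 0, 1, 1, 1, 1, 1]),
     (v 0 0 (-2) 0 0 2, [2, 5, 0, 2, 0, 5, 2, 4, 1, 3, 0, 1, 3]),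
     (v (-2) 2 2 0 0 (-2), [3, 0, 3, 6, 7, 1, 4, 2, 3, 1, 6, 5, 2]),
     (v 0 (-4) 0 (-4) (-4) 0, [3, 2, 0, 0, 2, 0, 2, 1, 2, 1, 1, 0, 0]),
     (v 0 2 (-2) 2 2 0, [0, 2, 0, 4, 2, 4, 2, 3, 0, 1, 1, 3, 3]),
     (v 4 0 0 4 0 0, [0, 0, 5, 3, 2, 2, 1, 1, 2, 2, 3, 4, 3]),
     (v (-4) 0 0 (-4) 4 0, [2, 3, 0, 0, 0, 2, 1, 2, 1, 2, 0, 0, 1]),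
     (v 0 0 0 0 0 (-4), [3, 0, 0, 3, 4, 0, 3, 1, 2, 0, 3, 2, 0]),
     (v 4 0 0 0 0 4, [0, 3, 0, 3, 0, 4, 1, 3, 0, 2, 0, 2, 3]),
     (v 0 0 (-2) 2 2 0, [1, 3, 5, 1, 0, 3, 1, 2, 3, 4, 2, 3, 4]),
     (v 2 0 (-2) 2 (-2) 0, [2, 0, 0, 4, 4, 2, 3, 2, 1, 0, 3, 3, 1]),
     (v 0 (-4) (-4) 0 0 0, [3, 3, 3, 0, 1, 1, 2, 2, 3, 3, 2, 1, 2]),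
     (v 2 (-2) (-2) 2 (-2) 0, [3, 1, 5, 1, 3, 0, 2, 1, 4, 3, 4, 3, 2]),
     (v 0 0 (-4) 0 0 0, [2, 2, 0, 2, 2, 2, 2, 2, 1, 1, 1, 1, 1]),
     (v 0 (-2) (-4) 0 0 0, [4, 4, 0, 0, 2, 2, 3, 3, 3, 3, 1, 0, 1]),
     (v 0 4 4 0 0 0, [0, 0, 0, 3, 2, 2, 1, 1, 0, 0, 1, 2, 1]),
     (v 0 0 (-4) 4 0 (-4), [2, 0, 2, 2, 4, 0, 2, 1, 2, 1, 3, 2, 1]),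
     (v 0 0 0 0 0 4, [1, 4, 4, 1, 0, 4, 1, 3, 2, 4, 1, 2, 4]),
     (v 0 (-2) 2 (-2) (-2) 0, [4, 2, 4, 0, 2, 0, 2, 1, 4, 3, 3, 1, 1]),
     (v (-4) 0 4 (-4) 0 (-4), [4, 2, 2, 2, 4, 0, 3, 2, 3, 2, 3, 2, 1]),
     (v 0 0 4 (-4) 0 4, [2, 4, 2, 2, 0, 4, 2, 3, 2, 3, 1, 2, 3]),
     (v (-4) 0 0 0 0 (-4), [4, 1, 4, 1, 4, 0, 3, 1, 4, 2, 4, 2, 1]),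
     (v (-4) 0 0 (-4) 0 0, [5, 5, 0, 2, 3, 3, 4, 4, 3, 3, 2, 1, 2]),
     (v (-2) 0 2 (-2) 2 0, [2, 4, 4, 0, 0, 2, 1, 2, 3, 4, 1, 1, 3]),
     (v 0 0 (-4) 0 4 0, [3, 5, 0, 3, 2, 5, 3, 4, 2, 3, 1, 2, 3])]
  inner := [
    [.inside 1, .inside 0, .golden 3 2 (.golden 2 0 (.inside 0) (.golden 3 1 (.inside 0) (.golden
     1 3 (.inside 2) (.inside 0)))) (.inside 1), .golden 0 3 (.inside 0) (.golden 2 1 (.inside 0)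
     (.inside 2)), .golden 2 1 (.inside 0) (.inside 2), .golden 2 1 (.inside 0) (.inside 2)],
    [.inside 1, .inside 1],
    [.inside 2, .inside 2],
    [.golden 3 1 (.golden 2 0 (.inside 0) (.golden 1 2 (.inside 2) (.inside 0))) (.inside 1),
     .golden 2 1 (.inside 0) (.inside 2), .golden 2 1 (.golden 0 1 (.inside 1) (.inside 0))
     (.inside 2)],
    [.golden 3 1 (.golden 2 0 (.inside 0) (.golden 1 2 (.inside 2) (.inside 0))) (.inside 1),
     .golden 2 1 (.inside 0) (.inside 2), .golden 2 1 (.golden 0 1 (.inside 1) (.inside 0))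
     (.inside 2)]]
  outer := [
    .golden 2 1 (.golden 0 2 (.golden 0 3 (.golden 1 3 (.golden 3 0 (.inside 13) (.golden 1 2
     (.inside 15) (.inside 13))) (.inside 14)) (.golden 3 0 (.golden 2 0 (.golden 0 3 (.inside 10)
     (.inside 2)) (.golden 1 2 (.half 0 2 (.inside 5) (.inside 3)) (.inside 2))) (.golden 3 1
     (.golden 3 0 (.inside 10) (.inside 2)) (.inside 12)))) (.golden 3 2 (.golden 0 3 (.golden 0 3
     (.inside 10) (.inside 2)) (.half 1 2 (.inside 1) (.inside 3))) (.golden 3 1 (.half 0 2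
     (.inside 1) (.inside 3)) (.half 1 2 (.inside 5) (.inside 3))))) (.golden 3 0 (.golden 0 3
     (.golden 0 3 (.inside 11) (.inside 4)) (.half 1 2 (.inside 1) (.inside 3))) (.golden 3 1
     (.half 0 2 (.inside 1) (.inside 3)) (.half 1 2 (.inside 5) (.inside 3)))),
    .golden 0 3 (.golden 0 3 (.golden 0 3 (.golden 2 1 (.inside 13) (.inside 15)) (.golden 2 0
     (.golden 2 0 (.inside 10) (.inside 2)) (.inside 12))) (.golden 3 1 (.golden 0 2 (.inside 10)
     (.inside 2)) (.inside 0))) (.golden 2 3 (.inside 7) (.inside 6)),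
    .golden 0 3 (.golden 0 2 (.golden 0 3 (.golden 1 2 (.golden 0 1 (.inside 14) (.inside 13))
     (.inside 15)) (.golden 2 0 (.golden 2 0 (.inside 3) (.golden 1 2 (.half 0 2 (.inside 12)
     (.inside 10)) (.inside 2))) (.inside 5))) (.golden 3 0 (.golden 2 0 (.inside 11) (.inside 4))
     (.half 1 0 (.inside 12) (.inside 10)))) (.golden 2 3 (.inside 9) (.inside 8))]

/-- The dissection of `τ T_4`. -/
def rule4 : Rule where
  table :=
    [v 0 0 0 0 0 (-1), v 0 0 0 0 0 1, v (-2) (-2) 2 4 0 1, v 2 2 0 0 0 (-1), v 0 2 0 0 (-2) (-1),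
     v 0 0 0 2 0 1, v (-2) 0 0 2 0 1, v (-2) 2 0 2 (-2) 1, v 2 0 0 0 0 (-1), v 2 0 0 0 2 (-1),
     v (-2) 0 0 2 (-2) 1, v 0 0 0 2 0 (-1)]
  splits := [(2, 1), (2, 3), (3, 0), (3, 1), (2, 0), (2, 4)]
  codes := [
    ⟨0, v 1 (-1) 1 0 1 0, v 0 0 0 0 1 0, v (-2) 0 0 1 (-1) 1, v 0 0 0 1 (-1) 0,
      [8, 10, 0, 11, 1, 5, 9, 6]⟩,
    ⟨1, v 1 0 0 0 1 (-1), v 1 0 0 0 0 0, v 0 1 0 (-1) (-1) 0, v 0 1 0 1 (-1) (-1),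
      [11, 4, 8, 0, 3]⟩,
    ⟨3, v 1 (-1) 1 0 1 0, v (-1) 1 0 0 (-1) 1, v (-1) 0 0 1 0 0, v 1 0 0 1 0 (-1),
      [8, 11, 3, 5, 9, 7]⟩,
    ⟨2, v (-1) 1 0 0 (-1) 1, v 1 (-1) 1 0 1 0, v 1 0 0 0 1 (-1), v (-1) 0 0 2 (-1) 0,
      [10, 11, 2, 5, 6, 7]⟩]
  ranks :=
    [(v (-2) 0 0 (-2) 2 (-2), [6, 5, 0, 2, 5, 1, 2, 1, 5, 4, 3, 2]),
     (v 2 0 0 2 (-2) 2, [0, 1, 6, 4, 1, 5, 4, 5, 1, 2, 3, 4]),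
     (v (-4) 0 0 0 0 (-4), [3, 0, 3, 0, 3, 0, 1, 1, 2, 0, 3, 3]),
     (v (-2) 0 2 (-2) 2 0, [2, 4, 4, 0, 0, 3, 4, 1, 1, 2, 3, 1]),
     (v 2 0 (-2) 2 (-2) 0, [2, 0, 0, 4, 4, 1, 0, 3, 3, 2, 1, 3]),
     (v 4 0 0 0 0 4, [0, 3, 0, 3, 0, 3, 2, 2, 1, 3, 0, 0]),
     (v 0 0 4 0 0 0, [0, 0, 2, 0, 0, 1, 1, 1, 0, 0, 1, 1]),
     (v 0 (-2) (-4) 0 0 0, [4, 4, 0, 0, 2, 1, 3, 0, 3, 3, 3, 1]),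
     (v 0 4 4 0 0 0, [0, 0, 0, 3, 2, 1, 0, 2, 1, 1, 0, 1]),
     (v 0 0 0 0 0 (-4), [3, 0, 0, 3, 4, 0, 0, 2, 3, 1, 2, 3]),
     (v (-4) 0 0 (-4) 4 0, [2, 3, 0, 0, 0, 1, 2, 0, 1, 2, 1, 0]),
     (v 0 0 (-4) 0 0 0, [2, 2, 0, 2, 2, 1, 1, 1, 2, 2, 1, 1]),
     (v 0 0 0 0 0 4, [1, 4, 4, 1, 0, 4, 4, 2, 1, 3, 2, 1]),
     (v 0 (-4) 0 (-4) (-4) 0, [3, 2, 0, 0, 2, 0, 1, 0, 2, 1, 2, 1]),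
     (v 0 (-4) (-4) 0 0 0, [3, 3, 3, 0, 1, 2, 3, 1, 2, 2, 3, 2]),
     (v (-4) 4 4 0 4 0, [0, 2, 5, 2, 0, 4, 3, 3, 1, 2, 2, 2]),
     (v 0 0 4 0 (-4) 0, [2, 0, 5, 2, 3, 2, 2, 3, 2, 1, 3, 4]),
     (v 2 (-2) (-2) 2 (-2) 0, [2, 0, 4, 0, 2, 1, 2, 2, 1, 0, 3, 3]),
     (v 0 2 4 0 0 0, [0, 0, 4, 4, 2, 3, 1, 4, 1, 1, 1, 3]),
     (v (-4) 0 4 (-4) 0 (-4), [3, 1, 1, 1, 3, 0, 1, 1, 2, 1, 2, 2]),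
     (v 0 0 4 (-4) 0 4, [2, 4, 2, 2, 0, 3, 3, 2, 2, 3, 2, 1]),
     (v 0 0 (-4) 4 0 (-4), [2, 0, 2, 2, 4, 1, 1, 2, 2, 1, 2, 3]),
     (v 4 0 (-4) 4 0 4, [0, 2, 2, 2, 0, 3, 2, 2, 1, 2, 1, 1])]
  inner := [
    [.inside 1, .inside 0, .golden 3 2 (.golden 2 0 (.inside 0) (.golden 3 1 (.inside 0) (.golden
     1 3 (.inside 2) (.inside 0)))) (.inside 1), .golden 0 3 (.inside 0) (.golden 2 1 (.inside 0)
     (.inside 2)), .golden 2 1 (.inside 0) (.inside 2), .golden 2 1 (.inside 0) (.inside 2)],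
    [.inside 1, .inside 1],
    [.golden 3 1 (.golden 2 0 (.inside 0) (.golden 1 2 (.inside 2) (.inside 0))) (.inside 1),
     .golden 2 1 (.inside 0) (.inside 2), .golden 2 1 (.golden 0 1 (.inside 1) (.inside 0))
     (.inside 2)],
    [.golden 3 1 (.golden 2 0 (.inside 0) (.golden 1 2 (.inside 2) (.inside 0))) (.inside 1),
     .golden 2 1 (.inside 0) (.inside 2), .golden 2 1 (.golden 0 1 (.inside 1) (.inside 0))
     (.inside 2)]]
  outer := [
    .golden 2 1 (.golden 0 2 (.golden 0 3 (.golden 1 3 (.golden 3 0 (.inside 11) (.golden 1 2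
     (.inside 13) (.inside 11))) (.inside 12)) (.golden 3 0 (.golden 2 0 (.golden 0 3 (.inside 8)
     (.inside 2)) (.golden 1 2 (.half 0 2 (.inside 5) (.inside 3)) (.inside 2))) (.golden 3 1
     (.golden 3 0 (.inside 8) (.inside 2)) (.inside 10)))) (.golden 3 2 (.golden 0 3 (.golden 0 3
     (.inside 8) (.inside 2)) (.half 1 2 (.inside 1) (.inside 3))) (.golden 3 1 (.half 0 2
     (.inside 1) (.inside 3)) (.half 1 2 (.inside 5) (.inside 3))))) (.golden 3 0 (.golden 0 3
     (.golden 0 3 (.inside 9) (.inside 4)) (.half 1 2 (.inside 1) (.inside 3))) (.golden 3 1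
     (.half 0 2 (.inside 1) (.inside 3)) (.half 1 2 (.inside 5) (.inside 3)))),
    .golden 0 3 (.golden 0 3 (.golden 0 3 (.golden 2 1 (.inside 11) (.inside 13)) (.golden 2 0
     (.golden 2 0 (.inside 8) (.inside 2)) (.inside 10))) (.golden 3 1 (.golden 0 2 (.inside 8)
     (.inside 2)) (.inside 0))) (.golden 2 3 (.inside 7) (.inside 6)),
    .golden 0 1 (.golden 0 2 (.golden 1 2 (.golden 0 1 (.inside 12) (.inside 11)) (.inside 13))
     (.golden 2 0 (.golden 2 0 (.inside 3) (.golden 1 2 (.half 0 2 (.inside 10) (.inside 8))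
     (.inside 2))) (.inside 5))) (.golden 2 0 (.golden 2 0 (.inside 9) (.inside 4)) (.half 1 0
     (.inside 10) (.inside 8)))]
/-- The data of `T_{i+1}`. -/
def kindData : Fin 4 → Kind
  | 0 => kind1
  | 1 => kind2
  | 2 => kind3
  | 3 => kind4

/-- The data of the dissection of `τ T_{i+1}`. -/
def ruleData : Fin 4 → Rule
  | 0 => rule1
  | 1 => rule2
  | 2 => rule3
  | 3 => rule4

/-! ### Decidable checks on the tables -/

namespace Kind

/-- The position of a vertex. -/
def pos (K : Kind) (n : ℕ) : LVec := K.verts.getD n 0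

/-- All decorated facets of the boundary. -/
def facets (K : Kind) : List (Facet ℕ) := (K.triangles.flatMap Facet.subs).dedup

/-- The vertices of the tetrahedra are listed, and those of the facets belong to them. -/
def wellFormed (K : Kind) : Bool :=
  (K.cells.all fun S => S.all fun n => decide (n < K.verts.length)) &&
  (K.triangles.all fun F => K.cells.any fun S => F.pts.all fun n => S.contains n)

end Kind

namespace Code

/-- The image of a vector under the rotation. -/
def rotate (c : Code) (u : LVec) : LVec := u.x • c.c₁ + u.y • c.c₂ + u.z • c.c₃

/-- The image of a point. -/
def act (c : Code) (u : LVec) : LVec := c.rotate u + c.t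

/-- The position of a vertex of the tile in the table. -/
def label (c : Code) (n : ℕ) : ℕ := c.labels.getD n 0

/-- The tetrahedra of the tile. -/
def cells (c : Code) : List (List ℕ) := (kindData c.kind).cells.map (List.map c.label)

/-- The facets of the tile. -/
def facets (c : Code) : List (Facet ℕ) := (kindData c.kind).facets.map (Facet.map c.label)

/-- The images of the basis vectors have the scalar products of the basis vectors. -/
def isometric (c : Code) : Bool :=
  decide (c.c₁.bilin c.c₁ = ⟨4, 0⟩) && decide (c.c₂.bilin c.c₂ = ⟨4, 0⟩) &&
  decide (c.c₃.bilin c.c₃ = ⟨4, 0⟩) && decide (c.c₁.bilin c.c₂ = ⟨0, 2⟩) &&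
  decide (c.c₁.bilin c.c₃ = ⟨-2, 2⟩) && decide (c.c₂.bilin c.c₃ = ⟨0, 0⟩)

end Code

/-- The part of `S` on the plane that separates it from `T`, where `r` ranks the vertices by the
values of a linear form. -/
def separate (r : List ℕ) (S T : List ℕ) : Option (List ℕ) :=
  -- The largest rank on `T`. Starting the fold at 0 is harmless: ranks are natural numbers, and an
  -- empty `T` has an empty hull.
  let c := T.foldl (fun m t => Nat.max m (r.getD t 0)) 0
  if S.all fun s => Nat.ble c (r.getD s 0) then some (S.filter fun s => r.getD s 0 == c) else none

namespace Rule

/-- The position of a vertex. -/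
def pos (R : Rule) (n : ℕ) : LVec := R.table.getD n 0

/-- The ranks order the vertices by the values of the linear form. -/
def ranked (R : Rule) (n : LVec) (r : List ℕ) : Bool :=
  (List.range R.table.length).all fun k => (List.range R.table.length).all fun l =>
    if r.getD k 0 < r.getD l 0 then (n.dot (R.pos l) - n.dot (R.pos k)).pos
    else if r.getD k 0 = r.getD l 0 then decide (n.dot (R.pos l) = n.dot (R.pos k)) else true

/-- Some linear form separates `S` from `T` with an intersection that is empty or satisfies `ok`. -/
def separated (R : Rule) (ok : List ℕ → Bool) (S T : List ℕ) : Bool :=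
  R.ranks.any fun nr => (separate nr.2 S T).any fun X => X.isEmpty || ok X

end Rule

/-- List inclusion. -/
def incl {α : Type*} [DecidableEq α] (l l' : List α) : Bool := l.all fun x => l'.contains x

/-- The relation holds between each member of the list and all later members. -/
def pairwise {α : Type*} (f : α → α → Bool) : List α → Bool
  | [] => true
  | a :: l => l.all (f a) && pairwise f l

/-- The label of the point that splits a long edge of the inflated tile. -/
def splitLabel (i : Fin 4) (a b : ℕ) : ℕ :=
  (kindData i).verts.length + (ruleData i).splits.idxOf (a, b)

/-- The pieces of an inflated facet, by labels. -/
def refineLabels (i : Fin 4) (F : Facet ℕ) : List (Facet ℕ) := F.refine id (splitLabel i)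

/-- The labels of the tiles point to the right positions, and rotations are isometries. -/
def checkCodes (i : Fin 4) : Bool :=
  (ruleData i).codes.all fun c => c.isometric &&
    (List.range (kindData c.kind).verts.length).all fun n =>
      decide (c.label n < (ruleData i).table.length) &&
      decide (c.act ((kindData c.kind).pos n) = (ruleData i).pos (c.label n))

/-- The table starts with the scaled vertices, and the labels of refined facets are right. -/
def checkRefine (i : Fin 4) : Bool :=
  ((List.range (kindData i).verts.length).all fun n =>
    decide (n < (ruleData i).table.length) &&
    decide (((kindData i).pos n).scale = (ruleData i).pos n)) &&
  (kindData i).facets.all fun F =>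
    (((refineLabels i F).all fun G => G.pts.all fun n => decide (n < (ruleData i).table.length)) &&
    decide ((refineLabels i F).map (Facet.map (ruleData i).pos) =
      F.refine (fun n => ((kindData i).pos n).scale)
        (fun a b => ((kindData i).pos a).split ((kindData i).pos b))))

/-- The ranks of all linear forms are right. -/
def checkRanks (i : Fin 4) : Bool :=
  (ruleData i).ranks.all fun nr => (ruleData i).ranked nr.1 nr.2

/-- The tetrahedra of the tile meet face-to-face. -/
def checkCells (i : Fin 4) : Bool :=
  (kindData i).cells.all fun S => (kindData i).cells.all fun T =>
    incl S T || (ruleData i).separated (fun X => incl X T) S T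

/-- The tiles of the dissection meet in common facets. -/
def checkPairs (i : Fin 4) : Bool :=
  pairwise (fun c d => c.cells.all fun S => d.cells.all fun T =>
    (ruleData i).separated (fun X => c.facets.any fun F =>
      incl X F.pts && incl F.pts S && incl F.pts T && d.facets.contains F) S T) (ruleData i).codes

/-- The tetrahedra of the dissection meet the inflated facets in facets of their refinement. -/
def checkFacets (i : Fin 4) : Bool :=
  (kindData i).facets.all fun F => (ruleData i).codes.all fun c => c.cells.all fun S =>
    (ruleData i).separated (fun X => c.facets.any fun G =>
      incl X G.pts && incl G.pts S && (refineLabels i F).contains G) S F.pts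

/-- The pieces of an inflated facet meet in common faces. -/
def checkPieces (i : Fin 4) : Bool :=
  (kindData i).facets.all fun F => (refineLabels i F).all fun G => (refineLabels i F).all fun H =>
    (ruleData i).separated (fun X => G.subs.any fun K => incl X K.pts && H.subs.contains K)
      G.pts H.pts

/-- A determinant. -/
def LVec.det (a b c : LVec) : GoldenInt :=
  a.x * (b.y * c.z - b.z * c.y) - a.y * (b.x * c.z - b.z * c.x) + a.z * (b.x * c.y - b.y * c.x)

/-- The barycentric coordinates of a point, multiplied by the determinant of the tetrahedron, show
that it lies inside. -/
def inTetrahedron : List LVec → LVec → Bool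
  | [a, b, c, d], p =>
    let D := LVec.det (b - a) (c - a) (d - a)
    -- The sign of the determinant, so that the orientation of the tetrahedron does not matter.
    let s : GoldenInt := if D.nonneg then ⟨1, 0⟩ else ⟨-1, 0⟩
    let β := s * LVec.det (p - a) (c - a) (d - a)
    let γ := s * LVec.det (b - a) (p - a) (d - a)
    let δ := s * LVec.det (b - a) (c - a) (p - a)
    (s * D).pos && β.nonneg && γ.nonneg && δ.nonneg && (s * D - β - γ - δ).nonneg &&
      -- Testing the vector identity itself makes a proof of Cramer's rule unnecessary.
      decide ((s * D) • (p - a) = β • (b - a) + γ • (c - a) + δ • (d - a))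
  | _, _ => false

/-- The bisection shows that the simplex is covered by the tetrahedra. -/
def Bisection.check (cells : List (List LVec)) : Bisection → List LVec → Bool
  | inside k, ps => ps.all (inTetrahedron (cells.getD k []))
  | golden k l s t, ps =>
    let a := ps.getD k 0
    let b := ps.getD l 0
    -- The golden section of the edge: `τ - 1 = 1/τ` is the longer share, and `m` stays in the
    -- lattice.
    let m := a + (⟨-1, 1⟩ : GoldenInt) • (b - a)
    let r := ps.filter fun p => !decide (p = a) && !decide (p = b)
    !r.isEmpty && s.check cells (a :: m :: r) && t.check cells (m :: b :: r)
  | half k l s t, ps =>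
    let a := ps.getD k 0
    let b := ps.getD l 0
    -- Integer division may round; the test `m + m = a + b` rejects that case.
    let m : LVec := ⟨⟨(a.x.a + b.x.a) / 2, (a.x.b + b.x.b) / 2⟩,
      ⟨(a.y.a + b.y.a) / 2, (a.y.b + b.y.b) / 2⟩, ⟨(a.z.a + b.z.a) / 2, (a.z.b + b.z.b) / 2⟩⟩
    let r := ps.filter fun p => !decide (p = a) && !decide (p = b)
    !r.isEmpty && decide (m + m = a + b) && s.check cells (a :: m :: r) &&
      t.check cells (m :: b :: r)

/-- The relation holds between corresponding members of the lists. -/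
def all₂ {α β : Type*} (f : α → β → Bool) : List α → List β → Bool
  | [], [] => true
  | a :: l, b :: m => f a b && all₂ f l m
  | _, _ => false

/-- The dissection covers the inflated tile and is covered by it. -/
def checkCover (i : Fin 4) : Bool :=
  all₂ (fun c l => all₂ (fun S (B : Bisection) => B.check
      ((kindData i).cells.map (List.map fun n => ((kindData i).pos n).scale))
      (S.map (ruleData i).pos)) c.cells l) (ruleData i).codes (ruleData i).inner &&
  all₂ (fun S (B : Bisection) => B.check
      ((ruleData i).codes.flatMap fun c => c.cells.map (List.map (ruleData i).pos))
      (S.map fun n => ((kindData i).pos n).scale)) (kindData i).cells (ruleData i).outer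


/-! ### Evaluation of the checks -/

theorem wellFormed_kindData (i : Fin 4) : (kindData i).wellFormed = true := by
  fin_cases i <;> decide +kernel

theorem checkCodes_eq_true (i : Fin 4) : checkCodes i = true := by
  fin_cases i <;> decide +kernel

theorem checkRefine_eq_true (i : Fin 4) : checkRefine i = true := by
  fin_cases i <;> decide +kernel

theorem checkRanks_eq_true (i : Fin 4) : checkRanks i = true := by
  fin_cases i <;> decide +kernel

theorem checkCells_eq_true (i : Fin 4) : checkCells i = true := by
  fin_cases i <;> decide +kernel

theorem checkPairs_eq_true (i : Fin 4) : checkPairs i = true := by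
  fin_cases i <;> decide +kernel

theorem checkFacets_eq_true (i : Fin 4) : checkFacets i = true := by
  fin_cases i <;> decide +kernel

theorem checkPieces_eq_true (i : Fin 4) : checkPieces i = true := by
  fin_cases i <;> decide +kernel

theorem checkCover_eq_true (i : Fin 4) : checkCover i = true := by
  fin_cases i <;> decide +kernel

open GoldenInt

/-! ### Convex hulls -/

/-- The convex hull of the points of a list. -/
def listHull (l : List E3) : Set E3 := convexHull ℝ {x | x ∈ l}

theorem listHull_nil : listHull [] = ∅ := by simp [listHull]

theorem listHull_mono {l m : List E3} (h : ∀ x ∈ l, x ∈ m) : listHull l ⊆ listHull m :=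
  convexHull_mono h

theorem listHull_map_mono {ι : Type*} (f : ι → E3) {l m : List ι} (h : ∀ x ∈ l, x ∈ m) :
    listHull (l.map f) ⊆ listHull (m.map f) :=
  listHull_mono fun x hx => by
    obtain ⟨n, hn, rfl⟩ := List.mem_map.1 hx
    exact List.mem_map_of_mem (h n hn)

/-- A supporting plane cuts out an extreme set: a convex combination whose value does not exceed the
minimum `c` puts no weight on points with a larger value. -/
theorem mem_convexHull_level {S : Set E3} (f : E3 →ₗ[ℝ] ℝ) {c : ℝ} (hS : ∀ s ∈ S, c ≤ f s)
    {x : E3} (hx : x ∈ convexHull ℝ S) (hfx : f x ≤ c) :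
    x ∈ convexHull ℝ {s ∈ S | f s = c} := by
  set X := {s ∈ S | f s = c}
  have hX : ∀ y ∈ convexHull ℝ X, f y = c := by
    intro y hy
    have : convexHull ℝ X ⊆ {y | f y = c} :=
      convexHull_min (fun s hs => hs.2) (convex_hyperplane f.isLinear c)
    exact this hy
  -- It suffices that the right side is convex, as it contains `S`. A proper combination that
  -- involves a point strictly above level `c` is itself strictly above.
  have key : convexHull ℝ S ⊆ {y | c < f y ∨ y ∈ convexHull ℝ X} := by
    refine convexHull_min (fun s hs => ?_) ?_
    · rcases (hS s hs).lt_or_eq with h | h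
      · exact Or.inl h
      · exact Or.inr (subset_convexHull ℝ X ⟨hs, h.symm⟩)
    · intro y hy z hz a b ha hb hab
      have hy' : c ≤ f y := hy.elim le_of_lt fun h => (hX y h).ge
      have hz' : c ≤ f z := hz.elim le_of_lt fun h => (hX z h).ge
      rcases ha.eq_or_lt with rfl | ha'
      · obtain rfl : b = 1 := by linarith
        simpa using hz
      rcases hb.eq_or_lt with rfl | hb'
      · obtain rfl : a = 1 := by linarith
        simpa using hy
      have hc : a * c + b * c = c := by rw [← add_mul, hab, one_mul]
      rcases hy with hy | hy
      · left
        simp only [map_add, map_smul, smul_eq_mul]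
        nlinarith
      rcases hz with hz | hz
      · left
        simp only [map_add, map_smul, smul_eq_mul]
        nlinarith
      · exact Or.inr (convex_convexHull ℝ X hy hz ha hb hab)
  rcases key hx with h | h
  · exact absurd h (not_lt.2 hfx)
  · exact h

theorem foldl_max_spec (r : ℕ → ℕ) (T : List ℕ) (m : ℕ) :
    m ≤ T.foldl (fun m t => Nat.max m (r t)) m ∧
    (∀ t ∈ T, r t ≤ T.foldl (fun m t => Nat.max m (r t)) m) ∧
    (T.foldl (fun m t => Nat.max m (r t)) m = m ∨
      ∃ t ∈ T, r t = T.foldl (fun m t => Nat.max m (r t)) m) := by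
  induction T generalizing m with
  | nil => simp
  | cons a T ih =>
    obtain ⟨h1, h2, h3⟩ := ih (Nat.max m (r a))
    have hm : m ≤ Nat.max m (r a) := Nat.le_max_left _ _
    have ha : r a ≤ Nat.max m (r a) := Nat.le_max_right _ _
    simp only [List.foldl_cons, List.mem_cons, forall_eq_or_imp, exists_eq_or_imp]
    refine ⟨hm.trans h1, ⟨ha.trans h1, h2⟩, ?_⟩
    rcases h3 with h3 | h3
    · rw [h3]
      rcases le_total m (r a) with h | h
      · exact Or.inr (Or.inl (Nat.max_eq_right h).symm)
      · exact Or.inl (Nat.max_eq_left h)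
    · exact Or.inr (Or.inr h3)

/-! ### Soundness of the checks -/

/-- The vertices of the prototiles in space. -/
noncomputable def kindPos (i : Fin 4) (n : ℕ) : E3 := ((kindData i).pos n).ev tau

/-- The vertices of the dissections of the inflated prototiles in space. -/
noncomputable def rulePos (i : Fin 4) (n : ℕ) : E3 := ((ruleData i).pos n).ev tau

theorem ranked_spec {i : Fin 4} {nr : LVec × List ℕ} (h : nr ∈ (ruleData i).ranks) {k l : ℕ}
    (hk : k < (ruleData i).table.length) (hl : l < (ruleData i).table.length) :
    (nr.2.getD k 0 < nr.2.getD l 0 → nr.1.form (rulePos i k) < nr.1.form (rulePos i l)) ∧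
    (nr.2.getD k 0 = nr.2.getD l 0 → nr.1.form (rulePos i k) = nr.1.form (rulePos i l)) := by
  have := List.all_eq_true.1 (checkRanks_eq_true i) nr h
  have := List.all_eq_true.1 this k (List.mem_range.2 hk)
  have := List.all_eq_true.1 this l (List.mem_range.2 hl)
  simp only [rulePos, LVec.form_ev]
  constructor
  · intro hlt
    rw [if_pos hlt] at this
    have := pos_val this
    rw [val_sub] at this
    linarith
  · intro heq
    rw [if_neg (by omega), if_pos heq] at this
    rw [of_decide_eq_true this]

/-- The form is at most `c` on the hull of `T` and at least `c` on the hull of `S`, so a common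
point lies at level `c`, hence in the hull of the vertices of `S` at that level. This is the only
source of information about intersections; the predicate `ok` says what these vertices have to
satisfy. -/
theorem separated_spec {i : Fin 4} {ok : List ℕ → Bool} {S T : List ℕ}
    (h : (ruleData i).separated ok S T = true)
    (hS : ∀ s ∈ S, s < (ruleData i).table.length) (hT : ∀ t ∈ T, t < (ruleData i).table.length)
    {x : E3} (hxS : x ∈ listHull (S.map (rulePos i))) (hxT : x ∈ listHull (T.map (rulePos i))) :
    ∃ X, ok X = true ∧ (∀ s ∈ X, s ∈ S) ∧ x ∈ listHull (X.map (rulePos i)) := by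
  obtain ⟨nr, hnr, h⟩ := List.any_eq_true.1 h
  obtain ⟨X, hX, h⟩ := (Option.any_eq_true _ _).1 h
  unfold separate at hX
  set r : ℕ → ℕ := fun t => nr.2.getD t 0 
  obtain ⟨-, h2, h3⟩ := foldl_max_spec r T 0
  set c := T.foldl (fun m t => Nat.max m (r t)) 0
  obtain ⟨t₀, ht₀, ht₀c⟩ : ∃ t ∈ T, r t = c := by
    rcases h3 with h3 | h3
    · cases T with
      | nil => simp [listHull_nil] at hxT
      | cons t T =>
        refine ⟨t, by simp, ?_⟩
        have := h2 t (by simp)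
        omega
    · exact h3
  dsimp only at hX
  split_ifs at hX with hall
  obtain rfl := Option.some.inj hX
  have hall' : ∀ s ∈ S, c ≤ r s := fun s hs => Nat.le_of_ble_eq_true (List.all_eq_true.1 hall s hs)
  set f := nr.1.form
  have hle : ∀ k l, k < (ruleData i).table.length → l < (ruleData i).table.length → r k ≤ r l →
      f (rulePos i k) ≤ f (rulePos i l) := by
    intro k l hk hl hkl
    obtain ⟨h1, h2⟩ := ranked_spec hnr hk hl
    rcases hkl.lt_or_eq with hkl | hkl
    · exact (h1 hkl).le
    · exact (h2 hkl).le
  have hfx : f x ≤ f (rulePos i t₀) := by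
    have : listHull (T.map (rulePos i)) ⊆ {y | f y ≤ f (rulePos i t₀)} := by
      refine convexHull_min ?_ (convex_halfSpace_le f.isLinear _)
      intro y hy
      obtain ⟨t, ht, rfl⟩ := List.mem_map.1 hy
      exact hle t t₀ (hT t ht) (hT t₀ ht₀) (ht₀c ▸ h2 t ht)
    exact this hxT
  have hx := mem_convexHull_level f (c := f (rulePos i t₀)) (fun y hy => by
    obtain ⟨s, hs, rfl⟩ := List.mem_map.1 hy
    exact hle t₀ s (hT t₀ ht₀) (hS s hs) (ht₀c ▸ hall' s hs)) hxS hfx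
  have hxX : x ∈ listHull ((S.filter fun s => r s == c).map (rulePos i)) := by
    refine convexHull_mono ?_ hx
    rintro y ⟨hy, hyf⟩
    obtain ⟨s, hs, rfl⟩ := List.mem_map.1 hy
    refine List.mem_map_of_mem (List.mem_filter.2 ⟨hs, beq_iff_eq.2 ?_⟩)
    by_contra hne
    have hlt : r t₀ < r s := by have := hall' s hs; omega
    exact absurd hyf ((ranked_spec hnr (hT t₀ ht₀) (hS s hs)).1 hlt).ne'
  refine ⟨_, ?_, fun s hs => (List.mem_filter.1 hs).1, hxX⟩
  rcases Bool.or_eq_true_iff.1 h with h | h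
  · rw [List.isEmpty_iff.1 h] at hxX
    simp [listHull_nil] at hxX
  · exact h

theorem incl_iff {α : Type*} [DecidableEq α] {l m : List α} :
    incl l m = true ↔ ∀ x ∈ l, x ∈ m := by
  simp [incl]

theorem pairwise_iff {α : Type*} {f : α → α → Bool} {l : List α} :
    pairwise f l = true ↔ l.Pairwise fun a b => f a b = true := by
  induction l with
  | nil => simp [pairwise]
  | cons a l ih => simp [pairwise, ih]

theorem all₂_left {α β : Type*} {f : α → β → Bool} {l : List α} {m : List β}
    (h : all₂ f l m = true) : ∀ a ∈ l, ∃ b, f a b = true := by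
  induction l generalizing m with
  | nil => simp
  | cons a l ih =>
    cases m with
    | nil => simp [all₂] at h
    | cons b m =>
      simp only [all₂, Bool.and_eq_true] at h
      simp only [List.mem_cons, forall_eq_or_imp]
      exact ⟨⟨b, h.1⟩, ih h.2⟩

/-! ### Bisection of simplices -/

/-- A point has a weight `α` at `a`, a weight `β` at `b`, and the rest in the hull of `R`. Since `m
= s a + t b`, the point `m` can absorb all of the weight at `b` if `s β ≤ t α`, and all of the
weight at `a` otherwise. -/
theorem convexHull_bisect {a b m : E3} {R : Set E3} (hR : R.Nonempty) {s t : ℝ} (hs : 0 < s)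
    (ht : 0 < t) (hst : s + t = 1) (hm : m = s • a + t • b) :
    convexHull ℝ (insert a (insert b R)) ⊆
      convexHull ℝ (insert a (insert m R)) ∪ convexHull ℝ (insert m (insert b R)) := by
  intro x hx
  rw [convexHull_insert (Set.insert_nonempty _ _), convexJoin_singleton_left, Set.mem_iUnion₂] at hx
  obtain ⟨y, hy, hxy⟩ := hx
  rw [convexHull_insert hR, convexJoin_singleton_left, Set.mem_iUnion₂] at hy
  obtain ⟨z, hz, hyz⟩ := hy
  obtain ⟨u, u', hu, hu', huu, rfl⟩ := hyz
  obtain ⟨w, w', hw, hw', hww, rfl⟩ := hxy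
  -- the point is `w a + w' u b + w' u' z`
  have hmem : ∀ (p q : E3) (α β γ : ℝ), 0 ≤ α → 0 ≤ β → 0 ≤ γ → α + β + γ = 1 →
      α • p + β • q + γ • z ∈ convexHull ℝ (insert p (insert q R)) := by
    intro p q α β γ hα hβ hγ h1
    have hp : p ∈ convexHull ℝ (insert p (insert q R)) := subset_convexHull ℝ _ (by simp)
    have hq : q ∈ convexHull ℝ (insert p (insert q R)) := subset_convexHull ℝ _ (by simp)
    have hz' : z ∈ convexHull ℝ (insert p (insert q R)) :=
      convexHull_mono (fun y hy => by simp [hy]) hz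
    have := (convex_convexHull ℝ (insert p (insert q R))).sum_mem (t := Finset.univ)
      (w := ![α, β, γ]) (z := ![p, q, z]) (by
        intro i _; fin_cases i <;> simp [hα, hβ, hγ]) (by simp [Fin.sum_univ_three, h1]) (by
        intro i _; fin_cases i <;> simp [hp, hq, hz'])
    simpa [Fin.sum_univ_three] using this
  have hwu : 0 ≤ w' * u := mul_nonneg hw' hu
  have hwu' : 0 ≤ w' * u' := mul_nonneg hw' hu'
  rcases le_total (s * (w' * u)) (t * w) with h | h
  · left
    have := hmem a m (w - s * (w' * u) / t) (w' * u / t) (w' * u')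
      (by rw [sub_nonneg, div_le_iff₀ ht]; linarith) (by positivity) hwu' (by
        field_simp
        have hs' : s = 1 - t := by linarith
        have hu'' : u' = 1 - u := by linarith
        have hw'' : w' = 1 - w := by linarith
        rw [hs', hu'', hw'']; ring)
    convert this using 1
    rw [hm]
    have h1 : (w' * u / t) • (s • a + t • b) = (s * (w' * u) / t) • a + (w' * u) • b := by
      rw [smul_add, smul_smul, smul_smul]; congr 2 <;> field_simp
    rw [h1, sub_smul, smul_add, smul_smul, smul_smul]
    abel
  · right
    have := hmem m b (w / s) (w' * u - t * w / s) (w' * u')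
      (by positivity) (by rw [sub_nonneg, div_le_iff₀ hs]; linarith) hwu' (by
        field_simp
        have hs' : t = 1 - s := by linarith
        have hu'' : u' = 1 - u := by linarith
        have hw'' : w' = 1 - w := by linarith
        rw [hs', hu'', hw'']; ring)
    convert this using 1
    rw [hm]
    have h1 : (w / s) • (s • a + t • b) = w • a + (t * w / s) • b := by
      rw [smul_add, smul_smul, smul_smul]; congr 2 <;> field_simp
    rw [h1, sub_smul, smul_add, smul_smul, smul_smul]
    abel

theorem listHull_bisect {a b m : E3} {l R : List E3} (hR : R ≠ []) {s t : ℝ} (hs : 0 < s)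
    (ht : 0 < t) (hst : s + t = 1) (hm : m = s • a + t • b)
    (hl : ∀ x ∈ l, x = a ∨ x = b ∨ x ∈ R) :
    listHull l ⊆ listHull (a :: m :: R) ∪ listHull (m :: b :: R) := by
  have hR' : {x | x ∈ R}.Nonempty := List.exists_mem_of_ne_nil R hR
  have e : ∀ p q : E3, {x | x ∈ p :: q :: R} = insert p (insert q {x | x ∈ R}) := by
    intro p q; ext x; simp
  refine (convexHull_mono (fun x hx => ?_)).trans
    ((convexHull_bisect hR' hs ht hst hm).trans (by simp only [listHull, e]; rfl))
  simpa using hl x hx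

theorem inTetrahedron_spec {l : List LVec} {p : LVec} (h : inTetrahedron l p = true) :
    p.ev tau ∈ listHull (l.map (LVec.ev tau)) := by
  unfold inTetrahedron at h
  split at h
  swap
  · simp at h
  rename_i a b c d
  simp only [Bool.and_eq_true] at h
  obtain ⟨⟨⟨⟨⟨hD, hβ⟩, hγ⟩, hδ⟩, hα⟩, he⟩ := h
  -- From here on only the signs and the vector identity matter, not that the numbers are
  -- determinants.
  generalize (if (LVec.det (b - a) (c - a) (d - a)).nonneg then (⟨1, 0⟩ : GoldenInt)
    else ⟨-1, 0⟩) = s at *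
  generalize s * LVec.det (b - a) (c - a) (d - a) = D at *
  generalize s * LVec.det (p - a) (c - a) (d - a) = β at *
  generalize s * LVec.det (b - a) (p - a) (d - a) = γ at *
  generalize s * LVec.det (b - a) (c - a) (p - a) = δ at *
  have he := congrArg (LVec.ev tau) (of_decide_eq_true he)
  simp only [LVec.ev_smul tau_sq, LVec.ev_add, LVec.ev_sub] at he
  have hD := pos_val hD
  have hβ := nonneg_val hβ
  have hγ := nonneg_val hγ
  have hδ := nonneg_val hδ
  have hα := nonneg_val hα
  simp only [val_sub] at hα
  generalize val tau D = D' at *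
  generalize val tau β = β' at *
  generalize val tau γ = γ' at *
  generalize val tau δ = δ' at *
  have hx : p.ev tau = ((D' - β' - γ' - δ') / D') • a.ev tau + (β' / D') • b.ev tau +
      (γ' / D') • c.ev tau + (δ' / D') • d.ev tau := by
    have : p.ev tau = (D'⁻¹ * D') • (p.ev tau - a.ev tau) + a.ev tau := by
      rw [inv_mul_cancel₀ hD.ne', one_smul]; abel
    rw [this, mul_smul, he]
    ext j
    simp
    field_simp
    ring
  rw [hx]
  have := (convex_convexHull ℝ {x | x ∈ [a, b, c, d].map (LVec.ev tau)}).sum_mem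
    (t := Finset.univ) (w := ![(D' - β' - γ' - δ') / D', β' / D', γ' / D', δ' / D'])
    (z := ![a.ev tau, b.ev tau, c.ev tau, d.ev tau]) (by
      intro i _; fin_cases i <;> simp <;> positivity) (by
      simp [Fin.sum_univ_four]; field_simp; ring) (by
      intro i _; fin_cases i <;> exact subset_convexHull ℝ _ (by simp))
  simpa [Fin.sum_univ_four, listHull] using this

theorem Bisection.check_spec {cells : List (List LVec)} {B : Bisection} {ps : List LVec}
    (h : B.check cells ps = true) {x : E3} (hx : x ∈ listHull (ps.map (LVec.ev tau))) :
    ∃ C ∈ cells, x ∈ listHull (C.map (LVec.ev tau)) := by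
  have hfilter : ∀ (ps : List LVec) (a b : LVec), ∀ y ∈ ps.map (LVec.ev tau),
      y = a.ev tau ∨ y = b.ev tau ∨
      y ∈ (ps.filter fun p => !decide (p = a) && !decide (p = b)).map (LVec.ev tau) := by
    intro ps a b y hy
    obtain ⟨p, hp, rfl⟩ := List.mem_map.1 hy
    by_cases ha : p = a
    · exact Or.inl (ha ▸ rfl)
    by_cases hb : p = b
    · exact Or.inr (Or.inl (hb ▸ rfl))
    · exact Or.inr (Or.inr (List.mem_map_of_mem (by simp [hp, ha, hb])))
  have htau := one_lt_tau
  have htau2 := Real.goldenRatio_lt_two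
  induction B generalizing ps with
  | inside k =>
    simp only [Bisection.check, List.all_eq_true] at h
    have hsub : listHull (ps.map (LVec.ev tau)) ⊆
        listHull ((cells.getD k []).map (LVec.ev tau)) := by
      refine convexHull_min ?_ (convex_convexHull ℝ _)
      intro y hy
      obtain ⟨p, hp, rfl⟩ := List.mem_map.1 hy
      exact inTetrahedron_spec (h p hp)
    have hx' := hsub hx
    refine ⟨_, ?_, hx'⟩
    -- An index out of range yields the empty list, whose hull contains no point.
    rw [List.getD_eq_getElem?_getD] at hx' ⊢
    by_cases hk : k < cells.length
    · simp [hk]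
    · simp [hk, listHull_nil] at hx'
  | golden k l s t ihs iht =>
    simp only [Bisection.check, Bool.and_eq_true] at h
    obtain ⟨⟨hne, hs⟩, ht⟩ := h
    have := listHull_bisect (m := (ps.getD k 0 + (⟨-1, 1⟩ : GoldenInt) •
        (ps.getD l 0 - ps.getD k 0)).ev tau)
      -- The weights of the golden section, positive because `1 < τ < 2`.
      (by simpa using hne) (s := 2 - tau) (t := tau - 1) (by linarith)
      (by linarith) (by ring) (by
        rw [LVec.ev_add, LVec.ev_smul tau_sq, LVec.ev_sub]
        have : val tau ⟨-1, 1⟩ = tau - 1 := by simp [val]; ring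
        rw [this]
        module) (hfilter ps (ps.getD k 0) (ps.getD l 0)) hx
    rcases this with h' | h'
    · exact ihs hs (by simpa using h')
    · exact iht ht (by simpa using h')
  | half k l s t ihs iht =>
    simp only [Bisection.check, Bool.and_eq_true] at h
    obtain ⟨⟨⟨hne, hm⟩, hs⟩, ht⟩ := h
    have hm := congrArg (LVec.ev tau) (of_decide_eq_true hm)
    rw [LVec.ev_add, LVec.ev_add] at hm
    generalize hm' : (LVec.mk _ _ _ : LVec) = m at hm hs ht
    have := listHull_bisect (m := m.ev tau) (by simpa using hne) (s := 1 / 2) (t := 1 / 2) (by norm_num)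
      (by norm_num) (by norm_num) (by
        rw [← smul_add, ← hm, ← two_smul ℝ, smul_smul]; norm_num)
      (hfilter ps (ps.getD k 0) (ps.getD l 0)) hx
    rcases this with h' | h'
    · exact ihs hs (by simpa using h')
    · exact iht ht (by simpa using h')

open GoldenInt

/-! ### Prototiles and their copies -/

theorem tau_def : tau = (1 + √5) / 2 := rfl

theorem ptA_eq : ptA = (v 0 0 0 0 (-1) 0).ev tau := by
  ext j; fin_cases j <;> simp [ptA, pt, LVec.ev, v, val]; linarith [tau_sq, tau_def]

theorem ptB_eq : ptB = (v 0 0 0 0 1 0).ev tau := by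
  ext j; fin_cases j <;> simp [ptB, pt, LVec.ev, v, val]; linarith [tau_sq, tau_def]

theorem ptC_eq : ptC = (v 0 (-2) 2 0 1 0).ev tau := by
  ext j; fin_cases j <;> simp [ptC, pt, LVec.ev, v, val] <;> linarith [tau_sq, tau_def]

theorem ptD_eq : ptD = (v 0 2 0 (-2) (-1) 0).ev tau := by
  ext j; fin_cases j <;> simp [ptD, pt, LVec.ev, v, val] <;> linarith [tau_sq, tau_def]

theorem ptP_eq : ptP = (v 0 (-2) 2 2 1 0).ev tau := by
  ext j; fin_cases j <;> simp [ptP, pt, LVec.ev, v, val] <;> linarith [tau_sq, tau_def]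

theorem ptQ_eq : ptQ = (v 0 2 0 0 (-1) 0).ev tau := by
  ext j; fin_cases j <;> simp [ptQ, pt, LVec.ev, v, val] <;> linarith [tau_sq, tau_def]

theorem ptR_eq : ptR = (v 0 0 2 0 (-1) 0).ev tau := by
  ext j; fin_cases j <;> simp [ptR, pt, LVec.ev, v, val] <;> linarith [tau_sq, tau_def]

theorem ptS_eq : ptS = (v 0 0 2 0 1 0).ev tau := by
  ext j; fin_cases j <;> simp [ptS, pt, LVec.ev, v, val] <;> linarith [tau_sq, tau_def]

theorem ptU_eq : ptU = (v 0 (-2) 0 0 1 0).ev tau := by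
  ext j; fin_cases j <;> simp [ptU, pt, LVec.ev, v, val] <;> linarith [tau_sq, tau_def]

theorem ptV_eq : ptV = (v 2 0 0 0 1 (-2)).ev tau := by
  ext j; fin_cases j <;> simp [ptV, pt, LVec.ev, v, val] <;> linarith [tau_sq, tau_def]

theorem ptW_eq : ptW = (v 2 0 0 0 1 0).ev tau := by
  ext j; fin_cases j <;> simp [ptW, pt, LVec.ev, v, val] <;> linarith [tau_sq, tau_def]

theorem protoCells_eq (i : Fin 4) :
    protoCells i = {S | ∃ C ∈ (kindData i).cells, S = {x | x ∈ C.map (kindPos i)}} := by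
  fin_cases i <;> ext S
  · simp only [kindData, kind1, List.mem_cons, List.not_mem_nil, or_false, exists_eq_or_imp,
      exists_eq_left, List.map_cons, List.map_nil, Set.mem_ofPred_eq]
    simp only [protoCells, ptA_eq, ptB_eq, ptC_eq, ptD_eq, ptP_eq, ptQ_eq, ptR_eq, ptS_eq]
    rfl
  · simp only [kindData, kind2, List.mem_cons, List.not_mem_nil, or_false, exists_eq_or_imp,
      exists_eq_left, List.map_cons, List.map_nil, Set.mem_ofPred_eq]
    simp only [protoCells, ptA_eq, ptB_eq, ptC_eq, ptP_eq, ptU_eq]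
    rfl
  · simp only [kindData, kind3, List.mem_cons, List.not_mem_nil, or_false, exists_eq_or_imp,
      exists_eq_left, List.map_cons, List.map_nil, Set.mem_ofPred_eq]
    simp only [protoCells, ptA_eq, ptB_eq, ptP_eq, ptQ_eq, ptV_eq, ptW_eq]
    rfl
  · simp only [kindData, kind4, List.mem_cons, List.not_mem_nil, or_false, exists_eq_or_imp,
      exists_eq_left, List.map_cons, List.map_nil, Set.mem_ofPred_eq]
    simp only [protoCells, ptA_eq, ptB_eq, ptP_eq, ptQ_eq, ptV_eq, ptS_eq]
    rfl

namespace Facet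

/-- The convex hull of a facet. -/
def hull (F : Facet E3) : Set E3 := listHull F.pts

/-- The pieces, with all their faces, of the inflated facet. -/
noncomputable def inflate (F : Facet E3) : List (Facet E3) := F.refine (fun x => tau • x) splitPoint

end Facet

namespace PlacedTile

/-- The vertices of a copy. -/
noncomputable def pos (p : PlacedTile) (n : ℕ) : E3 := p.map (kindPos p.kind n)

theorem mem_cells {p : PlacedTile} {S : Set E3} :
    S ∈ p.cells ↔ ∃ C ∈ (kindData p.kind).cells, S = {x | x ∈ C.map p.pos} := by
  simp only [cells, protoCells_eq, Set.mem_image, Set.mem_ofPred_eq]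
  have e : ∀ C : List ℕ, p.map '' {x | x ∈ C.map (kindPos p.kind)} = {x | x ∈ C.map p.pos} := by
    intro C; ext x; simp [pos]
  constructor
  · rintro ⟨_, ⟨C, hC, rfl⟩, rfl⟩
    exact ⟨C, hC, e C⟩
  · rintro ⟨C, hC, rfl⟩
    exact ⟨_, ⟨C, hC, rfl⟩, e C⟩

/-- The decorated facets of a copy. -/
def facets (p : PlacedTile) : Set (Facet E3) :=
  {F | ∃ G ∈ (kindData p.kind).facets, F = G.map p.pos}

theorem mem_support {p : PlacedTile} {x : E3} :
    x ∈ p.support ↔ ∃ C ∈ (kindData p.kind).cells, x ∈ listHull (C.map p.pos) := by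
  simp only [support, Set.mem_iUnion₂, mem_cells, exists_prop]
  constructor
  · rintro ⟨_, ⟨C, hC, rfl⟩, hx⟩
    exact ⟨C, hC, hx⟩
  · rintro ⟨C, hC, hx⟩
    exact ⟨_, ⟨C, hC, rfl⟩, hx⟩

theorem subs_mem_facets {p : PlacedTile} {F G : Facet E3} (hF : F ∈ p.facets) (hG : G ∈ F.subs) :
    G ∈ p.facets := by
  obtain ⟨F, hF, rfl⟩ := hF
  rw [Facet.subs_map, List.mem_map] at hG
  obtain ⟨G, hG, rfl⟩ := hG
  refine ⟨G, ?_, rfl⟩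
  simp only [Kind.facets, List.mem_dedup, List.mem_flatMap] at hF ⊢
  obtain ⟨T, hT, hF⟩ := hF
  exact ⟨T, hT, Facet.subs_trans hF hG⟩

theorem finite_facets (p : PlacedTile) : p.facets.Finite := by
  refine (((kindData p.kind).facets.map (Facet.map p.pos)).finite_toSet).subset ?_
  rintro _ ⟨G, hG, rfl⟩
  exact List.mem_map_of_mem hG

/-- The tetrahedra of the copies meet in common decorated facets. -/
def Matched (p q : PlacedTile) : Prop :=
  ∀ S ∈ p.cells, ∀ T ∈ q.cells, ∀ x ∈ convexHull ℝ S, x ∈ convexHull ℝ T →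
    ∃ F ∈ p.facets, F ∈ q.facets ∧ {x | x ∈ F.pts} ⊆ S ∧ {x | x ∈ F.pts} ⊆ T ∧ x ∈ F.hull

theorem Matched.symm {p q : PlacedTile} (h : p.Matched q) : q.Matched p := by
  intro S hS T hT x hxS hxT
  obtain ⟨F, h1, h2, h3, h4, h5⟩ := h T hT S hS x hxT hxS
  exact ⟨F, h2, h1, h4, h3, h5⟩

theorem move_map (A : E3 ≃ₗᵢ[ℝ] E3) (b : E3) (p : PlacedTile) (x : E3) :
    (move A b p).map x = A (p.map x) + b := by
  simp [move, map, add_assoc]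

theorem move_pos (A : E3 ≃ₗᵢ[ℝ] E3) (b : E3) (p : PlacedTile) (n : ℕ) :
    (move A b p).pos n = A (p.pos n) + b := move_map A b p _

end PlacedTile

/-- The affine map `x ↦ A x + b` is injective. -/
theorem motion_injective (A : E3 ≃ₗᵢ[ℝ] E3) (b : E3) : Function.Injective fun x => A x + b :=
  (add_left_injective b).comp A.injective

theorem convexHull_motion (A : E3 ≃ₗᵢ[ℝ] E3) (b : E3) (S : Set E3) :
    convexHull ℝ ((fun x => A x + b) '' S) = (fun x => A x + b) '' convexHull ℝ S := by
  have : (fun x => A x + b) = (A.toLinearEquiv.toLinearMap.toAffineMap + AffineMap.const ℝ E3 b :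
      E3 →ᵃ[ℝ] E3) := by
    ext x; simp
  rw [this, AffineMap.image_convexHull]

theorem listHull_motion (A : E3 ≃ₗᵢ[ℝ] E3) (b : E3) (l : List E3) :
    listHull (l.map fun x => A x + b) = (fun x => A x + b) '' listHull l := by
  rw [listHull, listHull, ← convexHull_motion]
  congr 1; ext x; simp

theorem listHull_smul (c : ℝ) (l : List E3) :
    listHull (l.map fun x => c • x) = c • listHull l := by
  rw [listHull, listHull, ← convexHull_smul]
  congr 1; ext x; simp [Set.mem_smul_set]

namespace PlacedTile

theorem move_cells (A : E3 ≃ₗᵢ[ℝ] E3) (b : E3) (p : PlacedTile) :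
    (move A b p).cells = (fun S => (fun x => A x + b) '' S) '' p.cells := by
  simp only [cells, Set.image_image]
  refine Set.image_congr fun S _ => Set.image_congr fun x _ => move_map A b p x

theorem move_facets (A : E3 ≃ₗᵢ[ℝ] E3) (b : E3) (p : PlacedTile) :
    (move A b p).facets = Facet.map (fun x => A x + b) '' p.facets := by
  ext F
  have e : (move A b p).pos = (fun x => A x + b) ∘ p.pos := funext (move_pos A b p)
  simp only [facets, Set.mem_image, Set.mem_ofPred_eq, e, ← Facet.map_map]
  constructor
  · rintro ⟨G, hG, rfl⟩
    exact ⟨_, ⟨G, hG, rfl⟩, rfl⟩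
  · rintro ⟨_, ⟨G, hG, rfl⟩, rfl⟩
    exact ⟨G, hG, rfl⟩

theorem move_support (A : E3 ≃ₗᵢ[ℝ] E3) (b : E3) (p : PlacedTile) :
    (move A b p).support = (fun x => A x + b) '' p.support := by
  simp only [support, move_cells, Set.biUnion_image, convexHull_motion, Set.image_iUnion₂]

theorem mem_hull_motion {A : E3 ≃ₗᵢ[ℝ] E3} {b : E3} {F : Facet E3} {x : E3} (h : x ∈ F.hull) :
    A x + b ∈ (F.map fun x => A x + b).hull := by
  rw [Facet.hull, Facet.pts_map, listHull_motion]
  exact ⟨x, h, rfl⟩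

theorem pts_motion (A : E3 ≃ₗᵢ[ℝ] E3) (b : E3) (F : Facet E3) :
    {x | x ∈ (F.map fun x => A x + b).pts} = (fun x => A x + b) '' {x | x ∈ F.pts} := by
  ext x; simp [Facet.pts_map]

theorem Matched.move {p q : PlacedTile} (h : p.Matched q) (A : E3 ≃ₗᵢ[ℝ] E3) (b : E3) :
    (move A b p).Matched (PlacedTile.move A b q) := by
  intro S hS T hT x hxS hxT
  rw [move_cells] at hS hT
  obtain ⟨S, hS, rfl⟩ := hS
  obtain ⟨T, hT, rfl⟩ := hT
  simp only [convexHull_motion] at hxS hxT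
  obtain ⟨y, hyS, rfl⟩ := hxS
  obtain ⟨z, hzT, hzy⟩ := hxT
  obtain rfl := motion_injective A b hzy
  obtain ⟨F, h1, h2, h3, h4, h5⟩ := h S hS T hT z hyS hzT
  refine ⟨F.map fun x => A x + b, ?_, ?_, ?_, ?_, mem_hull_motion h5⟩
  · rw [move_facets]; exact ⟨F, h1, rfl⟩
  · rw [move_facets]; exact ⟨F, h2, rfl⟩
  · rw [pts_motion]; exact Set.image_mono h3
  · rw [pts_motion]; exact Set.image_mono h4

end PlacedTile

/-! ### The tiles of the dissections -/

namespace Code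

/-- The linear map that sends the basis vectors to their given images. -/
noncomputable def rotMap (c : Code) : E3 →ₗ[ℝ] E3 :=
  coordX.smulRight (c.c₁.ev tau) + coordY.smulRight (c.c₂.ev tau) + coordZ.smulRight (c.c₃.ev tau)

theorem rotMap_ev (c : Code) (u : LVec) : c.rotMap (u.ev tau) = (c.rotate u).ev tau := by
  simp [rotMap, rotate, coordX_ev, coordY_ev, coordZ_ev, LVec.ev_add, LVec.ev_smul tau_sq]

theorem norm_sq_comb (a b c : ℝ) (u₁ u₂ u₃ : E3) :
    ‖a • u₁ + b • u₂ + c • u₃‖ ^ 2 = a * a * inner ℝ u₁ u₁ + b * b * inner ℝ u₂ u₂ +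
      c * c * inner ℝ u₃ u₃ + 2 * (a * b * inner ℝ u₁ u₂ + a * c * inner ℝ u₁ u₃ +
      b * c * inner ℝ u₂ u₃) := by
  rw [← real_inner_self_eq_norm_sq]
  simp only [inner_add_left, inner_add_right, real_inner_smul_left, real_inner_smul_right,
    real_inner_comm u₁ u₂, real_inner_comm u₁ u₃, real_inner_comm u₂ u₃]
  ring

theorem eq_comb (x : E3) : x = coordX x • (LVec.mk ⟨1, 0⟩ 0 0).ev tau +
    coordY x • (LVec.mk 0 ⟨1, 0⟩ 0).ev tau + coordZ x • (LVec.mk 0 0 ⟨1, 0⟩).ev tau := by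
  have h1 : val tau ⟨1, 0⟩ = 1 := by simp [val]
  ext j; fin_cases j <;> simp [LVec.ev, coordX, coordY, coordZ, h1] <;> ring

/-- The images of the basis vectors have the same Gram matrix as the basis, and the norm of a
combination depends only on that matrix. -/
theorem norm_rotMap {c : Code} (h : c.isometric = true) (x : E3) : ‖c.rotMap x‖ = ‖x‖ := by
  simp only [isometric, Bool.and_eq_true, decide_eq_true_eq] at h
  obtain ⟨⟨⟨⟨⟨h1, h2⟩, h3⟩, h4⟩, h5⟩, h6⟩ := h
  rw [← sq_eq_sq₀ (norm_nonneg _) (norm_nonneg _)]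
  conv_rhs => rw [eq_comb x]
  have e : c.rotMap x = coordX x • c.c₁.ev tau + coordY x • c.c₂.ev tau +
    coordZ x • c.c₃.ev tau := rfl
  rw [e, norm_sq_comb, norm_sq_comb]
  simp only [LVec.inner_ev tau_sq, h1, h2, h3, h4, h5, h6]
  rfl

/-- The rotation of a tile. -/
noncomputable def rot (c : Code) : E3 ≃ₗᵢ[ℝ] E3 :=
  -- The identity in the other case is a dummy value: all codes of the tables pass the test.
  if h : c.isometric = true then
    LinearIsometry.toLinearIsometryEquiv ⟨c.rotMap, norm_rotMap h⟩ rfl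
  else LinearIsometryEquiv.refl ℝ E3

theorem rot_ev {c : Code} (h : c.isometric = true) (u : LVec) :
    c.rot (u.ev tau) = (c.rotate u).ev tau := by
  rw [rot, dif_pos h, ← rotMap_ev]
  rfl

/-- The tile itself. -/
noncomputable def place (c : Code) : PlacedTile := ⟨c.kind, c.rot, c.t.ev tau⟩

end Code

theorem isometric_of_mem {i : Fin 4} {c : Code} (hc : c ∈ (ruleData i).codes) :
    c.isometric = true := by
  have := List.all_eq_true.1 (checkCodes_eq_true i) c hc
  simp only [Bool.and_eq_true] at this
  exact this.1

theorem label_spec {i : Fin 4} {c : Code} (hc : c ∈ (ruleData i).codes) {n : ℕ}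
    (hn : n < (kindData c.kind).verts.length) :
    c.label n < (ruleData i).table.length ∧ c.place.pos n = rulePos i (c.label n) := by
  have := List.all_eq_true.1 (checkCodes_eq_true i) c hc
  simp only [Bool.and_eq_true, List.all_eq_true, List.mem_range, decide_eq_true_eq] at this
  obtain ⟨h1, h2⟩ := this.2 n hn
  refine ⟨h1, ?_⟩
  rw [rulePos, ← h2, Code.act, LVec.ev_add, ← Code.rot_ev this.1]
  rfl

theorem lt_of_mem_cell {i : Fin 4} {C : List ℕ} (hC : C ∈ (kindData i).cells) :
    ∀ n ∈ C, n < (kindData i).verts.length := by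
  have := wellFormed_kindData i
  simp only [Kind.wellFormed, Bool.and_eq_true, List.all_eq_true, decide_eq_true_eq] at this
  exact this.1 C hC

theorem pts_subs {α : Type*} {F G : Facet α} (h : G ∈ F.subs) : ∀ a ∈ G.pts, a ∈ F.pts := by
  cases F <;> simp only [Facet.subs, List.mem_cons, List.not_mem_nil, or_false] at h <;>
    rcases h with rfl | rfl | rfl | rfl | rfl | rfl | rfl <;> simp [Facet.pts]

theorem lt_of_mem_facet {i : Fin 4} {F : Facet ℕ} (hF : F ∈ (kindData i).facets) :
    ∀ n ∈ F.pts, n < (kindData i).verts.length := by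
  have := wellFormed_kindData i
  simp only [Kind.wellFormed, Bool.and_eq_true, List.all_eq_true, List.any_eq_true] at this
  simp only [Kind.facets, List.mem_dedup, List.mem_flatMap] at hF
  obtain ⟨T, hT, hF⟩ := hF
  obtain ⟨S, hS, hTS⟩ := this.2 T hT
  intro n hn
  exact lt_of_mem_cell hS n (by simpa using hTS n (pts_subs hF n hn))

theorem map_congr_facet {α β : Type*} {f g : α → β} {F : Facet α} (h : ∀ a ∈ F.pts, f a = g a) :
    F.map f = F.map g := by
  cases F <;> simp [Facet.pts] at h <;> simp [Facet.map, h]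

section Rules

variable {i : Fin 4} {c : Code}

theorem lt_of_mem_code_cell (hc : c ∈ (ruleData i).codes) {C : List ℕ} (hC : C ∈ c.cells) :
    ∀ n ∈ C, n < (ruleData i).table.length := by
  obtain ⟨C, hC', rfl⟩ := List.mem_map.1 hC
  intro n hn
  obtain ⟨m, hm, rfl⟩ := List.mem_map.1 hn
  exact (label_spec hc (lt_of_mem_cell hC' m hm)).1

theorem mem_cells_place (hc : c ∈ (ruleData i).codes) {S : Set E3} :
    S ∈ c.place.cells ↔ ∃ C ∈ c.cells, S = {x | x ∈ C.map (rulePos i)} := by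
  have e : ∀ C ∈ (kindData c.kind).cells, C.map c.place.pos = (C.map c.label).map (rulePos i) := by
    intro C hC
    rw [List.map_map]
    exact List.map_congr_left fun n hn => (label_spec hc (lt_of_mem_cell hC n hn)).2
  rw [PlacedTile.mem_cells]
  constructor
  · rintro ⟨C, hC, rfl⟩
    exact ⟨C.map c.label, List.mem_map_of_mem hC, by rw [e C hC]⟩
  · rintro ⟨_, h, rfl⟩
    obtain ⟨C, hC, rfl⟩ := List.mem_map.1 h
    exact ⟨C, hC, by rw [e C hC]⟩

theorem mem_facets_place (hc : c ∈ (ruleData i).codes) {F : Facet E3} :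
    F ∈ c.place.facets ↔ ∃ G ∈ c.facets, F = G.map (rulePos i) := by
  have e : ∀ G ∈ (kindData c.kind).facets, G.map c.place.pos = (G.map c.label).map (rulePos i) := by
    intro G hG
    rw [Facet.map_map]
    exact map_congr_facet fun n hn => (label_spec hc (lt_of_mem_facet hG n hn)).2
  constructor
  · rintro ⟨G, hG, rfl⟩
    exact ⟨G.map c.label, List.mem_map_of_mem hG, by rw [e G hG]⟩
  · rintro ⟨_, h, rfl⟩
    obtain ⟨G, hG, rfl⟩ := List.mem_map.1 h
    exact ⟨G, hG, by rw [e G hG]⟩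

theorem matched_codes (i : Fin 4) :
    (ruleData i).codes.Pairwise fun c d => c.place.Matched d.place := by
  refine (pairwise_iff.1 (checkPairs_eq_true i)).imp_of_mem ?_
  intro c d hc hd h S hS T hT x hxS hxT
  obtain ⟨C, hC, rfl⟩ := (mem_cells_place hc).1 hS
  obtain ⟨C', hC', rfl⟩ := (mem_cells_place hd).1 hT
  have h := List.all_eq_true.1 (List.all_eq_true.1 h C hC) C' hC'
  obtain ⟨X, hX, -, hxX⟩ := separated_spec h (lt_of_mem_code_cell hc hC)
    (lt_of_mem_code_cell hd hC') hxS hxT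
  simp only [List.any_eq_true, Bool.and_eq_true, incl_iff] at hX
  obtain ⟨F, hF, ⟨⟨hXF, hFC⟩, hFC'⟩, hFd⟩ := hX
  refine ⟨F.map (rulePos i), (mem_facets_place hc).2 ⟨F, hF, rfl⟩,
    (mem_facets_place hd).2 ⟨F, by simpa using hFd, rfl⟩, ?_, ?_, ?_⟩
  · rw [Facet.pts_map]
    intro y hy
    obtain ⟨n, hn, rfl⟩ := List.mem_map.1 hy
    exact List.mem_map_of_mem (hFC n hn)
  · rw [Facet.pts_map]
    intro y hy
    obtain ⟨n, hn, rfl⟩ := List.mem_map.1 hy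
    exact List.mem_map_of_mem (hFC' n hn)
  · rw [Facet.hull, Facet.pts_map]
    exact listHull_map_mono _ hXF hxX

theorem table_spec {n : ℕ} (hn : n < (kindData i).verts.length) :
    n < (ruleData i).table.length ∧ tau • kindPos i n = rulePos i n := by
  have := checkRefine_eq_true i
  simp only [checkRefine, Bool.and_eq_true, List.all_eq_true, List.mem_range,
    decide_eq_true_eq] at this
  obtain ⟨h1, h2⟩ := this.1 n hn
  refine ⟨h1, ?_⟩
  rw [rulePos, ← h2, LVec.ev_scale tau_sq, kindPos]

theorem refineLabels_spec {F : Facet ℕ} (hF : F ∈ (kindData i).facets) :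
    (∀ G ∈ refineLabels i F, ∀ n ∈ G.pts, n < (ruleData i).table.length) ∧
    (F.map (kindPos i)).inflate = (refineLabels i F).map (Facet.map (rulePos i)) := by
  have := checkRefine_eq_true i
  simp only [checkRefine, Bool.and_eq_true, List.all_eq_true, List.mem_range,
    decide_eq_true_eq] at this
  obtain ⟨h1, h2⟩ := this.2 F hF
  refine ⟨h1, ?_⟩
  have h3 := congrArg (List.map (Facet.map (LVec.ev tau))) h2
  rw [Facet.refine_map, List.map_map] at h3
  have e : Facet.map (LVec.ev tau) ∘ Facet.map (ruleData i).pos = Facet.map (rulePos i) :=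
    funext fun G => Facet.map_map _ _ _
  rw [e] at h3
  rw [h3, Facet.inflate, Facet.refine_comp]
  congr 1
  · funext n; simp [kindPos, LVec.ev_scale tau_sq]
  · funext a b; simp [kindPos, LVec.ev_split]

/-- The subdivision that a dissection induces on an inflated boundary facet depends on the decorated
facet alone. This is why dissections on the two sides of a shared facet agree. -/
theorem inflate_facet_cell (hc : c ∈ (ruleData i).codes) {F : Facet E3} (hF : F ∈ (proto i).facets)
    {S : Set E3} (hS : S ∈ c.place.cells) {x : E3} (hx : x ∈ convexHull ℝ S)
    (hxF : x ∈ (F.map fun x => tau • x).hull) :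
    ∃ G ∈ F.inflate, G ∈ c.place.facets ∧ {x | x ∈ G.pts} ⊆ S ∧ x ∈ G.hull := by
  obtain ⟨F, hF : F ∈ (kindData i).facets, rfl⟩ := hF
  obtain ⟨C, hC, rfl⟩ := (mem_cells_place hc).1 hS
  have e : (proto i).pos = kindPos i := by
    funext n; simp [PlacedTile.pos, proto, PlacedTile.map]
  rw [e] at hxF ⊢
  have h := List.all_eq_true.1 (List.all_eq_true.1 (List.all_eq_true.1
    (checkFacets_eq_true i) F hF) c hc) C hC
  have hxF' : x ∈ listHull (F.pts.map (rulePos i)) := by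
    rw [Facet.map_map, Facet.hull, Facet.pts_map] at hxF
    convert hxF using 2
    exact List.map_congr_left fun n hn => (table_spec (lt_of_mem_facet hF n hn)).2.symm
  obtain ⟨X, hX, -, hxX⟩ := separated_spec h (lt_of_mem_code_cell hc hC)
    (fun n hn => (table_spec (lt_of_mem_facet hF n hn)).1) hx hxF'
  simp only [List.any_eq_true, Bool.and_eq_true, incl_iff] at hX
  obtain ⟨G, hG, ⟨hXG, hGC⟩, hGF⟩ := hX
  refine ⟨G.map (rulePos i), ?_, (mem_facets_place hc).2 ⟨G, hG, rfl⟩, ?_, ?_⟩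
  · rw [(refineLabels_spec hF).2]
    exact List.mem_map_of_mem (by simpa using hGF)
  · rw [Facet.pts_map]
    intro y hy
    obtain ⟨n, hn, rfl⟩ := List.mem_map.1 hy
    exact List.mem_map_of_mem (hGC n hn)
  · rw [Facet.hull, Facet.pts_map]
    exact listHull_map_mono _ hXG hxX

/-- Tiles on the two sides of a facet may meet it in different members of its subdivision; these
must again share a decorated face at every common point. -/
theorem inflate_facet_pieces {F : Facet E3} (hF : F ∈ (proto i).facets) {G H : Facet E3}
    (hG : G ∈ F.inflate) (hH : H ∈ F.inflate) {x : E3} (hxG : x ∈ G.hull) (hxH : x ∈ H.hull) :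
    ∃ K ∈ G.subs, K ∈ H.subs ∧ x ∈ K.hull := by
  obtain ⟨F, hF : F ∈ (kindData i).facets, rfl⟩ := hF
  have e : (proto i).pos = kindPos i := by
    funext n; simp [PlacedTile.pos, proto, PlacedTile.map]
  obtain ⟨hlt, href⟩ := refineLabels_spec hF
  rw [e, href, List.mem_map] at hG hH
  obtain ⟨G, hG, rfl⟩ := hG
  obtain ⟨H, hH, rfl⟩ := hH
  rw [Facet.hull, Facet.pts_map] at hxG hxH
  have h := List.all_eq_true.1 (List.all_eq_true.1 (List.all_eq_true.1
    (checkPieces_eq_true i) F hF) G hG) H hH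
  obtain ⟨X, hX, -, hxX⟩ := separated_spec h (hlt G hG) (hlt H hH) hxG hxH
  simp only [List.any_eq_true, Bool.and_eq_true, incl_iff] at hX
  obtain ⟨K, hK, hXK, hKH⟩ := hX
  refine ⟨K.map (rulePos i), ?_, ?_, ?_⟩
  · rw [Facet.subs_map]; exact List.mem_map_of_mem hK
  · rw [Facet.subs_map]; exact List.mem_map_of_mem (by simpa using hKH)
  · rw [Facet.hull, Facet.pts_map]
    exact listHull_map_mono _ hXK hxX

theorem faceToFace_proto (i : Fin 4) {S T : List ℕ} (hS : S ∈ (kindData i).cells)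
    (hT : T ∈ (kindData i).cells) {x : E3} (hxS : x ∈ listHull (S.map (kindPos i)))
    (hxT : x ∈ listHull (T.map (kindPos i))) :
    ∃ X : List ℕ, (∀ n ∈ X, n ∈ S) ∧ (∀ n ∈ X, n ∈ T) ∧ x ∈ listHull (X.map (kindPos i)) := by
  have h := List.all_eq_true.1 (List.all_eq_true.1 (checkCells_eq_true i) S hS) T hT
  -- The first case covers `S = T`, where the common face is the whole tetrahedron.
  rcases Bool.or_eq_true_iff.1 h with h | h
  · exact ⟨S, fun n hn => hn, incl_iff.1 h, hxS⟩
  -- The ranks refer to the table of the inflated tile, which begins with the scaled vertices of the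
  -- prototile; the separation is therefore applied to `τ x`.
  have hs : ∀ X : List ℕ, (∀ n ∈ X, n < (kindData i).verts.length) →
      listHull (X.map (rulePos i)) = tau • listHull (X.map (kindPos i)) := by
    intro X hX
    rw [← listHull_smul, List.map_map]
    congr 1
    exact List.map_congr_left fun n hn => (table_spec (hX n hn)).2.symm
  have hS' := lt_of_mem_cell hS
  have hT' := lt_of_mem_cell hT
  have htau : tau ≠ 0 := Real.goldenRatio_ne_zero
  obtain ⟨X, hX, hXS, hxX⟩ := separated_spec h (fun n hn => (table_spec (hS' n hn)).1)
    (fun n hn => (table_spec (hT' n hn)).1) (x := tau • x)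
    (by rw [hs S hS']; exact Set.smul_mem_smul_set hxS)
    (by rw [hs T hT']; exact Set.smul_mem_smul_set hxT)
  rw [hs X fun n hn => hS' n (hXS n hn), Set.smul_mem_smul_set_iff₀ htau] at hxX
  exact ⟨X, hXS, incl_iff.1 hX, hxX⟩

/-- Both inclusions are bisection certificates: `inner` puts each small tetrahedron into the
inflated tile, `outer` covers each inflated tetrahedron by small ones. -/
theorem support_rule (i : Fin 4) :
    (⋃ c ∈ {c | c ∈ (ruleData i).codes}, c.place.support) = tau • (proto i).support := by
  have e : (proto i).pos = kindPos i := by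
    funext n; simp [PlacedTile.pos, proto, PlacedTile.map]
  have hpos : ∀ C : List ℕ, (C.map fun n => ((kindData i).pos n).scale).map (LVec.ev tau) =
      (C.map (kindPos i)).map fun x => tau • x := by
    intro C
    simp only [List.map_map]
    exact List.map_congr_left fun n _ => LVec.ev_scale tau_sq _
  have hpos' : ∀ C : List ℕ, (C.map (ruleData i).pos).map (LVec.ev tau) = C.map (rulePos i) := by
    intro C
    simp only [List.map_map]
    rfl
  have hcover := checkCover_eq_true i
  simp only [checkCover, Bool.and_eq_true] at hcover
  have hsupp : ∀ c ∈ (ruleData i).codes, ∀ x, x ∈ c.place.support ↔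
      ∃ C ∈ c.cells, x ∈ listHull (C.map (rulePos i)) := by
    intro c hc x
    simp only [PlacedTile.support, Set.mem_iUnion₂, mem_cells_place hc, exists_prop]
    constructor
    · rintro ⟨_, ⟨C, hC, rfl⟩, hx⟩; exact ⟨C, hC, hx⟩
    · rintro ⟨C, hC, hx⟩; exact ⟨_, ⟨C, hC, rfl⟩, hx⟩
  ext x
  simp only [Set.mem_iUnion₂, Set.mem_ofPred_eq, exists_prop, Set.mem_smul_set]
  constructor
  · rintro ⟨c, hc, hx⟩
    obtain ⟨C, hC, hx⟩ := (hsupp c hc x).1 hx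
    obtain ⟨l, hl⟩ := all₂_left hcover.1 c hc
    obtain ⟨B, hB⟩ := all₂_left hl C hC
    obtain ⟨C', hC', hx'⟩ := Bisection.check_spec hB (by rwa [hpos'])
    obtain ⟨C', hC₁, rfl⟩ := List.mem_map.1 hC'
    rw [hpos, listHull_smul] at hx'
    obtain ⟨y, hy, rfl⟩ := hx'
    refine ⟨y, PlacedTile.mem_support.2 ⟨C', hC₁, ?_⟩, rfl⟩
    rwa [e]
  · rintro ⟨y, hy, rfl⟩
    obtain ⟨C, hC, hy⟩ := PlacedTile.mem_support.1 hy
    rw [e] at hy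
    obtain ⟨B, hB⟩ := all₂_left hcover.2 C hC
    obtain ⟨C', hC', hx'⟩ := Bisection.check_spec hB (x := tau • y) (by
      rw [hpos, listHull_smul]; exact Set.smul_mem_smul_set hy)
    obtain ⟨c, hc, hC'⟩ := List.mem_flatMap.1 hC'
    obtain ⟨C', hC₁, rfl⟩ := List.mem_map.1 hC'
    exact ⟨c, hc, (hsupp c hc _).2 ⟨C', hC₁, by rwa [hpos'] at hx'⟩⟩

end Rules

open GoldenInt MeasureTheory

/-! ### Interiors of tiles -/

/-- Where the continuous barycentric coordinates are all positive there is an open set, and it is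
contained in the hull. -/
theorem mem_interior_of_weights {p : Fin 4 → E3} {w : Fin 4 → E3 → ℝ} (hc : ∀ j, Continuous (w j))
    (hw : ∀ x, ∑ j, w j x • p j = x) (h1 : ∀ x, ∑ j, w j x = 1) {x : E3} (hx : ∀ j, 0 < w j x) :
    x ∈ interior (listHull [p 0, p 1, p 2, p 3]) := by
  refine mem_interior.2 ⟨⋂ j, {y | 0 < w j y}, fun y hy => ?_,
    isOpen_iInter_of_finite fun j => isOpen_lt continuous_const (hc j), Set.mem_iInter.2 hx⟩
  have := (convex_convexHull ℝ {x | x ∈ [p 0, p 1, p 2, p 3]}).sum_mem (t := Finset.univ)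
    (w := fun j => w j y) (z := p) (fun j _ => (Set.mem_iInter.1 hy j).le) (h1 y) (by
      intro j _; fin_cases j <;> exact subset_convexHull ℝ _ (by simp))
  rwa [hw] at this

/-- This point becomes the centre of the inflation-invariant tiling, where it has to be interior to
its tile. -/
theorem one_half_mem_interior : (pt 1 0 0 : E3) ∈ interior (listHull [ptA, ptB, ptP, ptQ]) := by
  have ht := one_lt_tau
  have ht0 : tau ≠ 0 := by linarith
  have ht1 : 1 + tau ≠ 0 := by linarith
  refine mem_interior_of_weights (p := ![ptA, ptB, ptP, ptQ])
    -- The barycentric coordinates with respect to the four vertices.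
    (w := ![fun x => (1 - 2 * x 0 / (1 + tau)) / 2 - x 1, fun x => (1 - 2 * x 0 / (1 + tau)) / 2 + x 1,
      fun x => x 0 / (1 + tau) - x 2 / tau, fun x => x 0 / (1 + tau) + x 2 / tau]) ?_ ?_ ?_ ?_
  · intro j; fin_cases j <;> simp <;> fun_prop
  · intro x
    simp only [Fin.sum_univ_four]
    ext j; fin_cases j <;> simp [ptA, ptB, ptP, ptQ, pt] <;> field_simp <;> ring
  · intro x
    simp [Fin.sum_univ_four]; ring
  · have h : 1 / (1 + tau) < 1 := by rw [div_lt_one (by linarith)]; linarith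
    have h' : 0 < 1 / (1 + tau) := by positivity
    have h5 := Real.sqrt_nonneg 5
    intro j; fin_cases j <;> simp [pt] <;> field_simp <;> linarith

theorem interior_nonempty_aux : (interior (listHull [ptA, ptB, ptC, ptP])).Nonempty := by
  have ht := one_lt_tau
  have ht0 : tau ≠ 0 := by linarith
  refine ⟨pt (1 / 2) 0 (-tau / 2), mem_interior_of_weights (p := ![ptA, ptB, ptC, ptP])
    (w := ![fun x => (1 + 2 * x 2 / tau) / 2 - x 1, fun x => (1 + 2 * x 2 / tau) / 2 + x 1,
      fun x => (-2 * x 2 / tau - (2 * x 0 + 2 * x 2 / tau) / tau) / 2,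
      fun x => (-2 * x 2 / tau + (2 * x 0 + 2 * x 2 / tau) / tau) / 2]) ?_ ?_ ?_ ?_⟩
  · intro j; fin_cases j <;> simp <;> fun_prop
  · intro x
    simp only [Fin.sum_univ_four]
    ext j; fin_cases j <;> simp [ptA, ptB, ptP, ptC, pt] <;> field_simp <;> ring
  · intro x
    simp [Fin.sum_univ_four]; ring
  · have h5 := Real.sqrt_nonneg 5
    intro j; fin_cases j <;> simp [pt] <;> field_simp <;> norm_num <;> positivity

theorem proto_pos (i : Fin 4) : (proto i).pos = kindPos i := by
  funext n; simp [PlacedTile.pos, proto, PlacedTile.map]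

theorem cell_subset_support {i : Fin 4} {C : List ℕ} (hC : C ∈ (kindData i).cells) :
    listHull (C.map (kindPos i)) ⊆ (proto i).support := by
  intro x hx
  refine PlacedTile.mem_support.2 ⟨C, hC, ?_⟩
  rwa [proto_pos]

theorem one_half_mem_interior_proto : (pt 1 0 0 : E3) ∈ interior (proto 0).support := by
  refine interior_mono (cell_subset_support (C := [0, 1, 4, 5]) (by decide)) ?_
  have := one_half_mem_interior
  rwa [ptA_eq, ptB_eq, ptP_eq, ptQ_eq] at this

theorem interior_proto_nonempty (i : Fin 4) : (interior (proto i).support).Nonempty := by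
  have h1 := one_half_mem_interior
  rw [ptA_eq, ptB_eq, ptP_eq, ptQ_eq] at h1
  have h2 := interior_nonempty_aux
  rw [ptA_eq, ptB_eq, ptC_eq, ptP_eq] at h2
  fin_cases i
  · exact ⟨_, one_half_mem_interior_proto⟩
  · exact h2.mono (interior_mono (cell_subset_support (i := 1) (C := [0, 1, 2, 4]) (by decide)))
  · exact ⟨_, interior_mono (cell_subset_support (i := 2) (C := [0, 1, 2, 3]) (by decide)) h1⟩
  · exact ⟨_, interior_mono (cell_subset_support (i := 3) (C := [0, 1, 2, 3]) (by decide)) h1⟩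

/-- The homeomorphism `x ↦ A x + b`. -/
noncomputable def motion (A : E3 ≃ₗᵢ[ℝ] E3) (b : E3) : E3 ≃ₜ E3 :=
  A.toHomeomorph.trans (Homeomorph.addRight b)

namespace PlacedTile

theorem eq_move (p : PlacedTile) : p = move p.rot p.trans (proto p.kind) := by
  cases p; simp [move, proto]

theorem interior_support_nonempty (p : PlacedTile) : (interior p.support).Nonempty := by
  rw [eq_move p, move_support]
  change (interior (motion p.rot p.trans '' _)).Nonempty
  rw [← Homeomorph.image_interior]
  exact (interior_proto_nonempty _).image _

end PlacedTile

theorem volume_facet_hull (F : Facet E3) : volume F.hull = 0 := by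
  obtain ⟨a, b, c, h⟩ : ∃ a b c : E3, {x | x ∈ F.pts} ⊆ {a, b, c} := by
    cases F with
    | vertex a => exact ⟨a, a, a, fun x => by simp [Facet.pts]⟩
    | short a b => exact ⟨a, b, b, fun x => by simp [Facet.pts]⟩
    | long a b => exact ⟨a, b, b, fun x => by simp [Facet.pts]⟩
    | obtuse a b c => exact ⟨a, b, c, fun x => by simp [Facet.pts]⟩
    | acute a b c => exact ⟨a, b, c, fun x => by simp [Facet.pts]⟩
  refine measure_mono_null ((convexHull_mono h).trans (convexHull_subset_affineSpan _))
    (Measure.addHaar_affineSubspace volume _ fun htop => ?_)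
  have h2 : Module.finrank ℝ (vectorSpan ℝ {a, b, c}) ≤ 2 := (coplanar_triple ℝ a b c).finrank_le_two
  rw [← direction_affineSpan, htop, AffineSubspace.direction_top, finrank_top,
    finrank_euclideanSpace_fin] at h2
  omega

namespace PlacedTile

theorem Matched.volume_inter {p q : PlacedTile} (h : p.Matched q) :
    volume (p.support ∩ q.support) = 0 := by
  refine measure_mono_null (t := ⋃ F ∈ p.facets, F.hull) ?_
    ((measure_biUnion_null_iff p.finite_facets.countable).2 fun F _ => volume_facet_hull F)
  rintro x ⟨hp, hq⟩
  simp only [support, Set.mem_iUnion₂] at hp hq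
  obtain ⟨S, hS, hxS⟩ := hp
  obtain ⟨T, hT, hxT⟩ := hq
  obtain ⟨F, hF, -, -, -, hx⟩ := h S hS T hT x hxS hxT
  exact Set.mem_biUnion hF hx

/-- The common part lies in finitely many planar facets, so the intersection of the interiors is an
open null set. -/
theorem Matched.disjoint {p q : PlacedTile} (h : p.Matched q) :
    Disjoint (interior p.support) (interior q.support) := by
  rw [Set.disjoint_iff_inter_eq_empty, ← interior_inter]
  exact (isOpen_interior.measure_eq_zero_iff volume).1
    (measure_mono_null interior_subset h.volume_inter)

/-- Matched tiles are thus distinct as placed tiles, which is what makes counting possible. -/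
theorem not_matched_self (p : PlacedTile) : ¬ p.Matched p := fun h => by
  have := h.disjoint
  rw [disjoint_self, Set.bot_eq_empty] at this
  exact p.interior_support_nonempty.ne_empty this

end PlacedTile

open PlacedTile

/-! ### The inflation rule -/

/-- The inflation rule. -/
noncomputable def dissection (i : Fin 4) : Finset PlacedTile :=
  letI := Classical.decEq PlacedTile
  ((ruleData i).codes.map Code.place).toFinset

theorem mem_dissection {i : Fin 4} {d : PlacedTile} :
    d ∈ dissection i ↔ ∃ c ∈ (ruleData i).codes, c.place = d := by
  simp [dissection]

theorem pairwise_dissection (i : Fin 4) :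
    (dissection i : Set PlacedTile).Pairwise Matched := by
  have h : ((ruleData i).codes.map Code.place).Pairwise Matched :=
    List.pairwise_map.2 (matched_codes i)
  intro d hd e he hne
  have hd' : d ∈ (ruleData i).codes.map Code.place := by simpa [dissection] using hd
  have he' : e ∈ (ruleData i).codes.map Code.place := by simpa [dissection] using he
  have : Std.Symm Matched := ⟨fun _ _ h => h.symm⟩
  exact h.forall hd' he' hne

theorem support_dissection (i : Fin 4) :
    (⋃ d ∈ (dissection i : Set PlacedTile), d.support) = tau • (proto i).support := by
  rw [← support_rule]
  ext x
  simp only [Set.mem_iUnion₂, Finset.mem_coe, mem_dissection, Set.mem_ofPred_eq, exists_prop]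
  constructor
  · rintro ⟨_, ⟨c, hc, rfl⟩, hx⟩; exact ⟨c, hc, hx⟩
  · rintro ⟨c, hc, hx⟩; exact ⟨_, ⟨c, hc, rfl⟩, hx⟩

theorem count_dissection (i j : Fin 4) :
    count (dissection i : Set PlacedTile) j = inflationMatrix i j := by
  let := Classical.decEq PlacedTile
  have hnd : ((ruleData i).codes.map Code.place).Nodup := by
    refine (List.pairwise_map.2 (matched_codes i)).imp ?_
    rintro a _ h rfl
    exact not_matched_self a h
  have e : {p ∈ (dissection i : Set PlacedTile) | p.kind = j} =
      (((ruleData i).codes.filter fun c => c.kind = j).map Code.place).toFinset := by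
    ext p
    simp only [Finset.mem_coe, mem_dissection, Set.mem_ofPred_eq, List.mem_toFinset, List.mem_map,
      List.mem_filter, decide_eq_true_eq]
    constructor
    · rintro ⟨⟨c, hc, rfl⟩, hk⟩; exact ⟨c, ⟨hc, hk⟩, rfl⟩
    · rintro ⟨c, ⟨hc, hk⟩, rfl⟩; exact ⟨⟨c, hc, rfl⟩, hk⟩
  rw [count, e, Set.ncard_coe_finset, List.toFinset_card_of_nodup
    (hnd.sublist (List.filter_sublist.map _)), List.length_map]
  clear hnd e
  fin_cases i <;> fin_cases j <;> rfl

/-- The piece of the inflated copy `p` that corresponds to the tile `d` of a dissection. -/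
noncomputable def child (p d : PlacedTile) : PlacedTile := move p.rot (tau • p.trans) d

theorem mem_inflate {P : Set PlacedTile} {e : PlacedTile} :
    e ∈ inflate dissection P ↔ ∃ p ∈ P, ∃ d ∈ dissection p.kind, child p d = e := by
  simp [inflate, child]

theorem smul_map (p : PlacedTile) (x : E3) : tau • p.map x = p.rot (tau • x) + tau • p.trans := by
  simp [PlacedTile.map]

theorem support_eq_image (p : PlacedTile) : p.support = p.map '' (proto p.kind).support := by
  conv_lhs => rw [eq_move p, move_support]
  rfl

theorem facets_eq_image (p : PlacedTile) :
    p.facets = Facet.map p.map '' (proto p.kind).facets := by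
  conv_lhs => rw [eq_move p, move_facets]
  rfl

theorem support_children (p : PlacedTile) :
    (⋃ d ∈ (dissection p.kind : Set PlacedTile), (child p d).support) = tau • p.support := by
  simp only [child, move_support]
  rw [← Set.image_iUnion₂, support_dissection, support_eq_image p]
  ext x
  simp only [Set.mem_image, Set.mem_smul_set]
  constructor
  · rintro ⟨_, ⟨y, hy, rfl⟩, rfl⟩
    exact ⟨_, ⟨y, hy, rfl⟩, smul_map p y⟩
  · rintro ⟨_, ⟨y, hy, rfl⟩, rfl⟩
    exact ⟨_, ⟨y, hy, rfl⟩, (smul_map p y).symm⟩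

theorem support_inflate (P : Set PlacedTile) :
    (⋃ e ∈ inflate dissection P, e.support) = tau • ⋃ p ∈ P, p.support := by
  simp only [inflate, Set.biUnion_iUnion, Set.biUnion_image, Set.smul_set_iUnion]
  exact Set.iUnion₂_congr fun p _ => support_children p

/-- The split point `τ a + (b - a)` is equivariant: translating `a` and `b` by `w` translates it by
`τ w`, just as it does scaled vertices. -/
theorem inflate_map_facet (p : PlacedTile) (F : Facet E3) :
    (F.map p.map).inflate = F.inflate.map (Facet.map fun x => p.rot x + tau • p.trans) := by
  rw [Facet.inflate, Facet.refine_comp, Facet.inflate, Facet.refine_map]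
  congr 1
  · funext x; exact smul_map p x
  · funext x y
    simp only [splitPoint, PlacedTile.map, map_add, map_sub, map_smul, smul_add]
    abel

theorem child_facet {p d : PlacedTile} (hd : d ∈ dissection p.kind) {F : Facet E3}
    (hF : F ∈ p.facets) {S : Set E3} (hS : S ∈ (child p d).cells) {x : E3}
    (hx : tau • x ∈ convexHull ℝ S) (hxF : x ∈ F.hull) :
    ∃ G ∈ F.inflate, G ∈ (child p d).facets ∧ {x | x ∈ G.pts} ⊆ S ∧ tau • x ∈ G.hull := by
  obtain ⟨c, hc, rfl⟩ := mem_dissection.1 hd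
  rw [facets_eq_image] at hF
  obtain ⟨F, hF, rfl⟩ := hF
  rw [child, move_cells] at hS
  obtain ⟨S, hS, rfl⟩ := hS
  have hxF' : x ∈ (F.map fun x => p.rot x + p.trans).hull := hxF
  rw [Facet.hull, Facet.pts_map, listHull_motion] at hxF'
  obtain ⟨z, hz, rfl⟩ := hxF'
  have ez : tau • (p.rot z + p.trans) = p.rot (tau • z) + tau • p.trans := by simp
  simp only [ez, convexHull_motion] at hx ⊢
  obtain ⟨y, hy, hyz⟩ := hx
  obtain rfl : y = tau • z := motion_injective p.rot (tau • p.trans) hyz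
  obtain ⟨G, hG, hGc, hGS, hGx⟩ := inflate_facet_cell hc hF hS hy (by
    rw [Facet.hull, Facet.pts_map, listHull_smul]
    exact Set.smul_mem_smul_set hz)
  refine ⟨G.map fun x => p.rot x + tau • p.trans, ?_, ?_, ?_, mem_hull_motion hGx⟩
  · rw [inflate_map_facet]; exact List.mem_map_of_mem hG
  · rw [child, move_facets]; exact ⟨G, hGc, rfl⟩
  · rw [pts_motion]; exact Set.image_mono hGS

theorem facet_pieces {p : PlacedTile} {F : Facet E3} (hF : F ∈ p.facets) {G H : Facet E3}
    (hG : G ∈ F.inflate) (hH : H ∈ F.inflate) {x : E3} (hxG : x ∈ G.hull) (hxH : x ∈ H.hull) :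
    ∃ K ∈ G.subs, K ∈ H.subs ∧ x ∈ K.hull := by
  rw [facets_eq_image] at hF
  obtain ⟨F, hF, rfl⟩ := hF
  rw [inflate_map_facet, List.mem_map] at hG hH
  obtain ⟨G, hG, rfl⟩ := hG
  obtain ⟨H, hH, rfl⟩ := hH
  rw [Facet.hull, Facet.pts_map, listHull_motion] at hxG hxH
  obtain ⟨y, hy, rfl⟩ := hxG
  obtain ⟨z, hz, hzy⟩ := hxH
  obtain rfl := motion_injective p.rot (tau • p.trans) hzy
  obtain ⟨K, hKG, hKH, hK⟩ := inflate_facet_pieces hF hG hH hy hz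
  refine ⟨_, ?_, ?_, mem_hull_motion hK⟩
  · rw [Facet.subs_map]; exact List.mem_map_of_mem hKG
  · rw [Facet.subs_map]; exact List.mem_map_of_mem hKH

theorem exists_cell_of_child {p d : PlacedTile} (hd : d ∈ dissection p.kind) {S : Set E3}
    (hS : S ∈ (child p d).cells) {x : E3} (hx : tau • x ∈ convexHull ℝ S) :
    ∃ T ∈ p.cells, x ∈ convexHull ℝ T := by
  have : tau • x ∈ tau • p.support := by
    rw [← support_children p]
    exact Set.mem_biUnion (Finset.mem_coe.2 hd) (Set.mem_biUnion hS hx)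
  rw [Set.smul_mem_smul_set_iff₀ Real.goldenRatio_ne_zero] at this
  simpa [support] using this

/-- A common point `τ x` of the children lies over a common point `x` of the parents, hence over a
decorated facet `F` of both. Each child contains `τ x` in a facet from the single list `F.inflate`,
and members of that list share a face at every common point. -/
theorem PlacedTile.Matched.child {p q d e : PlacedTile} (h : p.Matched q)
    (hd : d ∈ dissection p.kind) (he : e ∈ dissection q.kind) :
    (child p d).Matched (child q e) := by
  intro S hS T hT x hxS hxT
  obtain ⟨x, rfl⟩ : ∃ y, x = tau • y :=
    ⟨tau⁻¹ • x, by rw [smul_inv_smul₀ Real.goldenRatio_ne_zero]⟩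
  obtain ⟨S', hS', hxS'⟩ := exists_cell_of_child hd hS hxS
  obtain ⟨T', hT', hxT'⟩ := exists_cell_of_child he hT hxT
  obtain ⟨F, hFp, hFq, -, -, hxF⟩ := h S' hS' T' hT' x hxS' hxT'
  obtain ⟨G, hG, hGd, hGS, hxG⟩ := child_facet hd hFp hS hxS hxF
  obtain ⟨H, hH, hHe, hHT, hxH⟩ := child_facet he hFq hT hxT hxF
  obtain ⟨K, hKG, hKH, hxK⟩ := facet_pieces hFp hG hH hxG hxH
  exact ⟨K, subs_mem_facets hGd hKG, subs_mem_facets hHe hKH,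
    fun a ha => hGS (pts_subs hKG a ha), fun a ha => hHT (pts_subs hKH a ha), hxK⟩

theorem pairwise_inflate {P : Set PlacedTile} (h : P.Pairwise Matched) :
    (inflate dissection P).Pairwise Matched := by
  intro e he e' he' hne
  obtain ⟨p, hp, d, hd, rfl⟩ := mem_inflate.1 he
  obtain ⟨q, hq, d', hd', rfl⟩ := mem_inflate.1 he'
  -- Siblings are matched by the finite check, children of different tiles by inheritance.
  by_cases hpq : p = q
  · subst hpq
    exact (pairwise_dissection _ hd hd' fun h => hne (h ▸ rfl)).move _ _
  · exact (h hp hq hpq).child hd hd'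

theorem patch_succ (n : ℕ) (i : Fin 4) :
    patch dissection (n + 1) i = inflate dissection (patch dissection n i) :=
  Function.iterate_succ_apply' _ _ _

theorem pairwise_patch (n : ℕ) (i : Fin 4) : (patch dissection n i).Pairwise Matched := by
  induction n with
  | zero => exact Set.pairwise_singleton _ _
  | succ n ih => rw [patch_succ]; exact pairwise_inflate ih

theorem support_patch (n : ℕ) (i : Fin 4) :
    (⋃ p ∈ patch dissection n i, p.support) = tau ^ n • (proto i).support := by
  induction n with
  | zero => simp [patch]
  | succ n ih => rw [patch_succ, support_inflate, ih, smul_smul, pow_succ']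

/-- Matching only compares different tiles, and the faces inside a tile are not boundary facets; the
tetrahedra of one tile need this separate argument. -/
theorem faceToFace_self (p : PlacedTile) {S T : Set E3} (hS : S ∈ p.cells) (hT : T ∈ p.cells) :
    convexHull ℝ S ∩ convexHull ℝ T ⊆ convexHull ℝ (S ∩ T) := by
  obtain ⟨C, hC, rfl⟩ := mem_cells.1 hS
  obtain ⟨C', hC', rfl⟩ := mem_cells.1 hT
  have e : ∀ C : List ℕ, C.map p.pos = (C.map (kindPos p.kind)).map fun x => p.rot x + p.trans := by
    intro C; rw [List.map_map]; rfl
  rintro x ⟨hx, hx'⟩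
  change x ∈ listHull _ at hx
  change x ∈ listHull _ at hx'
  rw [e, listHull_motion] at hx hx'
  obtain ⟨y, hy, rfl⟩ := hx
  obtain ⟨z, hz, hzy⟩ := hx'
  obtain rfl := motion_injective p.rot p.trans hzy
  obtain ⟨X, hXC, hXC', hX⟩ := faceToFace_proto p.kind hC hC' hy hz
  have : p.rot z + p.trans ∈ listHull (X.map p.pos) := by
    rw [e, listHull_motion]; exact ⟨z, hX, rfl⟩
  refine convexHull_mono ?_ this
  intro a ha
  obtain ⟨n, hn, rfl⟩ := List.mem_map.1 ha
  exact ⟨List.mem_map_of_mem (hXC n hn), List.mem_map_of_mem (hXC' n hn)⟩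

theorem tiles_of_pairwise {P : Set PlacedTile} {X : Set E3} (hX : (⋃ p ∈ P, p.support) = X)
    (h : P.Pairwise Matched) : Tiles P X := by
  refine ⟨hX, fun p hp q hq hne => (h hp hq hne).disjoint, ?_⟩
  intro p hp q hq S hS T hT
  refine Set.Subset.antisymm ?_ (Set.subset_inter (convexHull_mono Set.inter_subset_left)
    (convexHull_mono Set.inter_subset_right))
  by_cases hpq : p = q
  · subst hpq
    exact faceToFace_self p hS hT
  · rintro x ⟨hxS, hxT⟩
    obtain ⟨F, -, -, hFS, hFT, hx⟩ := h hp hq hpq S hS T hT x hxS hxT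
    exact convexHull_mono (Set.subset_inter hFS hFT) hx

/-! ### Counting tiles -/

theorem finite_inflate {P : Set PlacedTile} (h : P.Finite) : (inflate dissection P).Finite :=
  h.biUnion fun _ _ => (Finset.finite_toSet _).image _

theorem finite_patch (n : ℕ) (i : Fin 4) : (patch dissection n i).Finite := by
  induction n with
  | zero => exact Set.finite_singleton _
  | succ n ih => rw [patch_succ]; exact finite_inflate ih

theorem move_injective (A : E3 ≃ₗᵢ[ℝ] E3) (b : E3) : Function.Injective (move A b) := by
  rintro ⟨k, R, t⟩ ⟨k', R', t'⟩ h
  simp only [move, PlacedTile.mk.injEq] at h ⊢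
  refine ⟨h.1, ?_, A.injective (add_left_injective b h.2.2)⟩
  ext x : 1
  exact A.injective (DFunLike.congr_fun h.2.1 x)

/-- Children of different tiles are matched, hence different, so the sets of children are disjoint
and their sizes add up. -/
theorem count_inflate {P : Set PlacedTile} (hf : P.Finite) (h : P.Pairwise Matched) (j : Fin 4) :
    count (inflate dissection P) j = ∑ i, count P i * inflationMatrix i j := by
  classical
  lift P to Finset PlacedTile using hf
  have e : {p ∈ inflate dissection P | p.kind = j} =
      (P.biUnion fun p => ((dissection p.kind).filter fun d => d.kind = j).image (child p) :
        Finset PlacedTile) := by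
    ext q
    simp only [mem_inflate, Set.mem_ofPred_eq, Finset.mem_coe, Finset.mem_biUnion,
      Finset.mem_image, Finset.mem_filter]
    constructor
    · rintro ⟨⟨p, hp, d, hd, rfl⟩, hk⟩; exact ⟨p, hp, d, ⟨hd, hk⟩, rfl⟩
    · rintro ⟨p, hp, d, ⟨hd, hk⟩, rfl⟩; exact ⟨⟨p, hp, d, hd, rfl⟩, hk⟩
  have hcard : ∀ p : PlacedTile, (((dissection p.kind).filter fun d => d.kind = j).image
      (child p)).card = inflationMatrix p.kind j := by
    intro p
    rw [Finset.card_image_of_injective (f := child p) _ (move_injective _ _), ← count_dissection, count,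
      ← Set.ncard_coe_finset]
    congr 1; ext d; simp
  rw [count, e, Set.ncard_coe_finset, Finset.card_biUnion]
  · simp only [hcard]
    rw [← Finset.sum_fiberwise P (fun p => p.kind)]
    refine Finset.sum_congr rfl fun i _ => ?_
    have : count (P : Set PlacedTile) i = (P.filter fun p => p.kind = i).card := by
      rw [count, ← Set.ncard_coe_finset]; congr 1; ext d; simp
    rw [this, Finset.sum_congr rfl fun p hp => by rw [(Finset.mem_filter.1 hp).2],
      Finset.sum_const, smul_eq_mul]
  · intro p hp q hq hpq
    refine Finset.disjoint_left.2 ?_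
    intro x hx hx'
    obtain ⟨d, hd, rfl⟩ := Finset.mem_image.1 hx
    obtain ⟨d', hd', heq⟩ := Finset.mem_image.1 hx'
    have := (h hp hq hpq).child (Finset.mem_filter.1 hd).1 (Finset.mem_filter.1 hd').1
    rw [heq] at this
    exact not_matched_self _ this

theorem count_patch (n : ℕ) (i j : Fin 4) :
    count (patch dissection n i) j = (inflationMatrix ^ n) i j := by
  induction n generalizing j with
  | zero =>
    by_cases hij : i = j
    · subst hij
      have : {p ∈ patch dissection 0 i | p.kind = i} = {proto i} := by
        ext p; simp only [patch, Function.iterate_zero, id, Set.mem_singleton_iff,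
          Set.mem_ofPred_eq, and_iff_left_iff_imp]
        rintro rfl; rfl
      simp [count, this]
    · have : {p ∈ patch dissection 0 i | p.kind = j} = ∅ := by
        ext p; simp only [patch, Function.iterate_zero, id, Set.mem_singleton_iff,
          Set.mem_ofPred_eq, Set.mem_empty_iff_false, iff_false, not_and]
        rintro rfl; exact hij
      simp [count, this, Matrix.one_apply_ne hij]
  | succ n ih =>
    rw [patch_succ, count_inflate (finite_patch n i) (pairwise_patch n i), pow_succ,
      Matrix.mul_apply]
    exact Finset.sum_congr rfl fun k _ => by rw [ih]

open GoldenInt PlacedTile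

/-! ### Families generated by the rule -/

/-- Matching concerns two tiles at a time, and a pair is a finite part of the family. -/
theorem GeneratedBy.pairwise {P : Set PlacedTile} (h : GeneratedBy dissection P) :
    P.Pairwise Matched := by
  intro p hp q hq hne
  obtain ⟨n, i, A, b, hF⟩ := h {p, q} (by simp [Set.insert_subset_iff, hp, hq]) (by simp)
  obtain ⟨p, hp', rfl⟩ := hF (Set.mem_insert _ _)
  obtain ⟨q, hq', rfl⟩ := hF (Set.mem_insert_of_mem _ rfl)
  exact (pairwise_patch n i hp' hq' fun h => hne (h ▸ rfl)).move A b

/-! ### A tiling that is fixed by a power of the inflation -/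

theorem inflate_mono : Monotone (inflate dissection) :=
  fun _ _ h => Set.biUnion_subset_biUnion_left h

theorem inflate_iUnion {ι : Sort*} (P : ι → Set PlacedTile) :
    inflate dissection (⋃ k, P k) = ⋃ k, inflate dissection (P k) :=
  Set.biUnion_iUnion _ _

theorem iterate_inflate_iUnion {ι : Sort*} (n : ℕ) (P : ι → Set PlacedTile) :
    (inflate dissection)^[n] (⋃ k, P k) = ⋃ k, (inflate dissection)^[n] (P k) := by
  induction n with
  | zero => rfl
  | succ n ih => simp only [Function.iterate_succ_apply', ih, inflate_iUnion]

theorem child_move (A : E3 ≃ₗᵢ[ℝ] E3) (b : E3) (p d : PlacedTile) :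
    child (move A b p) d = move A (tau • b) (child p d) := by
  simp [child, move, add_assoc]
  rfl

theorem inflate_move (A : E3 ≃ₗᵢ[ℝ] E3) (b : E3) (P : Set PlacedTile) :
    inflate dissection (move A b '' P) = move A (tau • b) '' inflate dissection P := by
  ext e
  simp only [mem_inflate, Set.mem_image]
  constructor
  · rintro ⟨_, ⟨p, hp, rfl⟩, d, hd, rfl⟩
    exact ⟨_, ⟨p, hp, d, hd, rfl⟩, (child_move A b p d).symm⟩
  · rintro ⟨_, ⟨p, hp, d, hd, rfl⟩, rfl⟩
    exact ⟨_, ⟨p, hp, rfl⟩, d, hd, child_move A b p d⟩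

theorem iterate_inflate_move (n : ℕ) (A : E3 ≃ₗᵢ[ℝ] E3) (b : E3) (P : Set PlacedTile) :
    (inflate dissection)^[n] (move A b '' P) =
      move A (tau ^ n • b) '' (inflate dissection)^[n] P := by
  induction n with
  | zero => simp
  | succ n ih => simp only [Function.iterate_succ_apply', ih, inflate_move, smul_smul, pow_succ']

theorem support_iterate_inflate (n : ℕ) (P : Set PlacedTile) :
    (⋃ p ∈ (inflate dissection)^[n] P, p.support) = tau ^ n • ⋃ p ∈ P, p.support := by
  induction n with
  | zero => simp
  | succ n ih => rw [Function.iterate_succ_apply', support_inflate, ih, smul_smul, pow_succ']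

/-- A tile of type `T₁` in the dissection of `τ T₁`, whose rotation has order three. -/
def centralCode : Code := (ruleData 0).codes.getD 3 ⟨0, 0, 0, 0, 0, []⟩

/-- The fixed point of the contraction of `T₁` to its central piece. -/
noncomputable def centralPoint : E3 := pt 1 0 0

theorem centralPoint_eq : centralPoint = (v 0 0 1 0 0 0).ev tau := by
  ext j; fin_cases j <;> simp [centralPoint, pt, LVec.ev, v, val]; norm_num

theorem centralCode_mem : centralCode ∈ (ruleData 0).codes := by
  simp [centralCode, ruleData, rule1]

/-- A linear map is determined on the lattice basis, where the third power is computed exactly. -/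
theorem centralCode_rot :
    centralCode.rot.trans (centralCode.rot.trans centralCode.rot) =
      LinearIsometryEquiv.refl ℝ E3 := by
  have h := isometric_of_mem centralCode_mem
  have e : ∀ u : LVec, centralCode.rotate (centralCode.rotate (centralCode.rotate u)) = u →
      centralCode.rot (centralCode.rot (centralCode.rot (u.ev tau))) = u.ev tau := by
    intro u hu
    rw [Code.rot_ev h, Code.rot_ev h, Code.rot_ev h, hu]
  ext x : 1
  change centralCode.rot (centralCode.rot (centralCode.rot x)) = x
  rw [Code.eq_comb x]
  simp only [map_add, map_smul]
  rw [e _ (by decide), e _ (by decide), e _ (by decide)]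

theorem centralCode_fixed :
    centralCode.rot centralPoint + centralCode.t.ev tau = tau • centralPoint := by
  rw [centralPoint_eq, Code.rot_ev (isometric_of_mem centralCode_mem), ← LVec.ev_add,
    ← LVec.ev_scale tau_sq]
  congr 1

/-- The copy of `T₁` with its central point at the origin. -/
noncomputable def centered (A : E3 ≃ₗᵢ[ℝ] E3) : PlacedTile := ⟨0, A, -A centralPoint⟩

/-- Since `centralPoint` is fixed by the contraction onto the central piece, that piece of a
centered copy is again centered, with its rotation changed by an element of order three. -/
theorem centered_mem_inflate (A : E3 ≃ₗᵢ[ℝ] E3) {P : Set PlacedTile} (h : centered A ∈ P) :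
    centered (centralCode.rot.trans A) ∈ inflate dissection P := by
  refine mem_inflate.2 ⟨_, h, centralCode.place, mem_dissection.2 ⟨_, centralCode_mem, rfl⟩, ?_⟩
  have e : A (centralCode.t.ev tau) + tau • -A centralPoint =
      -A (centralCode.rot centralPoint) := by
    rw [smul_neg, ← map_smul, ← centralCode_fixed, map_add]
    abel
  simp only [child, move, centered, Code.place, PlacedTile.mk.injEq, e]
  exact ⟨rfl, trivial, rfl⟩

/-- The centered copy of `T₁`, which the third power of the inflation reproduces. -/
noncomputable def seed : PlacedTile := centered (LinearIsometryEquiv.refl ℝ E3)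

theorem seed_mem : seed ∈ (inflate dissection)^[3] {seed} := by
  have h := centered_mem_inflate _ (centered_mem_inflate _ (centered_mem_inflate _
    (Set.mem_singleton seed)))
  rwa [LinearIsometryEquiv.trans_refl, centralCode_rot] at h

theorem seed_singleton :
    {seed} = move (LinearIsometryEquiv.refl ℝ E3) (-centralPoint) '' {proto 0} := by
  simp [seed, centered, move, proto]

theorem seed_support_mem_nhds : seed.support ∈ nhds (0 : E3) := by
  have h := one_half_mem_interior_proto
  rw [mem_interior_iff_mem_nhds] at h
  have := (motion (LinearIsometryEquiv.refl ℝ E3) (-centralPoint)).isOpenMap.image_mem_nhds h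
  have e : seed = move (LinearIsometryEquiv.refl ℝ E3) (-centralPoint) (proto 0) := by
    simp [seed, centered, move, proto]
  rw [e, move_support]
  rwa [show motion (LinearIsometryEquiv.refl ℝ E3) (-centralPoint) (pt 1 0 0) = 0 from
    add_neg_cancel centralPoint] at this

/-- The tiling generated by the centered copy of `T₁`. -/
def centralTiling : Set PlacedTile := ⋃ k : ℕ, ((inflate dissection)^[3])^[k] {seed}

theorem monotone_centralTiling : Monotone fun k : ℕ => ((inflate dissection)^[3])^[k] {seed} :=
  (inflate_mono.iterate 3).monotone_iterate_of_le_map (Set.singleton_subset_iff.2 seed_mem)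

/-- Inflation commutes with unions, so it only shifts the index of an increasing sequence. -/
theorem inflate_centralTiling : (inflate dissection)^[3] centralTiling = centralTiling := by
  rw [centralTiling, iterate_inflate_iUnion]
  simp only [← Function.iterate_succ_apply' ((inflate dissection)^[3])]
  exact monotone_centralTiling.iSup_nat_add 1

theorem generatedBy_centralTiling : GeneratedBy dissection centralTiling := by
  intro F hF hfin
  have : ∀ᶠ k in Filter.atTop, ∀ p ∈ F, p ∈ ((inflate dissection)^[3])^[k] {seed} := by
    refine (Filter.eventually_all_finite hfin).2 fun p hp => ?_
    obtain ⟨k, hk⟩ := Set.mem_iUnion.1 (hF hp)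
    filter_upwards [Filter.eventually_ge_atTop k] with l hl
    exact monotone_centralTiling hl hk
  obtain ⟨k, hk⟩ := this.exists
  refine ⟨3 * k, 0, LinearIsometryEquiv.refl ℝ E3, tau ^ (3 * k) • -centralPoint, fun p hp => ?_⟩
  have := hk p hp
  rwa [← Function.iterate_mul, seed_singleton, iterate_inflate_move] at this

theorem support_centralTiling : (⋃ p ∈ centralTiling, p.support) = Set.univ := by
  refine Set.eq_univ_of_forall fun x => ?_
  obtain ⟨ε, hε, hball⟩ := Metric.mem_nhds_iff.1 seed_support_mem_nhds
  have ht := one_lt_tau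
  obtain ⟨k, hk⟩ := pow_unbounded_of_one_lt (‖x‖ / ε) (one_lt_pow₀ ht three_ne_zero)
  rw [← pow_mul, div_lt_iff₀ hε] at hk
  have hpos : 0 < tau ^ (3 * k) := by positivity
  have hx : x ∈ tau ^ (3 * k) • seed.support := by
    rw [Set.mem_smul_set_iff_inv_smul_mem₀ hpos.ne']
    apply hball
    rw [mem_ball_zero_iff, norm_smul, norm_inv, Real.norm_of_nonneg hpos.le, inv_mul_lt_iff₀ hpos]
    exact hk
  have := support_iterate_inflate (3 * k) {seed}
  rw [Set.biUnion_singleton] at this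
  rw [← this] at hx
  obtain ⟨p, hp, hxp⟩ := Set.mem_iUnion₂.1 hx
  rw [Function.iterate_mul] at hp
  exact Set.mem_biUnion (Set.mem_iUnion.2 ⟨k, hp⟩) hxp

/-! ### Aperiodicity -/

/-- The squared norm of a lattice vector comes from an element of `ℤ[τ]`. If two of these agree as
real numbers, they agree in `ℤ[τ]` by irrationality, and so do their conjugates. -/
theorem norm_conj {R : E3 ≃ₗᵢ[ℝ] E3} {u w : LVec} (h : R (u.ev tau) = w.ev tau) :
    ‖w.ev (1 - tau)‖ = ‖u.ev (1 - tau)‖ := by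
  have h1 : inner ℝ (w.ev tau) (w.ev tau) = inner ℝ (u.ev tau) (u.ev tau) := by
    rw [← h, LinearIsometryEquiv.inner_map_map]
  rw [LVec.inner_ev tau_sq, LVec.inner_ev tau_sq, div_left_inj' (by norm_num)] at h1
  have h2 := val_injective h1
  rw [← sq_eq_sq₀ (norm_nonneg _) (norm_nonneg _), ← real_inner_self_eq_norm_sq,
    ← real_inner_self_eq_norm_sq, LVec.inner_ev conj_sq, LVec.inner_ev conj_sq, h2]

theorem exists_bound {ι α : Type*} [Finite ι] (l : ι → List α) (f : α → ℝ) :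
    ∃ B, ∀ i, ∀ x ∈ l i, f x ≤ B := by
  obtain ⟨B, hB⟩ := ((Set.finite_iUnion fun i => (l i).finite_toSet).image f).bddAbove
  exact ⟨B, fun i x hx => hB ⟨x, Set.mem_iUnion.2 ⟨i, hx⟩, rfl⟩⟩

/-- The isometry of the copy preserves the lattice, and the conjugate of its translation is
bounded by `C`. -/
def Integral (C : ℝ) (p : PlacedTile) : Prop :=
  (∀ u : LVec, ∃ w : LVec, p.rot (u.ev tau) = w.ev tau) ∧
  ∃ s : LVec, p.trans = s.ev tau ∧ ‖s.ev (1 - tau)‖ ≤ C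

theorem exists_integral : ∃ C, ∀ n i, ∀ p ∈ patch dissection n i, Integral C p := by
  obtain ⟨B, hB⟩ := exists_bound (fun i => (ruleData i).codes) fun c => ‖c.t.ev (1 - tau)‖
  have ht := one_lt_tau
  have ht2 : tau < 2 := Real.goldenRatio_lt_two
  have hB0 : 0 ≤ B := (norm_nonneg _).trans (hB 0 _ centralCode_mem)
  -- The conjugate translation of a child is at most `B + (τ - 1) C`, where `B` bounds those in the
  -- rules; `C = B / (2 - τ)` is the fixed point of this recursion.
  refine ⟨B / (2 - tau), fun n i => ?_⟩
  induction n with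
  | zero =>
    rintro p rfl
    refine ⟨fun u => ⟨u, rfl⟩, 0, by simp [proto], ?_⟩
    rw [LVec.ev_zero, norm_zero]
    exact div_nonneg hB0 (by linarith)
  | succ n ih =>
    rw [patch_succ]
    intro e he
    obtain ⟨p, hp, d, hd, rfl⟩ := mem_inflate.1 he
    obtain ⟨c, hc, rfl⟩ := mem_dissection.1 hd
    obtain ⟨h1, s, hs, hsC⟩ := ih p hp
    refine ⟨fun u => ?_, ?_⟩
    · obtain ⟨w, hw⟩ := h1 (c.rotate u)
      refine ⟨w, ?_⟩
      rw [← hw, ← Code.rot_ev (isometric_of_mem hc)]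
      rfl
    · obtain ⟨w, hw⟩ := h1 c.t
      refine ⟨w + s.scale, ?_, ?_⟩
      · rw [LVec.ev_add, LVec.ev_scale tau_sq, ← hw, ← hs]
        rfl
      · rw [LVec.ev_add, LVec.ev_scale conj_sq]
        refine (norm_add_le _ _).trans ?_
        rw [norm_conj hw, norm_smul, Real.norm_eq_abs, abs_of_neg (by linarith)]
        have h3 := hB _ _ hc
        have h4 : -(1 - tau) * ‖s.ev (1 - tau)‖ ≤ -(1 - tau) * (B / (2 - tau)) :=
          mul_le_mul_of_nonneg_left hsC (by linarith)
        have h5 : B / (2 - tau) * (2 - tau) = B := div_mul_cancel₀ _ (by linarith)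
        linarith

/-- A period is only assumed to carry bodies to bodies. Maxima of linear forms can be read off from
a body and are attained at vertices, where integrality is available. -/
theorem exists_max (p : PlacedTile) (f : E3 →ₗ[ℝ] ℝ) :
    ∃ S ∈ (kindData p.kind).cells, ∃ n ∈ S, p.pos n ∈ p.support ∧
      ∀ x ∈ p.support, f x ≤ f (p.pos n) := by
  have hmem : ∀ S ∈ (kindData p.kind).cells, ∀ n ∈ S, p.pos n ∈ p.support := fun S hS n hn =>
    mem_support.2 ⟨S, hS, subset_convexHull ℝ _ (List.mem_map_of_mem hn)⟩
  have hne : ({n | n ∈ (kindData p.kind).cells.flatten} : Set ℕ).Nonempty := by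
    obtain ⟨x, hx⟩ := p.interior_support_nonempty
    obtain ⟨S, hS, hx⟩ := mem_support.1 (interior_subset hx)
    obtain ⟨y, hy⟩ := convexHull_nonempty_iff.1 ⟨x, hx⟩
    obtain ⟨n, hn, rfl⟩ := List.mem_map.1 hy
    exact ⟨n, List.mem_flatten.2 ⟨S, hS, hn⟩⟩
  obtain ⟨n, hn, hmax⟩ := Set.exists_max_image _ (fun n => f (p.pos n)) (List.finite_toSet _) hne
  obtain ⟨S, hS, hnS⟩ := List.mem_flatten.1 hn
  refine ⟨S, hS, n, hnS, hmem S hS n hnS, fun x hx => ?_⟩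
  obtain ⟨T, hT, hx⟩ := mem_support.1 hx
  refine convexHull_min (fun y hy => ?_) (convex_halfSpace_le f.isLinear (f (p.pos n))) hx
  obtain ⟨m, hm, rfl⟩ := List.mem_map.1 hy
  exact hmax m (List.mem_flatten.2 ⟨T, hT, hm⟩)

theorem exists_max_bound : ∃ C, ∀ n i, ∀ p ∈ patch dissection n i, ∀ f : E3 →ₗ[ℝ] ℝ,
    ∃ w : LVec, ‖w.ev (1 - tau)‖ ≤ C ∧ w.ev tau ∈ p.support ∧
      ∀ x ∈ p.support, f x ≤ f (w.ev tau) := by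
  obtain ⟨C, hC⟩ := exists_integral
  obtain ⟨B, hB⟩ := exists_bound
    (fun i => (kindData i).cells.flatten.map (kindData i).pos) fun w => ‖w.ev (1 - tau)‖
  refine ⟨B + C, fun n i p hp f => ?_⟩
  obtain ⟨S, hS, m, hm, hmem, hmax⟩ := exists_max p f
  obtain ⟨h1, s, hs, hsC⟩ := hC n i p hp
  obtain ⟨w, hw⟩ := h1 ((kindData p.kind).pos m)
  have e : p.pos m = (w + s).ev tau := by
    rw [LVec.ev_add, ← hw, ← hs]
    rfl
  rw [e] at hmem hmax
  refine ⟨w + s, ?_, hmem, hmax⟩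
  rw [LVec.ev_add]
  refine (norm_add_le _ _).trans (add_le_add ?_ hsC)
  rw [norm_conj hw]
  exact hB p.kind _ (List.mem_map_of_mem (List.mem_flatten.2 ⟨S, hS, hm⟩))

theorem val_conj_eq_zero {x : GoldenInt} (h : val (1 - tau) x = 0) : x = 0 := by
  -- The conjugate `a + b (1 - τ)` is itself the value at `τ` of `(a + b) - b τ`.
  have h1 : val tau ⟨x.a + x.b, -x.b⟩ = 0 := by
    rw [← h]; simp only [val]; push_cast; ring
  have h2 := val_eq_zero h1
  have ha : x.a + x.b = 0 := congrArg GoldenInt.a h2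
  have hb : -x.b = 0 := congrArg GoldenInt.b h2
  cases x
  simp only at ha hb
  obtain rfl := neg_eq_zero.1 hb
  obtain rfl := (add_zero _).symm.trans ha
  rfl

/-- The support of `q` is that of `p` translated by `u`, so that a linear form that is integral on
the lattice takes an integral value at `u`. -/
theorem exists_val {C : ℝ} {p q : PlacedTile} {f : E3 →ₗ[ℝ] ℝ} {g : LVec → GoldenInt}
    (hf : ∀ w, f (w.ev tau) = val tau (g w))
    (hg : ∀ w, |val (1 - tau) (g w)| ≤ 6 * ‖w.ev (1 - tau)‖)
    (hp : ∃ w : LVec, ‖w.ev (1 - tau)‖ ≤ C ∧ w.ev tau ∈ p.support ∧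
      ∀ x ∈ p.support, f x ≤ f (w.ev tau))
    (hq : ∃ w : LVec, ‖w.ev (1 - tau)‖ ≤ C ∧ w.ev tau ∈ q.support ∧
      ∀ x ∈ q.support, f x ≤ f (w.ev tau)) {u : E3} (h : q.support = u +ᵥ p.support) :
    ∃ z : GoldenInt, f u = val tau z ∧ |val (1 - tau) z| ≤ 12 * C := by
  obtain ⟨a, haC, hap, ha⟩ := hp
  obtain ⟨b, hbC, hbq, hb⟩ := hq
  refine ⟨g b - g a, ?_, ?_⟩
  · rw [val_sub, ← hf, ← hf]
    -- Translation by `u` raises the maximum of `f` by `f u`, so `f u` is the difference of the two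
    -- maxima.
    have h1 := hb (u + a.ev tau) (h ▸ Set.vadd_mem_vadd_set hap)
    rw [h] at hbq
    obtain ⟨y, hy, hyb⟩ := Set.mem_vadd_set.1 hbq
    have h2 := ha y hy
    rw [← hyb, vadd_eq_add, map_add] at h1 ⊢
    rw [map_add] at h1
    linarith
  · rw [val_sub]
    have h1 := hg a
    have h2 := hg b
    have h3 := abs_sub (val (1 - tau) (g b)) (val (1 - tau) (g a))
    linarith

/-- The conjugate of `x` is at most `C / N`, so the integer `y.norm` has absolute value at most `C
|x| / N < 1` and vanishes. -/
theorem eq_zero_of_val {x : ℝ} {N : ℕ} {C : ℝ} {y z : GoldenInt} (hy : x = val tau y)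
    (hz : N * x = val tau z) (hC : |val (1 - tau) z| ≤ C) (hN : C * |x| < N) : x = 0 := by
  have e : z = (⟨N, 0⟩ : GoldenInt) * y := by
    apply val_injective
    rw [← hz, val_mul tau_sq, ← hy]
    simp [val]
  have e2 : val (1 - tau) z = N * val (1 - tau) y := by
    rw [e, val_mul conj_sq]
    simp [val]
  have hN0 : (0 : ℝ) < N :=
    lt_of_le_of_lt (mul_nonneg ((abs_nonneg _).trans hC) (abs_nonneg _)) hN
  have h1 : |(y.norm : ℝ)| < 1 := by
    rw [← val_mul_conj, ← hy, abs_mul]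
    rw [e2, abs_mul, abs_of_pos hN0] at hC
    have h2 := mul_le_mul_of_nonneg_right hC (abs_nonneg x)
    by_contra h3
    have h4 := mul_le_mul_of_nonneg_left (not_lt.1 h3) hN0.le
    linarith
  have h2 : y.norm = 0 := by
    rw [← Int.abs_lt_one_iff]
    exact_mod_cast h1
  have h3 := val_mul_conj y
  rw [h2, Int.cast_zero, mul_eq_zero] at h3
  rcases h3 with h3 | h3
  · rw [hy, h3]
  · rw [hy, val_conj_eq_zero h3, val_zero]

theorem iterate_translate {P : Set PlacedTile} {t : E3}
    (h : (fun X : Set E3 => t +ᵥ X) '' (PlacedTile.support '' P) = PlacedTile.support '' P)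
    {p : PlacedTile} (hp : p ∈ P) (N : ℕ) : ∃ q ∈ P, q.support = (N • t) +ᵥ p.support := by
  induction N with
  | zero => exact ⟨p, hp, by simp⟩
  | succ N ih =>
    obtain ⟨q, hq, hqs⟩ := ih
    have : t +ᵥ q.support ∈ PlacedTile.support '' P := by
      rw [← h]; exact ⟨_, ⟨q, hq, rfl⟩, rfl⟩
    obtain ⟨r, hr, hrs⟩ := this
    refine ⟨r, hr, ?_⟩
    rw [hrs, hqs, vadd_vadd, succ_nsmul']

theorem support_move_vadd {A : E3 ≃ₗᵢ[ℝ] E3} {b t : E3} {p q : PlacedTile}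
    (h : (move A b q).support = t +ᵥ (move A b p).support) :
    q.support = A.symm t +ᵥ p.support := by
  rw [move_support, move_support] at h
  apply (motion_injective A b).image_injective
  refine h.trans ?_
  ext x
  simp only [Set.mem_vadd_set, Set.mem_image, vadd_eq_add]
  constructor
  · rintro ⟨_, ⟨y, hy, rfl⟩, rfl⟩
    exact ⟨_, ⟨y, hy, rfl⟩, by simp [add_assoc]⟩
  · rintro ⟨_, ⟨y, hy, rfl⟩, rfl⟩
    exact ⟨_, ⟨y, hy, rfl⟩, by simp [add_assoc]⟩

theorem abs_apply_le_norm (x : E3) (j : Fin 3) : |x j| ≤ ‖x‖ := by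
  simpa using PiLp.norm_apply_le x j

theorem GeneratedBy.aperiodic {P : Set PlacedTile} (hP : GeneratedBy dissection P)
    (hne : P.Nonempty) : Aperiodic P := by
  intro t ht
  obtain ⟨C, hC⟩ := exists_max_bound
  obtain ⟨p, hp⟩ := hne
  -- The factor `12 C` bounds the conjugate in `exists_val`, and `6 ‖t‖` bounds each coordinate form
  -- at the period.
  obtain ⟨N, hN⟩ := exists_nat_gt (12 * C * (6 * ‖t‖))
  obtain ⟨q, hq, hqs⟩ := iterate_translate ht hp 1
  obtain ⟨r, hr, hrs⟩ := iterate_translate ht hp N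
  -- Three tiles suffice: `q` shows that the coordinates of the period are in `ℤ[τ]`, and `r` bounds
  -- the conjugates of their multiples by `N`.
  obtain ⟨n, i, A, b, hF⟩ := hP {p, q, r} (by simp [Set.insert_subset_iff, hp, hq, hr]) (by simp)
  obtain ⟨p, hp', rfl⟩ := hF (a := p) (by simp)
  obtain ⟨q, hq', rfl⟩ := hF (a := q) (by simp)
  obtain ⟨r, hr', rfl⟩ := hF (a := r) (by simp)
  replace hqs := support_move_vadd hqs
  replace hrs := support_move_vadd hrs
  have hu : ‖A.symm t‖ = ‖t‖ := A.symm.norm_map t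
  rw [one_nsmul] at hqs
  rw [map_nsmul] at hrs
  set u := A.symm t
  have key : ∀ (f : E3 →ₗ[ℝ] ℝ) (g : LVec → GoldenInt), (∀ w, f (w.ev tau) = val tau (g w)) →
      (∀ w, |val (1 - tau) (g w)| ≤ 6 * ‖w.ev (1 - tau)‖) → |f u| ≤ 6 * ‖u‖ → f u = 0 := by
    intro f g hf hg hfu
    obtain ⟨y, hy, -⟩ := exists_val hf hg (hC n i p hp' f) (hC n i q hq' f) hqs
    obtain ⟨z, hz, hzC⟩ := exists_val hf hg (hC n i p hp' f) (hC n i r hr' f) hrs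
    rw [map_nsmul, nsmul_eq_mul] at hz
    refine eq_zero_of_val hy hz hzC (lt_of_le_of_lt ?_ hN)
    rw [hu] at hfu
    exact mul_le_mul_of_nonneg_left hfu ((abs_nonneg _).trans hzC)
  have ht1 := one_lt_tau
  have ht2 : tau < 2 := Real.goldenRatio_lt_two
  -- Each coordinate form and its conjugate is a combination of two entries with coefficients of
  -- size at most 2 and 4, which gives the factor 6.
  have hlin : ∀ (a b x y z : ℝ), |a| ≤ 2 → |b| ≤ 4 → |x| ≤ z → |y| ≤ z →
      |a * x - b * y| ≤ 6 * z := by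
    intro a b x y z ha hb hx hy
    refine (abs_sub _ _).trans ?_
    rw [abs_mul, abs_mul]
    have h1 := mul_le_mul ha hx (abs_nonneg _) zero_le_two
    have h2 := mul_le_mul hb hy (abs_nonneg _) zero_le_four
    linarith
  have habs := abs_apply_le_norm
  have hx : coordX u = 0 := by
    refine key coordX LVec.x coordX_ev (fun w => ?_) ?_
    · have h1 : val (1 - tau) w.x = 0 * 0 - (-4) * (w.ev (1 - tau)) 2 := by
        simp [LVec.ev]; ring
      rw [h1]
      exact hlin _ _ _ _ _ (by norm_num) (by norm_num) (by simp) (habs _ _)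
    · have h1 : coordX u = 0 * 0 - (-4) * u 2 := by simp [coordX]
      rw [h1]
      exact hlin _ _ _ _ _ (by norm_num) (by norm_num) (by simp) (habs _ _)
  have hy : coordY u = 0 := by
    refine key coordY LVec.y coordY_ev (fun w => ?_) ?_
    · have h1 : val (1 - tau) w.y =
          2 * (w.ev (1 - tau)) 0 - 2 * (1 - tau) * (w.ev (1 - tau)) 2 := by
        simp [LVec.ev]; ring
      rw [h1]
      exact hlin _ _ _ _ _ (by norm_num) (abs_le.2 (by constructor <;> linarith))
        (habs _ _) (habs _ _)
    · have h1 : coordY u = 2 * u 0 - 2 * tau * u 2 := by simp [coordY]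
      rw [h1]
      exact hlin _ _ _ _ _ (by norm_num) (abs_le.2 (by constructor <;> linarith))
        (habs _ _) (habs _ _)
  have hz : coordZ u = 0 := by
    refine key coordZ LVec.z coordZ_ev (fun w => ?_) ?_
    · have h1 : val (1 - tau) w.z =
          2 * (w.ev (1 - tau)) 1 - 2 * -tau * (w.ev (1 - tau)) 2 := by
        simp [LVec.ev]; ring
      rw [h1]
      exact hlin _ _ _ _ _ (by norm_num) (abs_le.2 (by constructor <;> linarith))
        (habs _ _) (habs _ _)
    · have h1 : coordZ u = 2 * u 1 - 2 * (tau - 1) * u 2 := by simp [coordZ]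
      rw [h1]
      exact hlin _ _ _ _ _ (by norm_num) (abs_le.2 (by constructor <;> linarith))
        (habs _ _) (habs _ _)
  have : u = 0 := by
    rw [Code.eq_comb u, hx, hy, hz]
    simp
  exact A.symm.map_eq_zero_iff.1 this

open GoldenInt

/-! ### The prototiles are composite tiles -/

/-- The squares of the edge lengths of the fundamental tetrahedra, multiplied by sixteen. -/
def squaredEdges : Fin 6 → Fin 6 → GoldenInt :=
  ![![⟨16, 0⟩, ⟨16, 0⟩, ⟨16, 0⟩, ⟨16, 0⟩, ⟨16, 0⟩, ⟨16, 16⟩],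
    ![⟨16, 0⟩, ⟨16, 0⟩, ⟨16, 0⟩, ⟨16, 16⟩, ⟨16, 16⟩, ⟨16, 0⟩],
    ![⟨16, 16⟩, ⟨16, 16⟩, ⟨16, 16⟩, ⟨16, 0⟩, ⟨16, 0⟩, ⟨16, 0⟩],
    ![⟨16, 0⟩, ⟨16, 0⟩, ⟨16, 0⟩, ⟨16, 16⟩, ⟨16, 16⟩, ⟨16, 16⟩],
    ![⟨16, 16⟩, ⟨16, 16⟩, ⟨16, 16⟩, ⟨16, 16⟩, ⟨16, 0⟩, ⟨16, 0⟩],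
    ![⟨16, 0⟩, ⟨16, 16⟩, ⟨16, 16⟩, ⟨16, 16⟩, ⟨16, 16⟩, ⟨16, 16⟩]]

theorem val_squaredEdges (i j : Fin 6) :
    val tau (squaredEdges i j) / 16 = fundamentalEdges i j ^ 2 := by
  have h1 : val tau ⟨16, 0⟩ / 16 = 1 ^ 2 := by simp [val]
  have h2 : val tau ⟨16, 16⟩ / 16 = tau ^ 2 := by
    rw [tau_sq]; simp only [val]; push_cast; ring
  fin_cases i <;> fin_cases j <;> first | exact h1 | exact h2

theorem fundamentalEdges_nonneg (i j : Fin 6) : 0 ≤ fundamentalEdges i j := by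
  have h1 : (0 : ℝ) ≤ 1 := zero_le_one
  have h2 : 0 ≤ tau := Real.goldenRatio_pos.le
  fin_cases i <;> fin_cases j <;> first | exact h1 | exact h2

theorem dist_eq_fundamentalEdges {i j : Fin 6} {a b : LVec}
    (h : (a - b).bilin (a - b) = squaredEdges i j) :
    dist (a.ev tau) (b.ev tau) = fundamentalEdges i j := by
  rw [← sq_eq_sq₀ dist_nonneg (fundamentalEdges_nonneg i j), dist_eq_norm, ← LVec.ev_sub,
    ← real_inner_self_eq_norm_sq, LVec.inner_ev tau_sq, h, val_squaredEdges]

theorem isFundamental_ev {i : Fin 6} {a b c d : LVec}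
    (h : (a - b).bilin (a - b) = squaredEdges i 0 ∧ (a - c).bilin (a - c) = squaredEdges i 1 ∧
      (b - c).bilin (b - c) = squaredEdges i 2 ∧ (a - d).bilin (a - d) = squaredEdges i 3 ∧
      (b - d).bilin (b - d) = squaredEdges i 4 ∧ (c - d).bilin (c - d) = squaredEdges i 5) :
    IsFundamental i (a.ev tau) (b.ev tau) (c.ev tau) (d.ev tau) := by
  obtain ⟨h0, h1, h2, h3, h4, h5⟩ := h
  exact ⟨dist_eq_fundamentalEdges h0, dist_eq_fundamentalEdges h1, dist_eq_fundamentalEdges h2,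
    dist_eq_fundamentalEdges h3, dist_eq_fundamentalEdges h4, dist_eq_fundamentalEdges h5⟩

/-- The coefficients of a linear form that vanishes at two vectors. -/
def LVec.cross (a b : LVec) : LVec :=
  ⟨a.y * b.z - a.z * b.y, a.z * b.x - a.x * b.z, a.x * b.y - a.y * b.x⟩

theorem form_eq_of_mem_affineSpan {f : E3 →ₗ[ℝ] ℝ} {a b c x : E3} (hb : f b = f a)
    (hc : f c = f a) (hx : x ∈ affineSpan ℝ {a, b, c}) : f x = f a := by
  have h : affineSpan ℝ {a, b, c} ≤ AffineSubspace.mk' a (LinearMap.ker f) := by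
    refine affineSpan_le.2 ?_
    rintro y (rfl | rfl | rfl) <;> simp [AffineSubspace.mem_mk', *]
  have := h hx
  simpa [AffineSubspace.mem_mk', sub_eq_zero] using this

/-- The relation puts the weighted mean of `x` and `y` with positive weights `α` and `β` into the
plane of `a`, `b`, `c`; the form `f` certifies that `x` is off that plane. -/
theorem gluedAlong_of_comb {f : E3 →ₗ[ℝ] ℝ} {a b c x y : E3} {α β μ ν : ℝ} (hα : 0 < α)
    (hβ : 0 < β) (h : α • (x - a) + β • (y - a) = μ • (b - a) + ν • (c - a))
    (hb : f b = f a) (hc : f c = f a) (hx : f x ≠ f a) : GluedAlong a b c x y := by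
  have hs : 0 < α + β := add_pos hα hβ
  have hxs : x ∉ affineSpan ℝ {a, b, c} := fun h => hx (form_eq_of_mem_affineSpan hb hc h)
  have hm : ∀ s t : ℝ, s • (b - a) + t • (c - a) + a ∈ affineSpan ℝ {a, b, c} := by
    intro s t
    have ha' : a ∈ affineSpan ℝ {a, b, c} := subset_affineSpan ℝ _ (by simp)
    have hb' : b ∈ affineSpan ℝ {a, b, c} := subset_affineSpan ℝ _ (by simp)
    have hc' : c ∈ affineSpan ℝ {a, b, c} := subset_affineSpan ℝ _ (by simp)
    rw [add_assoc]
    exact AffineSubspace.smul_vsub_vadd_mem _ s hb' ha'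
      (AffineSubspace.smul_vsub_vadd_mem _ t hc' ha' ha')
  have hy : AffineMap.lineMap x y (β / (α + β)) = (μ / (α + β)) • (b - a) +
      (ν / (α + β)) • (c - a) + a := by
    have h1 : (α + β)⁻¹ • (α • (x - a) + β • (y - a)) =
        (α + β)⁻¹ • (μ • (b - a) + ν • (c - a)) := congrArg _ h
    rw [smul_add, smul_add, smul_smul, smul_smul, smul_smul, smul_smul, inv_mul_eq_div,
      inv_mul_eq_div, inv_mul_eq_div, inv_mul_eq_div] at h1
    rw [← h1, AffineMap.lineMap_apply_module]
    have h2 : α / (α + β) = 1 - β / (α + β) := by field_simp; ring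
    rw [h2]
    module
  have hm' := hm (μ / (α + β)) (ν / (α + β))
  rw [← hy] at hm'
  have hxy : x ≠ y := by
    rintro rfl
    simp at hm'
    exact hxs hm'
  refine Sbtw.sOppSide_of_notMem_of_mem ?_ hxs hm'
  rw [sbtw_lineMap_iff]
  refine ⟨hxy, by positivity, ?_⟩
  rw [div_lt_one hs]
  linarith

theorem gluedAlong_ev (α β μ ν : GoldenInt) {a b c x y : LVec}
    (h : (α.pos = true ∧ β.pos = true) ∧
      α • (x - a) + β • (y - a) = μ • (b - a) + ν • (c - a) ∧
      ((b - a).cross (c - a)).dot (b - a) = 0 ∧ ((b - a).cross (c - a)).dot (c - a) = 0 ∧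
      ((b - a).cross (c - a)).dot (x - a) ≠ 0) :
    GluedAlong (a.ev tau) (b.ev tau) (c.ev tau) (x.ev tau) (y.ev tau) := by
  obtain ⟨⟨hα, hβ⟩, hcomb, hb, hc, hx⟩ := h
  have hf : ∀ u w : LVec, ((b - a).cross (c - a)).form (u.ev tau) -
      ((b - a).cross (c - a)).form (w.ev tau) =
        val tau (((b - a).cross (c - a)).dot (u - w)) := by
    intro u w
    rw [← map_sub, ← LVec.ev_sub, LVec.form_ev]
  refine gluedAlong_of_comb (f := ((b - a).cross (c - a)).form) (μ := val tau μ) (ν := val tau ν)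
    (pos_val hα) (pos_val hβ) ?_ ?_ ?_ ?_
  · have := congrArg (LVec.ev tau) hcomb
    simpa only [LVec.ev_add, LVec.ev_sub, LVec.ev_smul tau_sq] using this
  · rw [← sub_eq_zero, hf, hb, val_zero]
  · rw [← sub_eq_zero, hf, hc, val_zero]
  · rw [← sub_ne_zero, hf]
    exact fun h => hx (val_eq_zero h)

theorem isComposite_protoCells (i : Fin 4) : IsComposite i (protoCells i) := by
  fin_cases i
  · refine ⟨ptA, ptB, ptC, ptD, ptP, ptQ, ptR, ptS, ?_, ?_, ?_, ?_, ?_, ?_, ?_, ?_, ?_, ?_, ?_, ?_,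
      rfl⟩ <;> simp only [ptA_eq, ptB_eq, ptC_eq, ptD_eq, ptP_eq, ptQ_eq, ptR_eq, ptS_eq]
    iterate 6 exact isFundamental_ev (by decide)
    -- The weights here and below are the coefficients of the linear relation between the two apices
    -- and two edges of the common face.
    · exact gluedAlong_ev ⟨0, 1⟩ ⟨-1, 1⟩ ⟨0, 1⟩ ⟨-1, 0⟩ (by decide)
    · exact gluedAlong_ev ⟨0, 1⟩ ⟨-1, 1⟩ ⟨0, 1⟩ ⟨-1, 0⟩ (by decide)
    · exact gluedAlong_ev ⟨1, 0⟩ ⟨1, 1⟩ ⟨1, 0⟩ ⟨0, 1⟩ (by decide)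
    · exact gluedAlong_ev ⟨1, 0⟩ ⟨1, 1⟩ ⟨1, 0⟩ ⟨0, 1⟩ (by decide)
    · exact gluedAlong_ev ⟨1, 1⟩ ⟨0, 1⟩ ⟨0, 1⟩ ⟨1, 0⟩ (by decide)
    · exact gluedAlong_ev ⟨1, 1⟩ ⟨0, 1⟩ ⟨0, 1⟩ ⟨1, 0⟩ (by decide)
  · refine ⟨ptA, ptB, ptC, ptU, ptP, ?_, ?_, ?_, rfl⟩ <;>
      simp only [ptA_eq, ptB_eq, ptC_eq, ptP_eq, ptU_eq]
    iterate 2 exact isFundamental_ev (by decide)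
    exact gluedAlong_ev ⟨0, 1⟩ ⟨1, 0⟩ ⟨0, 0⟩ ⟨1, 1⟩ (by decide)
  · refine ⟨ptA, ptB, ptP, ptQ, ptV, ptW, ?_, ?_, ?_, ?_, ?_, rfl⟩ <;>
      simp only [ptA_eq, ptB_eq, ptP_eq, ptQ_eq, ptV_eq, ptW_eq]
    iterate 3 exact isFundamental_ev (by decide)
    iterate 2 exact gluedAlong_ev ⟨1, 0⟩ ⟨0, 1⟩ ⟨1, 0⟩ ⟨0, 1⟩ (by decide)
  · refine ⟨ptA, ptB, ptP, ptQ, ptV, ptS, ?_, ?_, ?_, ?_, ?_, rfl⟩ <;>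
      simp only [ptA_eq, ptB_eq, ptP_eq, ptQ_eq, ptV_eq, ptS_eq]
    iterate 3 exact isFundamental_ev (by decide)
    · exact gluedAlong_ev ⟨1, 0⟩ ⟨0, 1⟩ ⟨1, 0⟩ ⟨0, 1⟩ (by decide)
    · exact gluedAlong_ev ⟨1, 0⟩ ⟨1, 1⟩ ⟨1, 0⟩ ⟨0, 1⟩ (by decide)

end IcosahedralTiling

/-! ### The main theorem -/

theorem mainTheorem1 :
    (∀ i : Fin 4, IsComposite i (protoCells i)) ∧
    ∃ D : Fin 4 → Finset PlacedTile,
      (∀ i : Fin 4, Tiles (D i : Set PlacedTile) (tau • (proto i).support) ∧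
        ∀ j : Fin 4, count (D i : Set PlacedTile) j = inflationMatrix i j) ∧
      (∀ (n : ℕ) (i : Fin 4), Tiles (patch D n i) (tau ^ n • (proto i).support) ∧
        ∀ j : Fin 4, count (patch D n i) j = (inflationMatrix ^ n) i j) ∧
      (∃ P : Set PlacedTile, GeneratedBy D P ∧ Tiles P Set.univ ∧
        ∃ m : ℕ, 0 < m ∧ (inflate D)^[m] P = P) ∧
      (∀ P : Set PlacedTile, GeneratedBy D P → (⋃ p ∈ P, p.support) = Set.univ →
        Tiles P Set.univ ∧ Aperiodic P) := by
  refine ⟨isComposite_protoCells, dissection, fun i => ⟨?_, count_dissection i⟩,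
    -- The power 3 of the inflation is the order of the rotation of the central tile.
    fun n i => ⟨?_, count_patch n i⟩, ⟨centralTiling, generatedBy_centralTiling, ?_, 3,
      three_pos, inflate_centralTiling⟩, fun P hP hcover => ⟨?_, ?_⟩⟩
  · exact tiles_of_pairwise (support_dissection i) (pairwise_dissection i)
  · exact tiles_of_pairwise (support_patch n i) (pairwise_patch n i)
  · exact tiles_of_pairwise support_centralTiling generatedBy_centralTiling.pairwise
  · exact tiles_of_pairwise hcover hP.pairwise
  · refine hP.aperiodic ?_
    obtain ⟨p, hp, -⟩ := Set.mem_iUnion₂.1 (hcover.symm ▸ Set.mem_univ (0 : E3))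
    exact ⟨p, hp⟩
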